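/- Let $\Bbbk$ be a field and let $A$, $B$ be $\Bbbk$-vector spaces that are both algebras and coalgebras (not necessarily bialgebras) such that $\epsilon_A,\epsilon_B$ are algebra maps and $\varDelta_A(1_A)=1_A\otimes 1_A$, $\varDelta_B(1_B)=1_B\otimes 1_B$. Let $\sigma:B\otimes A\to A\otimes B$, $b\otimes a\mapsto\sum a_\sigma\otimes b_\sigma$, and $\tau:A\otimes B\to B\otimes A$, $a\otimes b\mapsto\sum b_\tau\otimes a_\tau$, be linear maps such that $A\otimes B$ is a bialgebra with multiplication $(a\otimes b)(a'\otimes b')=\sum aa'_\sigma\otimes b_\sigma b'$, unit $1_A\otimes 1_B$, comultiplication $\varDelta(a\otimes b)=\sum (a_{(1)}\otimes b_{(1)\tau})\otimes(a_{(2)\tau}\otimes b_{(2)})$ and counit $\epsilon_A\otimes\epsilon_B$; this bialgebra is the smash biproduct $A{_\tau\times_\sigma}B$. Assume that $\sigma$ is right conormal: $\sum\epsilon_A(a_\sigma)b_\sigma=\epsilon_A(a)b$ for all $a\in A$, $b\in B$. A quasitriangular structure of a bialgebra $H$ is an element $\mathcal R\in H\otimes H$ with $(\epsilon_H\otimes id)(\mathcal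 R)=1_H=(id\otimes\epsilon_H)(\mathcal R)$, $(\varDelta_H\otimes id)(\mathcal R)=\mathcal R_{13}\mathcal R_{23}$, $(id\otimes\varDelta_H)(\mathcal R)=\mathcal R_{13}\mathcal R_{12}$ and $\mathcal R\varDelta_H(h)=\varDelta_H^{cop}(h)\mathcal R$ for all $h\in H$. An element $t=\sum t^1\otimes t^2\in C\otimes D$ with $C,D\in\{A,B\}$ is normalized if $\sum\epsilon_C(t^1)t^2=1_D$ and $\sum t^1\epsilon_D(t^2)=1_C$. Write $W=\sum W^1\otimes W^2$ and so on; bars denote further copies of the same element; $\sigma_i,\tau_i$ are copies of $\sigma,\tau$; $1_{B\tau_1},1_{B\tau_2},\dots$ come from different copies of $1_B$. In iterated subscripts the leftmost map is applied first. Consider elements $W\in B\otimes B$, $X\in A\otimes B$, $Y\in B\otimes A$, $Z\in A\otimes A$ and the following identities (for all $a\in A$ and $b\in B$, where they occur): - C1) $\sum Z^1_{\tau_1\tau_2}\bar X^1_{\tau_3}X^1a_{(1)\sigma_3}\,\epsilon_B((W^1Y^1)_{\sigma_3})\otimes Z^2Y^2_{\sigma_1\sigma_2}a_{(2)\sigma_4}\,\epsilon_B(1_{B\tau_1\sigma_2}\bar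 X^2_{\sigma_1})\,\epsilon_B((1_{B\tau_2}1_{B\tau_3}X^2W^2)_{\sigma_4})=\sum a_{(2)\tau}Z^1\otimes a_{(1)}Z^2_\sigma\,\epsilon_B(1_{B\tau\sigma})$; - C2) $\sum X^1a_\sigma\,\epsilon_B(W^1_\sigma)\otimes X^2W^2=\sum a_\tau X^1\otimes 1_{B\tau}X^2$; - C3) $\sum W^1Y^11_{B\tau}\otimes Y^2a_{\tau\sigma}\,\epsilon_B(W^2_\sigma)=\sum Y^1\otimes aY^2$; - C4) $\sum Z^1\otimes Z^2\epsilon_B(b)=\sum 1_{A\tau}Z^1_{\sigma_1}\otimes Z^2_{\sigma_2}\,\epsilon_B(b_{(1)\tau\sigma_2})\,\epsilon_B(b_{(2)\sigma_1})$; - C5) $\sum X^1\otimes X^2b=\sum 1_{A\tau}X^1_\sigma\,\epsilon_B(b_{(2)\sigma})\otimes b_{(1)\tau}X^2$; - C6) $\sum W^1Y^1b_\tau\otimes Y^21_{A\tau\sigma}\,\epsilon_B(W^2_\sigma)=\sum b_\sigma Y^1\otimes Y^2_\sigma$; - C7) $\sum W^1b_{(1)}\otimes W^2b_{(2)}=\sum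 b_{(2)}W^1\otimes b_{(1)}W^2$; - C8) $\sum Z^1_{(1)}\otimes Z^1_{(2)}\otimes Z^2=\sum Z^1_\tau X^1\otimes\bar Z^1\otimes Z^2\bar Z^2_\sigma\,\epsilon_B((1_{B\tau}X^2)_\sigma)$; - C9) $\sum X^1_{(1)}\otimes X^1_{(2)}\otimes X^2=\sum X^1\otimes\bar X^1\otimes X^2\bar X^2$; - C10) $\sum Y^1_{\tau_1}\otimes(Z^1_{\tau_2}X^1)_{\tau_1}\otimes Z^2Y^2_\sigma\,\epsilon_B((1_{B\tau_2}X^2)_\sigma)=\sum W^1Y^1\otimes Z^1\otimes Y^2Z^2_\sigma\,\epsilon_B(W^2_\sigma)$; - C11) $\sum W^1_\tau\otimes X^1_\tau\otimes X^2W^2=\sum W^1\otimes X^1\otimes W^2X^2$; - C12) $\sum Y^1_{(1)}\otimes Y^1_{(2)}\otimes Y^2=\sum W^1Y^1\otimes\bar Y^1\otimes Y^2\bar Y^2_\sigma\,\epsilon_B(W^2_\sigma)$; - C13) $\sum W^1_{(1)}\otimes W^1_{(2)}\otimes W^2=\sum W^1\otimes\bar W^1\otimes W^2\bar W^2$; -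 C14) $\sum Z^1\otimes Z^2_{(1)}\otimes Z^2_{(2)}=\sum Z^1_\tau X^1\bar Z^1_{\sigma_1}\,\epsilon_B(Y^1_{\sigma_1})\otimes\bar Z^2\otimes Z^2Y^2_{\sigma_2}\,\epsilon_B((1_{B\tau}X^2)_{\sigma_2})$; - C15) $\sum Z^1_{\tau_1}X^1\otimes(1_{B\tau_1}X^2)_{\tau_2}\otimes Z^2_{\tau_2}=\sum Z^1_\tau X^1\bar X^1_{\sigma_1}\,\epsilon_B(Y^1_{\sigma_1})\otimes\bar X^2\otimes Z^2Y^2_{\sigma_2}\,\epsilon_B((1_{B\tau}X^2)_{\sigma_2})$; - C16) $\sum X^1\otimes X^2_{(1)}\otimes X^2_{(2)}=\sum X^1\bar X^1_\sigma\,\epsilon_B(W^1_\sigma)\otimes\bar X^2\otimes X^2W^2$; - C17) $\sum Y^1\otimes Y^2_{(1)}\otimes Y^2_{(2)}=\sum Y^1\bar Y^1\otimes\bar Y^2\otimes Y^2$; - C18) $\sum W^1Y^1\otimes W^2_\tau\otimes Y^2_\tau=\sum Y^1W^1\otimes W^2\otimes Y^2$; - C19) $\sum W^1\otimes W^2_{(1)}\otimes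 W^2_{(2)}=\sum W^1\bar W^1\otimes\bar W^2\otimes W^2$. Then $A{_\tau\times_\sigma}B$ admits a quasitriangular structure if and only if there exist normalized elements $W\in B\otimes B$, $X\in A\otimes B$, $Y\in B\otimes A$ and $Z\in A\otimes A$ satisfying C1)–C19). In this case, for all such $W,X,Y,Z$ the element $$\alpha=\sum Z^1_{\tau_1\tau_2}\bar X^1_{\tau_3}X^1\otimes W^1Y^1\otimes Z^2Y^2_{\sigma_1\sigma_2}\,\epsilon_B(1_{B\tau_1\sigma_2}\bar X^2_{\sigma_1})\otimes 1_{B\tau_2}1_{B\tau_3}X^2W^2$$ of $(A{_\tau\times_\sigma}B)\otimes(A{_\tau\times_\sigma}B)$ is a quasitriangular structure of $A{_\tau\times_\sigma}B$, and every quasitriangular structure of $A{_\tau\times_\sigma}B$ is of this form for some such $W,X,Y,Z$. -/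

import Mathlib

open scoped TensorProduct

open Coalgebra

noncomputable section

/-! ### Quasitriangular structures on a bialgebra -/

section Quasitriangular

variable (k : Type*) {H : Type*} [Field k] [Ring H] [Bialgebra k H]

/-- `x ⊗ y ↦ (x ⊗ y) ⊗ 1`. -/
def leg12 : H ⊗[k] H →ₐ[k] (H ⊗[k] H) ⊗[k] H :=
  Algebra.TensorProduct.includeLeft

/-- `x ⊗ y ↦ (x ⊗ 1) ⊗ y`. -/
def leg13 : H ⊗[k] H →ₐ[k] (H ⊗[k] H) ⊗[k] H :=
  Algebra.TensorProduct.map Algebra.TensorProduct.includeLeft (AlgHom.id k H)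

/-- `x ⊗ y ↦ (1 ⊗ x) ⊗ y`. -/
def leg23 : H ⊗[k] H →ₐ[k] (H ⊗[k] H) ⊗[k] H :=
  Algebra.TensorProduct.map Algebra.TensorProduct.includeRight (AlgHom.id k H)

/-- `R` is a quasitriangular structure of the bialgebra `H` (`R` is not required to be
invertible; the normalization with respect to the counit is part of the definition). -/
structure IsQuasitriangular (R : H ⊗[k] H) : Prop where
  counit_left : TensorProduct.lid k H ((counit (R := k) (A := H)).rTensor H R) = 1
  counit_right : TensorProduct.rid k H ((counit (R := k) (A := H)).lTensor H R) = 1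
  comul_left : (comul (R := k) (A := H)).rTensor H R = leg13 k R * leg23 k R
  comul_right :
    (TensorProduct.assoc k H H H).symm ((comul (R := k) (A := H)).lTensor H R) =
      leg13 k R * leg12 k R
  comul_op : ∀ h : H, R * comul (R := k) h = TensorProduct.comm k H H (comul (R := k) h) * R

end Quasitriangular

/-! ### Sweedler notation -/

section Sweedler

variable {k M N P : Type*} [CommSemiring k] [AddCommMonoid M] [AddCommMonoid N]
  [AddCommMonoid P] [Module k M] [Module k N] [Module k P]

/-- `sweedler t f` is the sum `∑ f t¹ t²`, where `t = ∑ t¹ ⊗ t²` is a chosen expression of `t`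
as a finite sum of pure tensors. For bilinear `f` (the only case used) it does not depend on
that expression, see `sweedler_eq_lift`. -/
def sweedler (t : M ⊗[k] N) (f : M → N → P) : P :=
  ∑ i ∈ (TensorProduct.exists_finset t).choose, f i.1 i.2

theorem sweedler_eq_lift (t : M ⊗[k] N) (f : M →ₗ[k] N →ₗ[k] P) :
    sweedler t (fun x y => f x y) = TensorProduct.lift f t := by
  conv_rhs => rw [(TensorProduct.exists_finset t).choose_spec]
  simp [sweedler, map_sum]

theorem sweedler_tmul_self (t : M ⊗[k] N) : sweedler t (fun x y => x ⊗ₜ[k] y) = t :=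
  (TensorProduct.exists_finset t).choose_spec.symm

end Sweedler

/-! ### Smash products, smash coproducts, smash biproducts -/

section Smash

variable {k A B : Type*} [Field k]

/-- `id ⊗ f ⊗ id` on a fourfold tensor product. -/
def midMap {M N N' P P' Q : Type*} [AddCommGroup M] [AddCommGroup N] [AddCommGroup N']
    [AddCommGroup P] [AddCommGroup P'] [AddCommGroup Q] [Module k M] [Module k N] [Module k N']
    [Module k P] [Module k P'] [Module k Q] (f : N ⊗[k] P →ₗ[k] N' ⊗[k] P') :
    (M ⊗[k] N) ⊗[k] (P ⊗[k] Q) →ₗ[k] (M ⊗[k] N') ⊗[k] (P' ⊗[k] Q) :=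
  (TensorProduct.assoc k M N' (P' ⊗[k] Q)).symm.toLinearMap ∘ₗ
    ((TensorProduct.assoc k N' P' Q).toLinearMap ∘ₗ f.rTensor Q ∘ₗ
      (TensorProduct.assoc k N P Q).symm.toLinearMap).lTensor M ∘ₗ
    (TensorProduct.assoc k M N (P ⊗[k] Q)).toLinearMap

section Algebra

variable [Ring A] [Algebra k A] [Ring B] [Algebra k B]

/-- `(a ⊗ b) ⊗ (a' ⊗ b') ↦ ∑ a a'_σ ⊗ b_σ b'`. -/
def smashMul (σ : B ⊗[k] A →ₗ[k] A ⊗[k] B) :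
    (A ⊗[k] B) ⊗[k] (A ⊗[k] B) →ₗ[k] A ⊗[k] B :=
  TensorProduct.map (LinearMap.mul' k A) (LinearMap.mul' k B) ∘ₗ midMap σ

/-- `smashMul σ` is an associative multiplication on `A ⊗ B` with unit `1 ⊗ 1`. -/
structure IsSmashProduct (σ : B ⊗[k] A →ₗ[k] A ⊗[k] B) : Prop where
  mul_assoc : ∀ x y z : A ⊗[k] B,
    smashMul σ (smashMul σ (x ⊗ₜ[k] y) ⊗ₜ[k] z) = smashMul σ (x ⊗ₜ[k] smashMul σ (y ⊗ₜ[k] z))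
  one_mul : ∀ x : A ⊗[k] B, smashMul σ (((1 : A) ⊗ₜ[k] (1 : B)) ⊗ₜ[k] x) = x
  mul_one : ∀ x : A ⊗[k] B, smashMul σ (x ⊗ₜ[k] ((1 : A) ⊗ₜ[k] (1 : B))) = x

end Algebra

section Coalgebra

variable [AddCommGroup A] [Module k A] [Coalgebra k A] [AddCommGroup B] [Module k B]
  [Coalgebra k B]

/-- `a ⊗ b ↦ ∑ (a₍₁₎ ⊗ b₍₁₎_τ) ⊗ (a₍₂₎_τ ⊗ b₍₂₎)`. -/
def smashComul (τ : A ⊗[k] B →ₗ[k] B ⊗[k] A) :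
    A ⊗[k] B →ₗ[k] (A ⊗[k] B) ⊗[k] (A ⊗[k] B) :=
  midMap τ ∘ₗ TensorProduct.map (comul (R := k) (A := A)) (comul (R := k) (A := B))

variable (k A B) in
/-- `a ⊗ b ↦ ε(a) ε(b)`. -/
def smashCounit : A ⊗[k] B →ₗ[k] k :=
  LinearMap.mul' k k ∘ₗ TensorProduct.map (counit (R := k) (A := A)) (counit (R := k) (A := B))

/-- `smashComul τ` is a coassociative comultiplication on `A ⊗ B` with counit `ε ⊗ ε`. -/
structure IsSmashCoproduct (τ : A ⊗[k] B →ₗ[k] B ⊗[k] A) : Prop where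
  coassoc : ∀ x : A ⊗[k] B,
    TensorProduct.assoc k (A ⊗[k] B) (A ⊗[k] B) (A ⊗[k] B)
      ((smashComul τ).rTensor (A ⊗[k] B) (smashComul τ x)) =
    (smashComul τ).lTensor (A ⊗[k] B) (smashComul τ x)
  counit_left : ∀ x : A ⊗[k] B,
    (smashCounit k A B).rTensor (A ⊗[k] B) (smashComul τ x) = (1 : k) ⊗ₜ[k] x
  counit_right : ∀ x : A ⊗[k] B,
    (smashCounit k A B).lTensor (A ⊗[k] B) (smashComul τ x) = x ⊗ₜ[k] (1 : k)

end Coalgebra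

/-- `C` is a counital algebra via its counit: the counit is an algebra map. -/
structure IsCounitalAlgebra (k C : Type*) [Field k] [Ring C] [Algebra k C] [Coalgebra k C] :
    Prop where
  counit_one : counit (R := k) (1 : C) = 1
  counit_mul : ∀ x y : C, counit (R := k) (x * y) = counit (R := k) x * counit (R := k) y

/-- `C` is a unital coalgebra via its unit: the unit is a coalgebra map. -/
structure IsUnitalCoalgebra (k C : Type*) [Field k] [Ring C] [Algebra k C] [Coalgebra k C] :
    Prop where
  counit_one : counit (R := k) (1 : C) = 1
  comul_one : comul (R := k) (1 : C) = (1 : C) ⊗ₜ[k] (1 : C)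

variable [Ring A] [Algebra k A] [Coalgebra k A] [Ring B] [Algebra k B] [Coalgebra k B]

/-- `∑ ε(a_σ) b_σ = ε(a) b` for all `a` and `b`. -/
def IsRightConormal (σ : B ⊗[k] A →ₗ[k] A ⊗[k] B) : Prop :=
  ∀ (b : B) (a : A),
    TensorProduct.lid k B ((counit (R := k) (A := A)).rTensor B (σ (b ⊗ₜ[k] a))) =
      counit (R := k) a • b

/-- The smash product along `σ` and the smash coproduct along `τ` exist and form together a
bialgebra on `A ⊗ B`. Neither `A` nor `B` needs to be a bialgebra. -/
structure IsSmashBiproduct (σ : B ⊗[k] A →ₗ[k] A ⊗[k] B) (τ : A ⊗[k] B →ₗ[k] B ⊗[k] A) :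
    Prop extends IsSmashProduct σ, IsSmashCoproduct τ where
  counit_one : smashCounit k A B ((1 : A) ⊗ₜ[k] (1 : B)) = 1
  counit_mul : ∀ x y : A ⊗[k] B,
    smashCounit k A B (smashMul σ (x ⊗ₜ[k] y)) = smashCounit k A B x * smashCounit k A B y
  comul_one : smashComul τ ((1 : A) ⊗ₜ[k] (1 : B)) =
    ((1 : A) ⊗ₜ[k] (1 : B)) ⊗ₜ[k] ((1 : A) ⊗ₜ[k] (1 : B))
  comul_mul : ∀ x y : A ⊗[k] B,
    smashComul τ (smashMul σ (x ⊗ₜ[k] y)) =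
      TensorProduct.map (smashMul σ) (smashMul σ)
        (TensorProduct.tensorTensorTensorComm k (A ⊗[k] B) (A ⊗[k] B) (A ⊗[k] B) (A ⊗[k] B)
          (smashComul τ x ⊗ₜ[k] smashComul τ y))

/-- The vector space `A ⊗ B`, to be given the bialgebra structure of the smash biproduct. -/
def SmashBiproduct {σ : B ⊗[k] A →ₗ[k] A ⊗[k] B} {τ : A ⊗[k] B →ₗ[k] B ⊗[k] A}
    (_h : IsSmashBiproduct σ τ) : Type _ :=
  A ⊗[k] B

namespace SmashBiproduct

variable {σ : B ⊗[k] A →ₗ[k] A ⊗[k] B} {τ : A ⊗[k] B →ₗ[k] B ⊗[k] A}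
  (h : IsSmashBiproduct σ τ)

instance instAddCommGroup : AddCommGroup (SmashBiproduct h) :=
  inferInstanceAs (AddCommGroup (A ⊗[k] B))

instance instModule : Module k (SmashBiproduct h) :=
  inferInstanceAs (Module k (A ⊗[k] B))

/-- The identity map from `A ⊗ B` to the smash biproduct. -/
def of : A ⊗[k] B ≃ₗ[k] SmashBiproduct h :=
  LinearEquiv.refl k (A ⊗[k] B)

instance instRing : Ring (SmashBiproduct h) :=
  { instAddCommGroup h with
    mul := fun x y => of h (smashMul σ ((of h).symm x ⊗ₜ[k] (of h).symm y))
    one := of h ((1 : A) ⊗ₜ[k] (1 : B))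
    mul_assoc := fun x y z => h.mul_assoc x y z
    one_mul := fun x => h.one_mul x
    mul_one := fun x => h.mul_one x
    zero_mul := fun x => by
      change of h (smashMul σ ((of h).symm 0 ⊗ₜ[k] (of h).symm x)) = 0
      simp
    mul_zero := fun x => by
      change of h (smashMul σ ((of h).symm x ⊗ₜ[k] (of h).symm 0)) = 0
      simp
    left_distrib := fun x y z => by
      change of h (smashMul σ ((of h).symm x ⊗ₜ[k] (of h).symm (y + z))) =
        of h (smashMul σ ((of h).symm x ⊗ₜ[k] (of h).symm y)) +
        of h (smashMul σ ((of h).symm x ⊗ₜ[k] (of h).symm z))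
      simp [TensorProduct.tmul_add]
    right_distrib := fun x y z => by
      change of h (smashMul σ ((of h).symm (x + y) ⊗ₜ[k] (of h).symm z)) =
        of h (smashMul σ ((of h).symm x ⊗ₜ[k] (of h).symm z)) +
        of h (smashMul σ ((of h).symm y ⊗ₜ[k] (of h).symm z))
      simp [TensorProduct.add_tmul] }

theorem mul_def (x y : SmashBiproduct h) :
    x * y = of h (smashMul σ ((of h).symm x ⊗ₜ[k] (of h).symm y)) := rfl

theorem one_def : (1 : SmashBiproduct h) = of h ((1 : A) ⊗ₜ[k] (1 : B)) := rfl

instance instAlgebra : Algebra k (SmashBiproduct h) :=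
  Algebra.ofModule
    (fun r x y => by rw [mul_def, map_smul, ← TensorProduct.smul_tmul', map_smul, map_smul, mul_def])
    (fun r x y => by simp [mul_def])

theorem map_of_comp :
    TensorProduct.map (of h).toLinearMap (of h).toLinearMap ∘ₗ smashComul τ ∘ₗ
      (of h).symm.toLinearMap = smashComul τ :=
  congrArg (fun g => g ∘ₗ smashComul τ)
    (TensorProduct.map_id (R := k) (M := A ⊗[k] B) (N := A ⊗[k] B))

instance instCoalgebra : Coalgebra k (SmashBiproduct h) where
  comul := TensorProduct.map (of h).toLinearMap (of h).toLinearMap ∘ₗ smashComul τ ∘ₗ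
    (of h).symm.toLinearMap
  counit := smashCounit k A B ∘ₗ (of h).symm.toLinearMap
  coassoc := by
    refine LinearMap.ext fun x => ?_
    simp only [map_of_comp]
    exact h.coassoc x
  rTensor_counit_comp_comul := by
    refine LinearMap.ext fun x => ?_
    rw [map_of_comp]
    exact h.counit_left x
  lTensor_counit_comp_comul := by
    refine LinearMap.ext fun x => ?_
    rw [map_of_comp]
    exact h.counit_right x

theorem comul_def (x : SmashBiproduct h) :
    comul (R := k) x =
      TensorProduct.map (of h).toLinearMap (of h).toLinearMap (smashComul τ ((of h).symm x)) :=
  rfl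

theorem counit_def (x : SmashBiproduct h) :
    counit (R := k) x = smashCounit k A B ((of h).symm x) :=
  rfl

instance instBialgebra : Bialgebra k (SmashBiproduct h) :=
  Bialgebra.mk' k (SmashBiproduct h)
    h.counit_one
    (h.counit_mul _ _)
    (by
      change TensorProduct.map (of h).toLinearMap (of h).toLinearMap
        (smashComul τ ((1 : A) ⊗ₜ[k] (1 : B))) = _
      rw [h.comul_one]
      rfl)
    (by
      intro x y
      change TensorProduct.map (of h).toLinearMap (of h).toLinearMap
          (smashComul τ (smashMul σ ((of h).symm x ⊗ₜ[k] (of h).symm y))) =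
        TensorProduct.map (of h).toLinearMap (of h).toLinearMap (smashComul τ ((of h).symm x)) *
        TensorProduct.map (of h).toLinearMap (of h).toLinearMap (smashComul τ ((of h).symm y))
      rw [h.comul_mul]
      generalize smashComul τ ((of h).symm x) = s
      generalize smashComul τ ((of h).symm y) = t
      induction s with
      | zero => simp
      | add s₁ s₂ h₁ h₂ => simp only [TensorProduct.add_tmul, map_add, add_mul, h₁, h₂]
      | tmul p q =>
        induction t with
        | zero => simp
        | add t₁ t₂ h₁ h₂ => simp only [TensorProduct.tmul_add, map_add, mul_add, h₁, h₂]
        | tmul p' q' => simp [mul_def])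

end SmashBiproduct

/-! ### Normalized elements, the identities on them, and the reconstructed element -/

/-- `∑ ε(t¹) t² = 1` and `∑ t¹ ε(t²) = 1`. -/
structure IsNormalized {C D : Type*} [Ring C] [Algebra k C] [Coalgebra k C] [Ring D]
    [Algebra k D] [Coalgebra k D] (t : C ⊗[k] D) : Prop where
  left : TensorProduct.lid k D ((counit (R := k) (A := C)).rTensor D t) = 1
  right : TensorProduct.rid k C ((counit (R := k) (A := D)).lTensor C t) = 1

/-- The nineteen identities on `W`, `X`, `Y`, `Z`. Here `e, e₁, …` stand for the components `1_{B τ}`, `u, v` for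
auxiliary components, and a prime marks a component after an application of `σ` or `τ`.
The letters `p` and `q` denote second copies (`p` of `X`, `q` of any of the four). -/
structure FactorIdentities (σ : B ⊗[k] A →ₗ[k] A ⊗[k] B) (τ : A ⊗[k] B →ₗ[k] B ⊗[k] A)
    (W : B ⊗[k] B) (X : A ⊗[k] B) (Y : B ⊗[k] A) (Z : A ⊗[k] A) : Prop where
  C1 : ∀ a : A,
    (sweedler Z fun z₁ z₂ => sweedler X fun p₁ p₂ => sweedler X fun x₁ x₂ =>
      sweedler W fun w₁ w₂ => sweedler Y fun y₁ y₂ =>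
      sweedler (comul (R := k) a) fun a₁ a₂ =>
      sweedler (τ (z₁ ⊗ₜ[k] (1 : B))) fun e₁ z₁' =>
      sweedler (τ (z₁' ⊗ₜ[k] (1 : B))) fun e₂ z₁'' =>
      sweedler (τ (p₁ ⊗ₜ[k] (1 : B))) fun e₃ p₁' =>
      sweedler (σ (p₂ ⊗ₜ[k] y₂)) fun y₂' p₂' =>
      sweedler (σ (e₁ ⊗ₜ[k] y₂')) fun y₂'' e₁' =>
      sweedler (σ ((w₁ * y₁) ⊗ₜ[k] a₁)) fun a₁' u =>
      sweedler (σ ((e₂ * e₃ * x₂ * w₂) ⊗ₜ[k] a₂)) fun a₂' v =>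
        (counit (R := k) u * counit (R := k) (e₁' * p₂') * counit (R := k) v) •
          ((z₁'' * p₁' * x₁ * a₁') ⊗ₜ[k] (z₂ * y₂'' * a₂'))) =
    (sweedler Z fun z₁ z₂ => sweedler (comul (R := k) a) fun a₁ a₂ =>
      sweedler (τ (a₂ ⊗ₜ[k] (1 : B))) fun e a₂' =>
      sweedler (σ (e ⊗ₜ[k] z₂)) fun z₂' e' =>
        counit (R := k) e' • ((a₂' * z₁) ⊗ₜ[k] (a₁ * z₂')))
  C2 : ∀ a : A,
    (sweedler X fun x₁ x₂ => sweedler W fun w₁ w₂ =>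
      sweedler (σ (w₁ ⊗ₜ[k] a)) fun a' w₁' =>
        counit (R := k) w₁' • ((x₁ * a') ⊗ₜ[k] (x₂ * w₂))) =
    (sweedler X fun x₁ x₂ => sweedler (τ (a ⊗ₜ[k] (1 : B))) fun e a' =>
      (a' * x₁) ⊗ₜ[k] (e * x₂))
  C3 : ∀ a : A,
    (sweedler W fun w₁ w₂ => sweedler Y fun y₁ y₂ =>
      sweedler (τ (a ⊗ₜ[k] (1 : B))) fun e a' =>
      sweedler (σ (w₂ ⊗ₜ[k] a')) fun a'' w₂' =>
        counit (R := k) w₂' • ((w₁ * y₁ * e) ⊗ₜ[k] (y₂ * a''))) =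
    (sweedler Y fun y₁ y₂ => y₁ ⊗ₜ[k] (a * y₂))
  C4 : ∀ b : B,
    (sweedler Z fun z₁ z₂ => counit (R := k) b • (z₁ ⊗ₜ[k] z₂)) =
    (sweedler Z fun z₁ z₂ => sweedler (comul (R := k) b) fun b₁ b₂ =>
      sweedler (τ ((1 : A) ⊗ₜ[k] b₁)) fun b₁' u =>
      sweedler (σ (b₂ ⊗ₜ[k] z₁)) fun z₁' b₂' =>
      sweedler (σ (b₁' ⊗ₜ[k] z₂)) fun z₂' b₁'' =>
        (counit (R := k) b₁'' * counit (R := k) b₂') • ((u * z₁') ⊗ₜ[k] z₂'))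
  C5 : ∀ b : B,
    (sweedler X fun x₁ x₂ => x₁ ⊗ₜ[k] (x₂ * b)) =
    (sweedler X fun x₁ x₂ => sweedler (comul (R := k) b) fun b₁ b₂ =>
      sweedler (τ ((1 : A) ⊗ₜ[k] b₁)) fun b₁' u =>
      sweedler (σ (b₂ ⊗ₜ[k] x₁)) fun x₁' b₂' =>
        counit (R := k) b₂' • ((u * x₁') ⊗ₜ[k] (b₁' * x₂)))
  C6 : ∀ b : B,
    (sweedler W fun w₁ w₂ => sweedler Y fun y₁ y₂ =>
      sweedler (τ ((1 : A) ⊗ₜ[k] b)) fun b' u =>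
      sweedler (σ (w₂ ⊗ₜ[k] u)) fun u' w₂' =>
        counit (R := k) w₂' • ((w₁ * y₁ * b') ⊗ₜ[k] (y₂ * u'))) =
    (sweedler Y fun y₁ y₂ => sweedler (σ (b ⊗ₜ[k] y₂)) fun y₂' b' =>
      (b' * y₁) ⊗ₜ[k] y₂')
  C7 : ∀ b : B,
    (sweedler W fun w₁ w₂ => sweedler (comul (R := k) b) fun b₁ b₂ =>
      (w₁ * b₁) ⊗ₜ[k] (w₂ * b₂)) =
    (sweedler W fun w₁ w₂ => sweedler (comul (R := k) b) fun b₁ b₂ =>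
      (b₂ * w₁) ⊗ₜ[k] (b₁ * w₂))
  C8 :
    (sweedler Z fun z₁ z₂ => sweedler (comul (R := k) z₁) fun s t =>
      s ⊗ₜ[k] (t ⊗ₜ[k] z₂)) =
    (sweedler Z fun z₁ z₂ => sweedler X fun x₁ x₂ => sweedler Z fun q₁ q₂ =>
      sweedler (τ (z₁ ⊗ₜ[k] (1 : B))) fun e z₁' =>
      sweedler (σ ((e * x₂) ⊗ₜ[k] q₂)) fun q₂' u =>
        counit (R := k) u • ((z₁' * x₁) ⊗ₜ[k] (q₁ ⊗ₜ[k] (z₂ * q₂'))))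
  C9 :
    (sweedler X fun x₁ x₂ => sweedler (comul (R := k) x₁) fun s t =>
      s ⊗ₜ[k] (t ⊗ₜ[k] x₂)) =
    (sweedler X fun x₁ x₂ => sweedler X fun p₁ p₂ =>
      x₁ ⊗ₜ[k] (p₁ ⊗ₜ[k] (x₂ * p₂)))
  C10 :
    (sweedler Z fun z₁ z₂ => sweedler X fun x₁ x₂ => sweedler Y fun y₁ y₂ =>
      sweedler (τ (z₁ ⊗ₜ[k] (1 : B))) fun e z₁' =>
      sweedler (τ ((z₁' * x₁) ⊗ₜ[k] y₁)) fun y₁' v =>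
      sweedler (σ ((e * x₂) ⊗ₜ[k] y₂)) fun y₂' u =>
        counit (R := k) u • (y₁' ⊗ₜ[k] (v ⊗ₜ[k] (z₂ * y₂')))) =
    (sweedler W fun w₁ w₂ => sweedler Y fun y₁ y₂ => sweedler Z fun z₁ z₂ =>
      sweedler (σ (w₂ ⊗ₜ[k] z₂)) fun z₂' w₂' =>
        counit (R := k) w₂' • ((w₁ * y₁) ⊗ₜ[k] (z₁ ⊗ₜ[k] (y₂ * z₂'))))
  C11 :
    (sweedler W fun w₁ w₂ => sweedler X fun x₁ x₂ =>
      sweedler (τ (x₁ ⊗ₜ[k] w₁)) fun w₁' x₁' =>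
        w₁' ⊗ₜ[k] (x₁' ⊗ₜ[k] (x₂ * w₂))) =
    (sweedler W fun w₁ w₂ => sweedler X fun x₁ x₂ =>
      w₁ ⊗ₜ[k] (x₁ ⊗ₜ[k] (w₂ * x₂)))
  C12 :
    (sweedler Y fun y₁ y₂ => sweedler (comul (R := k) y₁) fun s t =>
      s ⊗ₜ[k] (t ⊗ₜ[k] y₂)) =
    (sweedler W fun w₁ w₂ => sweedler Y fun y₁ y₂ => sweedler Y fun q₁ q₂ =>
      sweedler (σ (w₂ ⊗ₜ[k] q₂)) fun q₂' w₂' =>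
        counit (R := k) w₂' • ((w₁ * y₁) ⊗ₜ[k] (q₁ ⊗ₜ[k] (y₂ * q₂'))))
  C13 :
    (sweedler W fun w₁ w₂ => sweedler (comul (R := k) w₁) fun s t =>
      s ⊗ₜ[k] (t ⊗ₜ[k] w₂)) =
    (sweedler W fun w₁ w₂ => sweedler W fun q₁ q₂ =>
      w₁ ⊗ₜ[k] (q₁ ⊗ₜ[k] (w₂ * q₂)))
  C14 :
    (sweedler Z fun z₁ z₂ => sweedler (comul (R := k) z₂) fun s t =>
      z₁ ⊗ₜ[k] (s ⊗ₜ[k] t)) =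
    (sweedler Z fun z₁ z₂ => sweedler X fun x₁ x₂ => sweedler Z fun q₁ q₂ =>
      sweedler Y fun y₁ y₂ =>
      sweedler (τ (z₁ ⊗ₜ[k] (1 : B))) fun e z₁' =>
      sweedler (σ (y₁ ⊗ₜ[k] q₁)) fun q₁' y₁' =>
      sweedler (σ ((e * x₂) ⊗ₜ[k] y₂)) fun y₂' u =>
        (counit (R := k) y₁' * counit (R := k) u) •
          ((z₁' * x₁ * q₁') ⊗ₜ[k] (q₂ ⊗ₜ[k] (z₂ * y₂'))))
  C15 :
    (sweedler Z fun z₁ z₂ => sweedler X fun x₁ x₂ =>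
      sweedler (τ (z₁ ⊗ₜ[k] (1 : B))) fun e z₁' =>
      sweedler (τ (z₂ ⊗ₜ[k] (e * x₂))) fun u z₂' =>
        (z₁' * x₁) ⊗ₜ[k] (u ⊗ₜ[k] z₂')) =
    (sweedler Z fun z₁ z₂ => sweedler X fun x₁ x₂ => sweedler X fun p₁ p₂ =>
      sweedler Y fun y₁ y₂ =>
      sweedler (τ (z₁ ⊗ₜ[k] (1 : B))) fun e z₁' =>
      sweedler (σ (y₁ ⊗ₜ[k] p₁)) fun p₁' y₁' =>
      sweedler (σ ((e * x₂) ⊗ₜ[k] y₂)) fun y₂' u =>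
        (counit (R := k) y₁' * counit (R := k) u) •
          ((z₁' * x₁ * p₁') ⊗ₜ[k] (p₂ ⊗ₜ[k] (z₂ * y₂'))))
  C16 :
    (sweedler X fun x₁ x₂ => sweedler (comul (R := k) x₂) fun s t =>
      x₁ ⊗ₜ[k] (s ⊗ₜ[k] t)) =
    (sweedler X fun x₁ x₂ => sweedler X fun p₁ p₂ => sweedler W fun w₁ w₂ =>
      sweedler (σ (w₁ ⊗ₜ[k] p₁)) fun p₁' w₁' =>
        counit (R := k) w₁' • ((x₁ * p₁') ⊗ₜ[k] (p₂ ⊗ₜ[k] (x₂ * w₂))))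
  C17 :
    (sweedler Y fun y₁ y₂ => sweedler (comul (R := k) y₂) fun s t =>
      y₁ ⊗ₜ[k] (s ⊗ₜ[k] t)) =
    (sweedler Y fun y₁ y₂ => sweedler Y fun q₁ q₂ =>
      (y₁ * q₁) ⊗ₜ[k] (q₂ ⊗ₜ[k] y₂))
  C18 :
    (sweedler W fun w₁ w₂ => sweedler Y fun y₁ y₂ =>
      sweedler (τ (y₂ ⊗ₜ[k] w₂)) fun w₂' y₂' =>
        (w₁ * y₁) ⊗ₜ[k] (w₂' ⊗ₜ[k] y₂')) =
    (sweedler Y fun y₁ y₂ => sweedler W fun w₁ w₂ =>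
      (y₁ * w₁) ⊗ₜ[k] (w₂ ⊗ₜ[k] y₂))
  C19 :
    (sweedler W fun w₁ w₂ => sweedler (comul (R := k) w₂) fun s t =>
      w₁ ⊗ₜ[k] (s ⊗ₜ[k] t)) =
    (sweedler W fun w₁ w₂ => sweedler W fun q₁ q₂ =>
      (w₁ * q₁) ⊗ₜ[k] (q₂ ⊗ₜ[k] w₂))

/-- The element `α` of `(A ⊗ B) ⊗ (A ⊗ B)` built from `W`, `X`, `Y`, `Z`, in the notation of
`FactorIdentities`. -/
def reconstruct (σ : B ⊗[k] A →ₗ[k] A ⊗[k] B) (τ : A ⊗[k] B →ₗ[k] B ⊗[k] A)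
    (W : B ⊗[k] B) (X : A ⊗[k] B) (Y : B ⊗[k] A) (Z : A ⊗[k] A) :
    (A ⊗[k] B) ⊗[k] (A ⊗[k] B) :=
  sweedler Z fun z₁ z₂ => sweedler X fun p₁ p₂ => sweedler X fun x₁ x₂ =>
  sweedler W fun w₁ w₂ => sweedler Y fun y₁ y₂ =>
  sweedler (τ (z₁ ⊗ₜ[k] (1 : B))) fun e₁ z₁' =>
  sweedler (τ (z₁' ⊗ₜ[k] (1 : B))) fun e₂ z₁'' =>
  sweedler (τ (p₁ ⊗ₜ[k] (1 : B))) fun e₃ p₁' =>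
  sweedler (σ (p₂ ⊗ₜ[k] y₂)) fun y₂' p₂' =>
  sweedler (σ (e₁ ⊗ₜ[k] y₂')) fun y₂'' e₁' =>
    counit (R := k) (e₁' * p₂') •
      (((z₁'' * p₁' * x₁) ⊗ₜ[k] (w₁ * y₁)) ⊗ₜ[k]
        ((z₂ * y₂'') ⊗ₜ[k] (e₂ * e₃ * x₂ * w₂)))

/-- `reconstruct` as an element of the tensor square of the smash biproduct. -/
def SmashBiproduct.alpha {σ : B ⊗[k] A →ₗ[k] A ⊗[k] B} {τ : A ⊗[k] B →ₗ[k] B ⊗[k] A}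
    (h : IsSmashBiproduct σ τ) (W : B ⊗[k] B) (X : A ⊗[k] B) (Y : B ⊗[k] A) (Z : A ⊗[k] A) :
    SmashBiproduct h ⊗[k] SmashBiproduct h :=
  TensorProduct.map (SmashBiproduct.of h).toLinearMap (SmashBiproduct.of h).toLinearMap
    (reconstruct σ τ W X Y Z)

/-- `W`, `X`, `Y`, `Z` are normalized and satisfy the nineteen identities. -/
structure IsFactorDatum (σ : B ⊗[k] A →ₗ[k] A ⊗[k] B) (τ : A ⊗[k] B →ₗ[k] B ⊗[k] A)
    (W : B ⊗[k] B) (X : A ⊗[k] B) (Y : B ⊗[k] A) (Z : A ⊗[k] A) : Prop where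
  normalized_W : IsNormalized W
  normalized_X : IsNormalized X
  normalized_Y : IsNormalized Y
  normalized_Z : IsNormalized Z
  identities : FactorIdentities σ τ W X Y Z

end Smash

end

/-! Write H for the smash biproduct, with projections πA : a ⊗ b ↦ ε(b)a and πB : a ⊗ b ↦ ε(a)b. The
map δ = (πA ⊗ πB)Δ is the identity of A ⊗ B, while (πB ⊗ πA)Δ is τ. Both projections are coalgebra
maps. Right conormality of σ makes πB an algebra map. The projection πA is in general not one, but
πA(xy) = x ▷ πA(y) for an action ▷ of H on A, so A is a quotient left H-module. These facts are
collected in `SmashBiproduct.isSplitting`.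

Since δ is injective, an equation in tensor powers of H may be tested after applying δ to one of its
legs. Coassociativity distributes the coproduct over the projected legs. Where δ meets a leg on
which copies of R are multiplied, the opposite hexagon identity expands δ, as in the two
computations of (Δ ⊗ Δ)R. Replacing projected legs by full ones, one at a time, shows that both
hexagon identities follow from fifteen projected ones (`IsSplitting.hexagons`). In the same way,
RΔ(h) = Δᵒᵖ(h)R follows from its projections for h in A and in B, which generate H
(`IsSplitting.mulComul_eq`).

Let W, X, Y, Z be the BB, AB, BA and AA projections of R. Three of the fifteen hexagons compute
rather than constrain: since δ is the identity, those whose comultiplied legs go to A and B in this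
order express R and its half-projections through W, X, Y, Z. In particular R is the product, in the
last leg, of its (A,H) and (B,H) projections. Expanding this product by `C2`, `C16` and the
coassociativity rule for τ gives exactly α (`SmashBiproduct.reconstruct_eq_mergeRight`). The other
twelve hexagons become `C8`–`C19`, and the intertwining relations become `C1`–`C7`; the BB relation
on A holds automatically (`SmashBiproduct.factorIdentities_iff`). Conversely, normalization ensures
that the projections of α are the given W, X, Y, Z (`SmashBiproduct.isFactorization_alpha`), so the
same dictionary can be read backwards. -/

open scoped TensorProduct

open Coalgebra

/-! ### Products and coproducts of the legs of a tensor -/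

section Legs

variable {k : Type*} [Field k]
variable {H C D E N A B C' D' V U : Type*} [Ring H] [Bialgebra k H]
  [AddCommGroup C] [Module k C] [AddCommGroup D] [Module k D] [AddCommGroup E] [Module k E]
  [AddCommGroup N] [Module k N] [AddCommGroup A] [Module k A] [AddCommGroup B] [Module k B]
  [AddCommGroup C'] [Module k C'] [AddCommGroup D'] [Module k D']
  [AddCommGroup V] [Module k V] [AddCommGroup U] [Module k U]

/-- `p (x * y)` depends bilinearly on `p' x` and `p y`. -/
def MulFactors (p' : H →ₗ[k] C') (p : H →ₗ[k] C) : Prop :=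
  ∃ m : C' →ₗ[k] C →ₗ[k] C, ∀ x y, p (x * y) = m (p' x) (p y)

/-- `∑ p x₍₁₎ ⊗ q x₍₂₎` depends linearly on `n x`. -/
def ComulFactors (n : H →ₗ[k] N) (p : H →ₗ[k] C) (q : H →ₗ[k] D) : Prop :=
  ∃ ν : N →ₗ[k] C ⊗[k] D, ∀ x, TensorProduct.map p q (comul x) = ν (n x)

/-- The image of `(Δ ⊗ id) R = R₁₃ R₂₃` under `p ⊗ q ⊗ r`, where `R = ∑ i ∈ s, i.1 ⊗ i.2`. -/
def LeftHexagon (s : Finset (H × H)) (p : H →ₗ[k] C) (q : H →ₗ[k] D) (r : H →ₗ[k] E) : Prop :=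
  ∑ i ∈ s, TensorProduct.map p q (comul i.1) ⊗ₜ[k] r i.2 =
    ∑ i ∈ s, ∑ j ∈ s, (p i.1 ⊗ₜ[k] q j.1) ⊗ₜ[k] r (i.2 * j.2)

/-- The image of `(id ⊗ Δ) R = R₁₃ R₁₂` under `p ⊗ q ⊗ r`, where `R = ∑ i ∈ s, i.1 ⊗ i.2`. -/
def RightHexagon (s : Finset (H × H)) (p : H →ₗ[k] C) (q : H →ₗ[k] D) (r : H →ₗ[k] E) : Prop :=
  ∑ i ∈ s, p i.1 ⊗ₜ[k] TensorProduct.map q r (comul i.2) =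
    ∑ i ∈ s, ∑ j ∈ s, p (i.1 * j.1) ⊗ₜ[k] (q j.2 ⊗ₜ[k] r i.2)

variable {s : Finset (H × H)} {p : H →ₗ[k] C} {q : H →ₗ[k] D} {r : H →ₗ[k] E} {n : H →ₗ[k] N}
  {πA : H →ₗ[k] A} {πB : H →ₗ[k] B} {p' : H →ₗ[k] C'} {q' : H →ₗ[k] D'}

theorem LeftHexagon.apply (h : LeftHexagon s p q r) (F : C ⊗[k] D →ₗ[k] V) (G : E →ₗ[k] U) :
    ∑ i ∈ s, F (TensorProduct.map p q (comul i.1)) ⊗ₜ[k] G (r i.2) =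
      ∑ i ∈ s, ∑ j ∈ s, F (p i.1 ⊗ₜ[k] q j.1) ⊗ₜ[k] G (r (i.2 * j.2)) := by
  simpa [map_sum] using congrArg (TensorProduct.map F G) h

theorem RightHexagon.apply (h : RightHexagon s p q r) (F : C →ₗ[k] V) (G : D ⊗[k] E →ₗ[k] U) :
    ∑ i ∈ s, F (p i.1) ⊗ₜ[k] G (TensorProduct.map q r (comul i.2)) =
      ∑ i ∈ s, ∑ j ∈ s, F (p (i.1 * j.1)) ⊗ₜ[k] G (q j.2 ⊗ₜ[k] r i.2) := by
  simpa [map_sum] using congrArg (TensorProduct.map F G) h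

theorem map_mul_eq_map₂ {m : C' →ₗ[k] C →ₗ[k] C} {m' : D' →ₗ[k] D →ₗ[k] D}
    (hm : ∀ x y, p (x * y) = m (p' x) (p y)) (hm' : ∀ x y, q (x * y) = m' (q' x) (q y))
    (u v : H ⊗[k] H) :
    TensorProduct.map p q (u * v) =
      TensorProduct.map₂ m m' (TensorProduct.map p' q' u) (TensorProduct.map p q v) := by
  induction u with
  | zero => simp
  | add u₁ u₂ h₁ h₂ => simp only [add_mul, map_add, h₁, h₂, LinearMap.add_apply]
  | tmul a b =>
    induction v with
    | zero => simp
    | add v₁ v₂ h₁ h₂ => simp only [mul_add, map_add, h₁, h₂]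
    | tmul c d => simp [hm, hm']

theorem assoc_map_comul (f : H →ₗ[k] C) (g : H →ₗ[k] D) (l : H →ₗ[k] E) (x : H) :
    TensorProduct.assoc k C D E
        (TensorProduct.map (TensorProduct.map f g ∘ₗ comul) l (comul (R := k) x)) =
      TensorProduct.map f (TensorProduct.map g l ∘ₗ comul) (comul (R := k) x) := by
  have h := congrArg (TensorProduct.map f (TensorProduct.map g l)) (coassoc_apply (R := k) x)
  have e₁ : ∀ u : H ⊗[k] H, TensorProduct.assoc k C D E
      (TensorProduct.map (TensorProduct.map f g ∘ₗ comul) l u) =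
      TensorProduct.map f (TensorProduct.map g l)
        (TensorProduct.assoc k H H H ((comul (R := k)).rTensor H u)) := by
    intro u
    induction u with
    | zero => simp
    | add u v hu hv => simp only [map_add, hu, hv]
    | tmul a b =>
      simp only [TensorProduct.map_tmul, LinearMap.rTensor_tmul, LinearMap.comp_apply]
      induction comul (R := k) a with
      | zero => simp
      | add u v hu hv => simp only [map_add, TensorProduct.add_tmul, hu, hv]
      | tmul c d => simp
  rw [e₁, h, ← LinearMap.comp_apply, LinearMap.map_comp_lTensor]

theorem rTensor_map_comul (f : H →ₗ[k] C) (g : H →ₗ[k] D) (l : H →ₗ[k] E) (x : H) :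
    (TensorProduct.map f g ∘ₗ comul).rTensor E (TensorProduct.map LinearMap.id l (comul x)) =
      (TensorProduct.assoc k C D E).symm
        (TensorProduct.map f (TensorProduct.map g l ∘ₗ comul) (comul (R := k) x)) := by
  rw [← assoc_map_comul, LinearEquiv.symm_apply_apply, ← LinearMap.comp_apply,
    LinearMap.rTensor_comp_map, LinearMap.comp_id]

theorem lTensor_map_comul (f : H →ₗ[k] C) (g : H →ₗ[k] D) (l : H →ₗ[k] E) (x : H) :
    (TensorProduct.map g l ∘ₗ comul).lTensor C (TensorProduct.map f LinearMap.id (comul x)) =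
      TensorProduct.assoc k C D E
        (TensorProduct.map (TensorProduct.map f g ∘ₗ comul) l (comul (R := k) x)) := by
  rw [assoc_map_comul, ← LinearMap.comp_apply, LinearMap.lTensor_comp_map, LinearMap.comp_id]

/-- Modules over a field are flat. This and its mirror image allow an equation to be tested after
applying δ to a single leg. -/
theorem rTensor_injective_of_injective {f : C →ₗ[k] D} (hf : Function.Injective f) :
    Function.Injective (f.rTensor E) :=
  Module.Flat.rTensor_preserves_injective_linearMap f hf

theorem lTensor_injective_of_injective {f : C →ₗ[k] D} (hf : Function.Injective f) :
    Function.Injective (f.lTensor E) :=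
  Module.Flat.lTensor_preserves_injective_linearMap f hf

/-- After δ is applied to the first leg, the three factors πA, πB, q of an iterated coproduct
appear. Grouping the last two as a function of n permits `h₁`, then `h₂` separates them, and `h₃`
read backwards reassembles δ. The products in the last leg are regrouped on both sides, which is why
`r` itself has to be multiplicative. -/
theorem LeftHexagon.id_left (hδ : Function.Injective (TensorProduct.map πA πB ∘ₗ comul))
    (hn : ComulFactors n πB q) (hr : MulFactors r r) (h₁ : LeftHexagon s πA n r)
    (h₂ : LeftHexagon s πB q r) (h₃ : LeftHexagon s πA πB r) :
    LeftHexagon s LinearMap.id q r := by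
  obtain ⟨ν, hν⟩ := hn
  obtain ⟨m, hm⟩ := hr
  refine rTensor_injective_of_injective (rTensor_injective_of_injective hδ) ?_
  simp only [map_sum, LinearMap.rTensor_tmul, LinearMap.id_apply]
  let α := (TensorProduct.assoc k A B D).symm.toLinearMap
  calc ∑ i ∈ s, (TensorProduct.map πA πB ∘ₗ comul).rTensor D
          (TensorProduct.map LinearMap.id q (comul i.1)) ⊗ₜ[k] r i.2
      = ∑ i ∈ s, (α ∘ₗ ν.lTensor A) (TensorProduct.map πA n (comul i.1)) ⊗ₜ[k] r i.2 := by
        refine Finset.sum_congr rfl fun i _ => ?_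
        rw [rTensor_map_comul, LinearMap.comp_apply, ← LinearMap.comp_apply (ν.lTensor A),
          LinearMap.lTensor_comp_map,
          show TensorProduct.map πB q ∘ₗ comul = ν ∘ₗ n from LinearMap.ext hν]
        rfl
    _ = ∑ i ∈ s, ∑ j ∈ s, (α ∘ₗ TensorProduct.mk k A _ (πA i.1))
          (TensorProduct.map πB q (comul j.1)) ⊗ₜ[k] m (r i.2) (r j.2) := by
        refine (h₁.apply (α ∘ₗ ν.lTensor A) LinearMap.id).trans ?_
        simp [hν, hm]
    _ = ∑ i ∈ s, ∑ j ∈ s, ∑ l ∈ s,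
          ((πA i.1 ⊗ₜ[k] πB j.1) ⊗ₜ[k] q l.1) ⊗ₜ[k] m (r (i.2 * j.2)) (r l.2) := by
        refine Finset.sum_congr rfl fun i _ => ?_
        rw [h₂.apply (α ∘ₗ TensorProduct.mk k A _ (πA i.1)) (m (r i.2))]
        simp only [← hm, mul_assoc]
        rfl
    _ = ∑ l ∈ s, ∑ i ∈ s, ((TensorProduct.mk k (A ⊗[k] B) D).flip (q l.1)
          (TensorProduct.map πA πB (comul i.1))) ⊗ₜ[k] m.flip (r l.2) (r i.2) := by
        simp only [fun l : H × H => h₃.apply ((TensorProduct.mk k (A ⊗[k] B) D).flip (q l.1))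
          (m.flip (r l.2))]
        rw [Finset.sum_comm_cycle]
        rfl
    _ = _ := by
        rw [Finset.sum_comm]
        simp [hm]

/-- Same scheme with δ on the second leg: the factors p, πA, πB are grouped as (p, πA) and πB, split
by `h₁` and then `h₂`, and πA, πB are rejoined by `h₃`. -/
theorem LeftHexagon.id_middle (hδ : Function.Injective (TensorProduct.map πA πB ∘ₗ comul))
    (hr : MulFactors r r) (h₁ : LeftHexagon s LinearMap.id πB r)
    (h₂ : LeftHexagon s p πA r) (h₃ : LeftHexagon s πA πB r) :
    LeftHexagon s p LinearMap.id r := by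
  obtain ⟨m, hm⟩ := hr
  refine rTensor_injective_of_injective (lTensor_injective_of_injective hδ) ?_
  simp only [map_sum, LinearMap.rTensor_tmul, LinearMap.lTensor_tmul, LinearMap.id_apply]
  let α := (TensorProduct.assoc k C A B).toLinearMap
  calc ∑ i ∈ s, (TensorProduct.map πA πB ∘ₗ comul).lTensor C
          (TensorProduct.map p LinearMap.id (comul i.1)) ⊗ₜ[k] r i.2
      = ∑ i ∈ s, (α ∘ₗ (TensorProduct.map p πA ∘ₗ comul).rTensor B)
          (TensorProduct.map LinearMap.id πB (comul i.1)) ⊗ₜ[k] r i.2 := by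
        refine Finset.sum_congr rfl fun i _ => ?_
        rw [lTensor_map_comul, LinearMap.comp_apply, ← LinearMap.comp_apply (LinearMap.rTensor _ _),
          LinearMap.rTensor_comp_map, LinearMap.comp_id]
        rfl
    _ = ∑ j ∈ s, ∑ i ∈ s, (α ∘ₗ (TensorProduct.mk k _ B).flip (πB j.1))
          (TensorProduct.map p πA (comul i.1)) ⊗ₜ[k] m.flip (r j.2) (r i.2) := by
        refine (h₁.apply (α ∘ₗ (TensorProduct.map p πA ∘ₗ comul).rTensor B) LinearMap.id).trans ?_
        rw [Finset.sum_comm]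
        simp [hm]
    _ = ∑ j ∈ s, ∑ i ∈ s, ∑ l ∈ s,
          (p i.1 ⊗ₜ[k] (πA l.1 ⊗ₜ[k] πB j.1)) ⊗ₜ[k] m (r i.2) (r (l.2 * j.2)) := by
        refine Finset.sum_congr rfl fun j _ => ?_
        rw [h₂.apply (α ∘ₗ (TensorProduct.mk k _ B).flip (πB j.1)) (m.flip (r j.2))]
        simp only [LinearMap.flip_apply, ← hm, mul_assoc]
        rfl
    _ = ∑ i ∈ s, ∑ l ∈ s, (TensorProduct.mk k C (A ⊗[k] B) (p i.1)
          (TensorProduct.map πA πB (comul l.1))) ⊗ₜ[k] m (r i.2) (r l.2) := by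
        simp only [fun i : H × H => h₃.apply (TensorProduct.mk k C (A ⊗[k] B) (p i.1)) (m (r i.2))]
        rw [Finset.sum_comm_cycle, Finset.sum_comm_cycle]
        rfl
    _ = _ := by simp [hm]

/-- Analogue of `LeftHexagon.id_left` for the second tensor factor of R. Here `p` only needs to be a
module quotient, so that πA is allowed; the price is that `h₂` keeps the whole first leg, because
its products are multiplied on the right by further elements. -/
theorem RightHexagon.id_middle (hδ : Function.Injective (TensorProduct.map πA πB ∘ₗ comul))
    (hn : ComulFactors n πB q) (hp : MulFactors LinearMap.id p) (h₁ : RightHexagon s p πA n)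
    (h₂ : RightHexagon s LinearMap.id πB q) (h₃ : RightHexagon s p πA πB) :
    RightHexagon s p LinearMap.id q := by
  obtain ⟨ν, hν⟩ := hn
  obtain ⟨m, hm⟩ := hp
  refine lTensor_injective_of_injective (rTensor_injective_of_injective hδ) ?_
  simp only [map_sum, LinearMap.rTensor_tmul, LinearMap.lTensor_tmul, LinearMap.id_apply]
  let α := (TensorProduct.assoc k A B D).symm.toLinearMap
  calc ∑ i ∈ s, p i.1 ⊗ₜ[k] (TensorProduct.map πA πB ∘ₗ comul).rTensor D
          (TensorProduct.map LinearMap.id q (comul i.2))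
      = ∑ i ∈ s, p i.1 ⊗ₜ[k] (α ∘ₗ ν.lTensor A) (TensorProduct.map πA n (comul i.2)) := by
        refine Finset.sum_congr rfl fun i _ => ?_
        rw [rTensor_map_comul, LinearMap.comp_apply, ← LinearMap.comp_apply (ν.lTensor A),
          LinearMap.lTensor_comp_map,
          show TensorProduct.map πB q ∘ₗ comul = ν ∘ₗ n from LinearMap.ext hν]
        rfl
    _ = ∑ j ∈ s, ∑ i ∈ s, m.flip (p j.1) i.1 ⊗ₜ[k] (α ∘ₗ TensorProduct.mk k A _ (πA j.2))
          (TensorProduct.map πB q (comul i.2)) := by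
        refine (h₁.apply LinearMap.id (α ∘ₗ ν.lTensor A)).trans ?_
        rw [Finset.sum_comm]
        simp [hν, hm]
    _ = ∑ j ∈ s, ∑ i ∈ s, ∑ l ∈ s, m i.1 (p (l.1 * j.1)) ⊗ₜ[k]
          ((πA j.2 ⊗ₜ[k] πB l.2) ⊗ₜ[k] q i.2) := by
        refine Finset.sum_congr rfl fun j _ => ?_
        refine (h₂.apply (m.flip (p j.1)) (α ∘ₗ TensorProduct.mk k A _ (πA j.2))).trans ?_
        simp only [LinearMap.flip_apply, LinearMap.id_apply,
          show ∀ x y, m x (p y) = p (x * y) from fun x y => (hm x y).symm, mul_assoc]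
        rfl
    _ = ∑ i ∈ s, ∑ l ∈ s, m i.1 (p l.1) ⊗ₜ[k] ((TensorProduct.mk k (A ⊗[k] B) D).flip (q i.2)
          (TensorProduct.map πA πB (comul l.2))) := by
        simp only [fun i : H × H =>
          h₃.apply (m i.1) ((TensorProduct.mk k (A ⊗[k] B) D).flip (q i.2))]
        rw [Finset.sum_comm]
        refine Finset.sum_congr rfl fun i _ => ?_
        rw [Finset.sum_comm]
        rfl
    _ = _ := by simp [hm]

/-- Here the factors q, πA, πB are grouped as (q, πA) and πB. The full first leg is needed in `h₃`,
where two copies of R must be recombined to the left of an element already projected by `p`. -/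
theorem RightHexagon.id_right (hδ : Function.Injective (TensorProduct.map πA πB ∘ₗ comul))
    (hp : MulFactors LinearMap.id p) (h₁ : RightHexagon s p LinearMap.id πB)
    (h₂ : RightHexagon s p q πA) (h₃ : RightHexagon s LinearMap.id πA πB) :
    RightHexagon s p q LinearMap.id := by
  obtain ⟨m, hm⟩ := hp
  have hm' : ∀ x y, m x (p y) = p (x * y) := fun x y => (hm x y).symm
  refine lTensor_injective_of_injective (lTensor_injective_of_injective hδ) ?_
  simp only [map_sum, LinearMap.lTensor_tmul, LinearMap.id_apply]
  let α := (TensorProduct.assoc k D A B).toLinearMap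
  calc ∑ i ∈ s, p i.1 ⊗ₜ[k] (TensorProduct.map πA πB ∘ₗ comul).lTensor D
          (TensorProduct.map q LinearMap.id (comul i.2))
      = ∑ i ∈ s, p i.1 ⊗ₜ[k] (α ∘ₗ (TensorProduct.map q πA ∘ₗ comul).rTensor B)
          (TensorProduct.map LinearMap.id πB (comul i.2)) := by
        refine Finset.sum_congr rfl fun i _ => ?_
        rw [lTensor_map_comul, LinearMap.comp_apply, ← LinearMap.comp_apply (LinearMap.rTensor _ _),
          LinearMap.rTensor_comp_map, LinearMap.comp_id]
        rfl
    _ = ∑ i ∈ s, ∑ j ∈ s, m i.1 (p j.1) ⊗ₜ[k] (α ∘ₗ (TensorProduct.mk k _ B).flip (πB i.2))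
          (TensorProduct.map q πA (comul j.2)) := by
        refine (h₁.apply LinearMap.id
          (α ∘ₗ (TensorProduct.map q πA ∘ₗ comul).rTensor B)).trans ?_
        simp [hm]
    _ = ∑ i ∈ s, ∑ j ∈ s, ∑ l ∈ s, m.flip (p l.1) (i.1 * j.1) ⊗ₜ[k]
          TensorProduct.mk k D (A ⊗[k] B) (q l.2) (πA j.2 ⊗ₜ[k] πB i.2) := by
        refine Finset.sum_congr rfl fun i _ => ?_
        rw [h₂.apply (m i.1) (α ∘ₗ (TensorProduct.mk k _ B).flip (πB i.2))]
        simp only [LinearMap.flip_apply, hm', mul_assoc]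
        rfl
    _ = ∑ l ∈ s, ∑ i ∈ s, m.flip (p l.1) i.1 ⊗ₜ[k] TensorProduct.mk k D (A ⊗[k] B) (q l.2)
          (TensorProduct.map πA πB (comul i.2)) := by
        rw [Finset.sum_comm_cycle]
        exact Finset.sum_congr rfl fun l _ => (h₃.apply (m.flip (p l.1))
          (TensorProduct.mk k D (A ⊗[k] B) (q l.2))).symm
    _ = _ := by
        rw [Finset.sum_comm]
        simp [hm]

end Legs

/-! ### Full legs in the position where a hexagon multiplies -/

section Legs

variable {k : Type*} [Field k]
variable {H C D E N A B C' D' V U : Type*} [Ring H] [Bialgebra k H]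
  [AddCommGroup C] [Module k C] [AddCommGroup D] [Module k D] [AddCommGroup E] [Module k E]
  [AddCommGroup N] [Module k N] [AddCommGroup A] [Module k A] [AddCommGroup B] [Module k B]
  [AddCommGroup C'] [Module k C'] [AddCommGroup D'] [Module k D']
  [AddCommGroup V] [Module k V] [AddCommGroup U] [Module k U]
variable {s : Finset (H × H)} {p : H →ₗ[k] C} {q : H →ₗ[k] D} {r : H →ₗ[k] E} {n : H →ₗ[k] N}
  {πA : H →ₗ[k] A} {πB : H →ₗ[k] B} {p' : H →ₗ[k] C'} {q' : H →ₗ[k] D'}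

theorem sum_comm_four {ι M : Type*} [AddCommMonoid M] (s : Finset ι) (f : ι → ι → ι → ι → M) :
    ∑ a ∈ s, ∑ b ∈ s, ∑ c ∈ s, ∑ d ∈ s, f a b c d =
      ∑ b ∈ s, ∑ d ∈ s, ∑ c ∈ s, ∑ a ∈ s, f a b c d := by
  rw [Finset.sum_comm]
  refine Finset.sum_congr rfl fun b _ => ?_
  rw [Finset.sum_comm_cycle]
  exact Finset.sum_congr rfl fun d _ => Finset.sum_comm

theorem map_comul_mul {m : H →ₗ[k] A →ₗ[k] A} {m' : B →ₗ[k] B →ₗ[k] B}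
    (hm : ∀ x y, πA (x * y) = m x (πA y)) (hm' : ∀ x y, πB (x * y) = m' (πB x) (πB y)) (x y : H) :
    (TensorProduct.map πA πB ∘ₗ comul) (x * y) =
      TensorProduct.map₂ m m' ((TensorProduct.map LinearMap.id πB ∘ₗ comul) x)
        ((TensorProduct.map πA πB ∘ₗ comul) y) := by
  simp only [LinearMap.comp_apply, Bialgebra.comul_mul]
  have hm₁ : ∀ x y, πA (x * y) = m (LinearMap.id (R := k) x) (πA y) := hm
  exact map_mul_eq_map₂ hm₁ hm' _ _

/-- The leg in question carries the product of two copies of R, so coassociativity alone does not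
suffice. Computing the projected (Δ ⊗ Δ)R by `h₁` and then by right hexagons yields four copies of
R. The two middle copies commute past each other, as they share no tensor factor, and left hexagons
read backwards recombine the four into δ(xy), where δ(xy) is the product of (id ⊗ πB)Δ(x) and δ(y).
-/
theorem RightHexagon.id_left (hδ : Function.Injective (TensorProduct.map πA πB ∘ₗ comul))
    {q' : H →ₗ[k] C'} {r' : H →ₗ[k] D'}
    (hA : MulFactors LinearMap.id πA) (hB : MulFactors πB πB)
    (hq : MulFactors q' q) (hr : MulFactors r' r)
    (h₁ : LeftHexagon s πA πB LinearMap.id) (h₂ : RightHexagon s πA q' r')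
    (h₃ : RightHexagon s πB q r) (h₄ : LeftHexagon s LinearMap.id πB r) :
    RightHexagon s LinearMap.id q r := by
  obtain ⟨mA, hA⟩ := hA
  obtain ⟨mB, hB⟩ := hB
  obtain ⟨m, hm⟩ := hq
  obtain ⟨m', hm'⟩ := hr
  refine rTensor_injective_of_injective hδ ?_
  simp only [map_sum, LinearMap.rTensor_tmul, LinearMap.id_apply]
  calc ∑ i ∈ s, (TensorProduct.map πA πB (comul i.1)) ⊗ₜ[k] TensorProduct.map q r (comul i.2)
      = ∑ i ∈ s, ∑ j ∈ s, TensorProduct.mk k A B (πA i.1) (πB j.1) ⊗ₜ[k]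
          TensorProduct.map₂ m m' (TensorProduct.map q' r' (comul i.2))
            (TensorProduct.map q r (comul j.2)) := by
        refine (h₁.apply LinearMap.id (TensorProduct.map q r ∘ₗ comul)).trans ?_
        simp [← map_mul_eq_map₂ hm hm']
    _ = ∑ i ∈ s, ∑ j ∈ s, ∑ l ∈ s,
          (TensorProduct.mk k A B).flip (πB (j.1 * l.1)) (πA i.1) ⊗ₜ[k]
          (TensorProduct.map₂ m m').flip (q l.2 ⊗ₜ[k] r j.2)
            (TensorProduct.map q' r' (comul i.2)) :=
        Finset.sum_congr rfl fun i _ => h₃.apply (TensorProduct.mk k A B (πA i.1))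
          (TensorProduct.map₂ m m' (TensorProduct.map q' r' (comul i.2)))
    _ = ∑ j ∈ s, ∑ l ∈ s, ∑ i ∈ s, ∑ t ∈ s,
          (πA (i.1 * t.1) ⊗ₜ[k] πB (j.1 * l.1)) ⊗ₜ[k] (q (t.2 * l.2) ⊗ₜ[k] r (i.2 * j.2)) := by
        rw [Finset.sum_comm]
        refine Finset.sum_congr rfl fun j _ => ?_
        rw [Finset.sum_comm]
        refine Finset.sum_congr rfl fun l _ => ?_
        rw [h₂.apply ((TensorProduct.mk k A B).flip (πB (j.1 * l.1)))
          ((TensorProduct.map₂ m m').flip (q l.2 ⊗ₜ[k] r j.2))]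
        simp [hm, hm']
    -- The four copies are regrouped into the pairs (i, j) and (t, l); each pair is the right-hand
    -- side of a left hexagon.
    _ = ∑ l ∈ s, ∑ t ∈ s, ∑ i ∈ s, ∑ j ∈ s,
          TensorProduct.map (mA.flip (πA t.1)) (mB.flip (πB l.1)) (i.1 ⊗ₜ[k] πB j.1) ⊗ₜ[k]
            TensorProduct.mk k D E (q (t.2 * l.2)) (r (i.2 * j.2)) := by
        rw [sum_comm_four]
        simp [hA, hB]
    _ = ∑ i ∈ s, ∑ t ∈ s, ∑ l ∈ s,
          TensorProduct.map₂ mA mB (TensorProduct.map LinearMap.id πB (comul i.1))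
            (πA t.1 ⊗ₜ[k] πB l.1) ⊗ₜ[k] ((TensorProduct.mk k D E).flip (r i.2) ∘ₗ q)
              (t.2 * l.2) := by
        -- With the right-hand factor fixed and pure, the product is a linear map of `u`, the form
        -- in which a hexagon can be applied.
        have key : ∀ (a : A) (b : B) (u : H ⊗[k] B), TensorProduct.map₂ mA mB u (a ⊗ₜ[k] b) =
            TensorProduct.map (mA.flip a) (mB.flip b) u := fun a b u => by
          induction u with
          | zero => simp
          | add u v hu hv => simp only [map_add, LinearMap.add_apply, hu, hv]
          | tmul c d => simp
        simp only [key]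
        refine Eq.trans (Finset.sum_congr rfl fun l _ => Eq.trans
          (Finset.sum_congr rfl fun t _ => ?_) Finset.sum_comm) Finset.sum_comm_cycle.symm
        exact (h₄.apply (TensorProduct.map (mA.flip (πA t.1)) (mB.flip (πB l.1)))
          (TensorProduct.mk k D E (q (t.2 * l.2)))).symm
    _ = ∑ i ∈ s, ∑ t ∈ s,
          TensorProduct.map₂ mA mB (TensorProduct.map LinearMap.id πB (comul i.1))
            (TensorProduct.map πA πB (comul t.1)) ⊗ₜ[k] (q t.2 ⊗ₜ[k] r i.2) :=
        Finset.sum_congr rfl fun i _ => (h₁.apply (TensorProduct.map₂ mA mB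
          (TensorProduct.map LinearMap.id πB (comul i.1)))
            ((TensorProduct.mk k D E).flip (r i.2) ∘ₗ q)).symm
    _ = _ := by
        simp only [map_comul_mul hA hB]
        rfl

/-- Mirror image of `RightHexagon.id_left`: δ is applied to the second tensor factor of R, a right
hexagon expands it, left hexagons produce four copies of R, and right hexagons recombine them. -/
theorem LeftHexagon.id_right (hδ : Function.Injective (TensorProduct.map πA πB ∘ₗ comul))
    (hA : MulFactors LinearMap.id πA) (hB : MulFactors πB πB)
    (hp : MulFactors LinearMap.id p) (hq : MulFactors LinearMap.id q)
    (h₁ : RightHexagon s LinearMap.id πA πB) (h₂ : LeftHexagon s LinearMap.id LinearMap.id πB)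
    (h₃ : LeftHexagon s p q πA) (h₄ : RightHexagon s p LinearMap.id πB)
    (h₅ : RightHexagon s q πA πB) :
    LeftHexagon s p q LinearMap.id := by
  obtain ⟨mA, hA⟩ := hA
  obtain ⟨mB, hB⟩ := hB
  obtain ⟨m, hm⟩ := hp
  obtain ⟨m', hm'⟩ := hq
  refine lTensor_injective_of_injective hδ ?_
  simp only [map_sum, LinearMap.lTensor_tmul, LinearMap.id_apply]
  calc ∑ i ∈ s, TensorProduct.map p q (comul i.1) ⊗ₜ[k] TensorProduct.map πA πB (comul i.2)
      = ∑ j ∈ s, ∑ i ∈ s, (TensorProduct.map₂ m m').flip (TensorProduct.map p q (comul j.1))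
          (TensorProduct.map LinearMap.id LinearMap.id (comul i.1)) ⊗ₜ[k]
            TensorProduct.mk k A B (πA j.2) (πB i.2) := by
        refine (h₁.apply (TensorProduct.map p q ∘ₗ comul) LinearMap.id).trans ?_
        rw [Finset.sum_comm]
        simp [map_mul_eq_map₂ hm hm', TensorProduct.map_id]
    _ = ∑ j ∈ s, ∑ i ∈ s, ∑ l ∈ s, TensorProduct.map₂ m m' (i.1 ⊗ₜ[k] l.1)
          (TensorProduct.map p q (comul j.1)) ⊗ₜ[k]
            (TensorProduct.mk k A B).flip (πB (i.2 * l.2)) (πA j.2) :=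
        Finset.sum_congr rfl fun j _ => h₂.apply ((TensorProduct.map₂ m m').flip
          (TensorProduct.map p q (comul j.1))) (TensorProduct.mk k A B (πA j.2))
    _ = ∑ i ∈ s, ∑ l ∈ s, ∑ j ∈ s, ∑ t ∈ s,
          (p (i.1 * j.1) ⊗ₜ[k] q (l.1 * t.1)) ⊗ₜ[k] (πA (j.2 * t.2) ⊗ₜ[k] πB (i.2 * l.2)) := by
        rw [Finset.sum_comm]
        refine Finset.sum_congr rfl fun i _ => ?_
        rw [Finset.sum_comm]
        refine Finset.sum_congr rfl fun l _ => ?_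
        rw [h₃.apply (TensorProduct.map₂ m m' (i.1 ⊗ₜ[k] l.1))
          ((TensorProduct.mk k A B).flip (πB (i.2 * l.2)))]
        simp [hm, hm']
    _ = ∑ l ∈ s, ∑ t ∈ s, ∑ i ∈ s, ∑ j ∈ s,
          (TensorProduct.mk k C D).flip (q (l.1 * t.1)) (p (i.1 * j.1)) ⊗ₜ[k]
          TensorProduct.map (mA.flip (πA t.2)) (mB.flip (πB l.2)) (j.2 ⊗ₜ[k] πB i.2) := by
        rw [sum_comm_four]
        refine Finset.sum_congr rfl fun l _ => Finset.sum_congr rfl fun t _ => ?_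
        rw [Finset.sum_comm]
        simp [hA, hB]
    _ = ∑ i ∈ s, ∑ l ∈ s, ∑ t ∈ s, (TensorProduct.mk k C D (p i.1)) (q (l.1 * t.1)) ⊗ₜ[k]
          TensorProduct.map₂ mA mB (TensorProduct.map LinearMap.id πB (comul i.2))
            (πA t.2 ⊗ₜ[k] πB l.2) := by
        have key : ∀ (a : A) (b : B) (u : H ⊗[k] B), TensorProduct.map₂ mA mB u (a ⊗ₜ[k] b) =
            TensorProduct.map (mA.flip a) (mB.flip b) u := fun a b u => by
          induction u with
          | zero => simp
          | add u v hu hv => simp only [map_add, LinearMap.add_apply, hu, hv]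
          | tmul c d => simp
        simp only [key]
        refine Eq.trans (Finset.sum_congr rfl fun l _ => Finset.sum_congr rfl fun t _ => ?_)
          Finset.sum_comm_cycle
        exact (h₄.apply ((TensorProduct.mk k C D).flip (q (l.1 * t.1)))
          (TensorProduct.map (mA.flip (πA t.2)) (mB.flip (πB l.2)))).symm
    _ = ∑ i ∈ s, ∑ l ∈ s, (TensorProduct.mk k C D (p i.1)) (q l.1) ⊗ₜ[k]
          TensorProduct.map₂ mA mB (TensorProduct.map LinearMap.id πB (comul i.2))
            (TensorProduct.map πA πB (comul l.2)) :=
        Finset.sum_congr rfl fun i _ => (h₅.apply (TensorProduct.mk k C D (p i.1))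
          (TensorProduct.map₂ mA mB (TensorProduct.map LinearMap.id πB (comul i.2)))).symm
    _ = _ := by
        simp only [map_comul_mul hA hB]
        rfl

end Legs

/-! ### The relation RΔ(h) = Δᵒᵖ(h)R under projections -/

section Legs

variable {k : Type*} [Field k]
variable {H C D E A B V : Type*} [Ring H] [Bialgebra k H]
  [AddCommGroup C] [Module k C] [AddCommGroup D] [Module k D] [AddCommGroup E] [Module k E]
  [AddCommGroup A] [Module k A] [AddCommGroup B] [Module k B] [AddCommGroup V] [Module k V]
variable {s : Finset (H × H)} {p : H →ₗ[k] C} {q : H →ₗ[k] D} {r : H →ₗ[k] E}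
  {πA : H →ₗ[k] A} {πB : H →ₗ[k] B}

/-- The image of `R Δ(h)` under `p ⊗ q`, where `R = ∑ i ∈ s, i.1 ⊗ i.2`, as a function of `h`. -/
noncomputable def mulComul (s : Finset (H × H)) (p : H →ₗ[k] C) (q : H →ₗ[k] D) :
    H →ₗ[k] C ⊗[k] D :=
  ∑ i ∈ s, TensorProduct.map p q ∘ₗ LinearMap.mulLeft k (i.1 ⊗ₜ[k] i.2) ∘ₗ comul

/-- The image of `Δᵒᵖ(h) R` under `p ⊗ q`, where `R = ∑ i ∈ s, i.1 ⊗ i.2`, as a function of `h`. -/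
noncomputable def opComulMul (s : Finset (H × H)) (p : H →ₗ[k] C) (q : H →ₗ[k] D) :
    H →ₗ[k] C ⊗[k] D :=
  ∑ i ∈ s, TensorProduct.map p q ∘ₗ LinearMap.mulRight k (i.1 ⊗ₜ[k] i.2) ∘ₗ
    (TensorProduct.comm k H H).toLinearMap ∘ₗ comul

theorem mulComul_apply (x : H) : mulComul s p q x =
    ∑ i ∈ s, TensorProduct.map p q ((i.1 ⊗ₜ[k] i.2) * comul x) := by
  simp [mulComul]

theorem opComulMul_apply (x : H) : opComulMul s p q x =
    ∑ i ∈ s, TensorProduct.map p q (TensorProduct.comm k H H (comul x) * (i.1 ⊗ₜ[k] i.2)) := by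
  simp [opComulMul]

/-- `∑ h₍₁₎ ⊗ (h₍₂₎ ⊗ h₍₃₎)`. -/
noncomputable def comulTwice : H →ₗ[k] H ⊗[k] (H ⊗[k] H) :=
  (comul (R := k) (A := H)).lTensor H ∘ₗ comul

/-- Applying δ to the first leg turns R into R₁₃R₂₃, which is moved past h₍₁₎ ⊗ h₍₂₎ ⊗ h₍₃₎ one
factor at a time. Moving R₂₃ uses `h₃`. Moving R₁₃ uses `h₄`, known only on the image of `g`; by
`hg` this image is stable under h ↦ h₍₁₎ ⊗ πB h₍₂₎, and πB is what acts on the remaining factor. -/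
theorem mulComul_eq_of_subcomodule_left
    (hδ : Function.Injective (TensorProduct.map πA πB ∘ₗ comul))
    (hA : MulFactors LinearMap.id πA) (hB : MulFactors πB πB) (hr : MulFactors r r)
    {g : V →ₗ[k] H} {c : V →ₗ[k] V ⊗[k] B}
    (hg : ∀ v, TensorProduct.map LinearMap.id πB (comul (g v)) = g.rTensor B (c v))
    (h₁ : LeftHexagon s LinearMap.id πB r) (h₂ : LeftHexagon s πA πB r)
    (h₃ : mulComul s πB r = opComulMul s πB r)
    (h₄ : mulComul s πA r ∘ₗ g = opComulMul s πA r ∘ₗ g) :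
    mulComul s LinearMap.id r ∘ₗ g = opComulMul s LinearMap.id r ∘ₗ g := by
  obtain ⟨mA, hA⟩ := hA
  obtain ⟨mB, hB⟩ := hB
  obtain ⟨m, hm⟩ := hr
  replace hA : ∀ x y, mA x (πA y) = πA (x * y) := fun x y => (hA x y).symm
  replace hB : ∀ x y, mB (πB x) (πB y) = πB (x * y) := fun x y => (hB x y).symm
  replace hm : ∀ x y, m (r x) (r y) = r (x * y) := fun x y => (hm x y).symm
  have hδm := map_comul_mul (fun x y => (hA x y).symm) (fun x y => (hB x y).symm)
  refine LinearMap.ext fun v => rTensor_injective_of_injective hδ ?_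
  -- With R = ∑ i and a second copy j, the three stages are L = R₁₃R₂₃(h₍₁₎ ⊗ h₍₂₎ ⊗ h₍₃₎), M =
  -- R₁₃(h₍₁₎ ⊗ h₍₃₎ ⊗ h₍₂₎)R₂₃ and K = (h₍₂₎ ⊗ h₍₃₎ ⊗ h₍₁₎)R₁₃R₂₃, each projected by πA, πB, r.
  let L : H × H → H × H → H ⊗[k] (H ⊗[k] H) →ₗ[k] (A ⊗[k] B) ⊗[k] E := fun i j =>
    TensorProduct.map (TensorProduct.map (πA ∘ₗ LinearMap.mulLeft k i.1)
      (πB ∘ₗ LinearMap.mulLeft k j.1)) (r ∘ₗ LinearMap.mulLeft k (i.2 * j.2)) ∘ₗ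
      (TensorProduct.assoc k H H H).symm.toLinearMap
  let M : H × H → H × H → H ⊗[k] (H ⊗[k] H) →ₗ[k] (A ⊗[k] B) ⊗[k] E := fun i j =>
    TensorProduct.map (TensorProduct.map (πA ∘ₗ LinearMap.mulLeft k i.1)
      (πB ∘ₗ LinearMap.mulRight k j.1))
      (r ∘ₗ LinearMap.mulLeft k i.2 ∘ₗ LinearMap.mulRight k j.2) ∘ₗ
      (TensorProduct.assoc k H H H).symm.toLinearMap ∘ₗ
      (TensorProduct.comm k H H).toLinearMap.lTensor H
  let K : H × H → H × H → H ⊗[k] (H ⊗[k] H) →ₗ[k] (A ⊗[k] B) ⊗[k] E := fun i j =>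
    TensorProduct.map (TensorProduct.map (πA ∘ₗ LinearMap.mulRight k i.1)
      (πB ∘ₗ LinearMap.mulRight k j.1)) (r ∘ₗ LinearMap.mulRight k (i.2 * j.2)) ∘ₗ
      (TensorProduct.comm k H (H ⊗[k] H)).toLinearMap
  let Φ := TensorProduct.map₂ (TensorProduct.map₂ mA mB) m
  have hΦ : ∀ u v : H ⊗[k] H, (TensorProduct.map πA πB ∘ₗ comul).rTensor E
      (TensorProduct.map LinearMap.id r (u * v)) =
        Φ (TensorProduct.map (TensorProduct.map LinearMap.id πB ∘ₗ comul) r u)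
          (TensorProduct.map (TensorProduct.map πA πB ∘ₗ comul) r v) := fun u v => by
    rw [← LinearMap.comp_apply, LinearMap.rTensor_comp_map, LinearMap.comp_id,
      map_mul_eq_map₂ hδm (fun x y => (hm x y).symm)]
  have sumL : ∀ x, (TensorProduct.map πA πB ∘ₗ comul).rTensor E (mulComul s LinearMap.id r x) =
      ∑ i ∈ s, ∑ j ∈ s, L i j (comulTwice x) := fun x => by
    have e : ∀ i j : H × H, ∀ t : H ⊗[k] (H ⊗[k] H),
        Φ ((LinearMap.id (R := k) i.1 ⊗ₜ[k] πB j.1) ⊗ₜ[k] r (i.2 * j.2))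
          (TensorProduct.map (TensorProduct.map πA πB) r
            ((TensorProduct.assoc k H H H).symm t)) = L i j t := fun i j t => by
      have : Φ ((LinearMap.id (R := k) i.1 ⊗ₜ[k] πB j.1) ⊗ₜ[k] r (i.2 * j.2)) ∘ₗ
          TensorProduct.map (TensorProduct.map πA πB) r ∘ₗ
            (TensorProduct.assoc k H H H).symm.toLinearMap = L i j := by
        ext a b c
        simp [Φ, L, hA, hB, hm, mul_assoc]
      exact LinearMap.congr_fun this t
    have triple : TensorProduct.map (TensorProduct.map πA πB ∘ₗ comul) r (comul (R := k) x) =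
        TensorProduct.map (TensorProduct.map πA πB) r
          ((TensorProduct.assoc k H H H).symm (comulTwice (k := k) x)) := by
      rw [comulTwice, LinearMap.comp_apply, ← coassoc_apply, LinearEquiv.symm_apply_apply,
        ← LinearMap.comp_apply (TensorProduct.map (TensorProduct.map πA πB) r),
        LinearMap.map_comp_rTensor]
    have := congrArg (fun w => Φ w (TensorProduct.map (TensorProduct.map πA πB) r
      ((TensorProduct.assoc k H H H).symm (comulTwice (k := k) x)))) h₁
    simp only [map_sum, LinearMap.sum_apply, e] at this
    rw [← this]
    simp only [mulComul_apply, map_sum, hΦ, triple]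
    rfl
  have sumK : ∀ x, (TensorProduct.map πA πB ∘ₗ comul).rTensor E (opComulMul s LinearMap.id r x) =
      ∑ i ∈ s, ∑ j ∈ s, K i j (comulTwice x) := fun x => by
    have e : ∀ i j : H × H, ∀ t : H ⊗[k] (H ⊗[k] H),
        Φ (TensorProduct.map (TensorProduct.map LinearMap.id πB) r
            (TensorProduct.comm k H (H ⊗[k] H) t)) ((πA i.1 ⊗ₜ[k] πB j.1) ⊗ₜ[k] r (i.2 * j.2)) =
          K i j t := fun i j t => by
      have : Φ.flip ((πA i.1 ⊗ₜ[k] πB j.1) ⊗ₜ[k] r (i.2 * j.2)) ∘ₗ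
          TensorProduct.map (TensorProduct.map LinearMap.id πB) r ∘ₗ
            (TensorProduct.comm k H (H ⊗[k] H)).toLinearMap = K i j := by
        ext a b c
        simp [Φ, K, hA, hB, hm, mul_assoc]
      exact LinearMap.congr_fun this t
    have triple : TensorProduct.map (TensorProduct.map LinearMap.id πB ∘ₗ comul) r
        (TensorProduct.comm k H H (comul (R := k) x)) =
        TensorProduct.map (TensorProduct.map LinearMap.id πB) r
          (TensorProduct.comm k H (H ⊗[k] H) (comulTwice (k := k) x)) := by
      rw [comulTwice, LinearMap.comp_apply]
      induction comul (R := k) x with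
      | zero => simp
      | add u v hu hv => simp only [map_add, hu, hv]
      | tmul a b => simp
    have := congrArg (Φ (TensorProduct.map (TensorProduct.map LinearMap.id πB) r
      (TensorProduct.comm k H (H ⊗[k] H) (comulTwice (k := k) x)))) h₂
    simp only [map_sum, e] at this
    rw [← this]
    simp only [opComulMul_apply, map_sum, hΦ, triple]
    rfl
  have sumLM : ∀ x, ∀ i : H × H, ∑ j ∈ s, L i j (comulTwice x) =
      ∑ j ∈ s, M i j (comulTwice x) := fun x i => by
    rw [comulTwice, LinearMap.comp_apply]
    induction comul (R := k) x with
    | zero => simp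
    | add u v hu hv => simp only [map_add, Finset.sum_add_distrib, hu, hv]
    | tmul a b =>
      let F := TensorProduct.map (TensorProduct.mk k A B (πA (i.1 * a))) (m (r i.2))
      have eL : ∀ j : H × H, ∀ w, L i j (a ⊗ₜ[k] w) =
          F (TensorProduct.map πB r ((j.1 ⊗ₜ[k] j.2) * w)) := fun j w => by
        induction w with
        | zero => simp
        | add u v hu hv => simp only [map_add, mul_add, TensorProduct.tmul_add, hu, hv]
        | tmul b c => simp [L, F, hm]
      have eM : ∀ j : H × H, ∀ w, M i j (a ⊗ₜ[k] w) =
          F (TensorProduct.map πB r (TensorProduct.comm k H H w * (j.1 ⊗ₜ[k] j.2))) :=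
        fun j w => by
        induction w with
        | zero => simp
        | add u v hu hv => simp only [map_add, add_mul, TensorProduct.tmul_add, hu, hv]
        | tmul b c => simp [M, F, hm]
      have := congrArg F (LinearMap.congr_fun h₃ b)
      simpa only [mulComul_apply, opComulMul_apply, map_sum, LinearMap.lTensor_tmul, eL, eM]
        using this
  have sumMK : ∀ v, ∀ j : H × H, ∑ i ∈ s, M i j (comulTwice (g v)) =
      ∑ i ∈ s, K i j (comulTwice (g v)) := fun v j => by
    -- Now the first two factors are taken as the coproduct of h₍₁₎, so that `hg` brings the
    -- relation back to elements `g v`.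
    rw [comulTwice, LinearMap.comp_apply, ← coassoc_apply]
    let Θ : (A ⊗[k] E) ⊗[k] B →ₗ[k] (A ⊗[k] B) ⊗[k] E :=
      TensorProduct.map ((mB.flip (πB j.1)).lTensor A) (m.flip (r j.2)) ∘ₗ
        (TensorProduct.rightComm k A E B).toLinearMap
    have eM : ∀ u : H ⊗[k] H, ∑ i ∈ s, M i j (TensorProduct.assoc k H H H (comul.rTensor H u)) =
        Θ ((mulComul s πA r).rTensor B (TensorProduct.map LinearMap.id πB u)) := fun u => by
      induction u with
      | zero => simp
      | add u v hu hv => simp only [map_add, Finset.sum_add_distrib, hu, hv]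
      | tmul a b =>
        simp only [LinearMap.rTensor_tmul, TensorProduct.map_tmul, mulComul_apply,
          TensorProduct.sum_tmul, map_sum, LinearMap.id_apply]
        refine Finset.sum_congr rfl fun i _ => ?_
        induction comul (R := k) a with
        | zero => simp
        | add u v hu hv => simp only [map_add, mul_add, TensorProduct.add_tmul, hu, hv]
        | tmul c d => simp [M, Θ, hB, hm, mul_assoc]
    have eK : ∀ u : H ⊗[k] H, ∑ i ∈ s, K i j (TensorProduct.assoc k H H H (comul.rTensor H u)) =
        Θ ((opComulMul s πA r).rTensor B (TensorProduct.map LinearMap.id πB u)) := fun u => by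
      induction u with
      | zero => simp
      | add u v hu hv => simp only [map_add, Finset.sum_add_distrib, hu, hv]
      | tmul a b =>
        simp only [LinearMap.rTensor_tmul, TensorProduct.map_tmul, opComulMul_apply,
          TensorProduct.sum_tmul, map_sum, LinearMap.id_apply]
        refine Finset.sum_congr rfl fun i _ => ?_
        induction comul (R := k) a with
        | zero => simp
        | add u v hu hv => simp only [map_add, add_mul, TensorProduct.add_tmul, hu, hv]
        | tmul c d => simp [K, Θ, hB, hm, mul_assoc]
    rw [eM, eK, hg, ← LinearMap.comp_apply (LinearMap.rTensor B _), ← LinearMap.rTensor_comp, h₄,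
      LinearMap.rTensor_comp]
    rfl
  simp only [LinearMap.comp_apply, sumL, sumK, sumLM]
  rw [Finset.sum_comm]
  simp only [sumMK]
  rw [Finset.sum_comm]

/-- Here δ is applied to the second leg and R becomes R₁₃R₁₂. The inner factor R₁₂ is moved first,
by `h₄` and the comodule property of `g`; then R₁₃ is moved by `h₃`, which is available on all of H.
-/
theorem mulComul_eq_of_subcomodule_right
    (hδ : Function.Injective (TensorProduct.map πA πB ∘ₗ comul))
    (hA : MulFactors LinearMap.id πA) (hB : MulFactors πB πB) (hp : MulFactors LinearMap.id p)
    {g : V →ₗ[k] H} {c : V →ₗ[k] V ⊗[k] B}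
    (hg : ∀ v, TensorProduct.map LinearMap.id πB (comul (g v)) = g.rTensor B (c v))
    (h₁ : RightHexagon s LinearMap.id LinearMap.id πB) (h₂ : RightHexagon s p πA πB)
    (h₃ : mulComul s LinearMap.id πB = opComulMul s LinearMap.id πB)
    (h₄ : mulComul s p πA ∘ₗ g = opComulMul s p πA ∘ₗ g) :
    mulComul s p LinearMap.id ∘ₗ g = opComulMul s p LinearMap.id ∘ₗ g := by
  obtain ⟨mA, hA⟩ := hA
  obtain ⟨mB, hB⟩ := hB
  obtain ⟨m, hm⟩ := hp
  replace hA : ∀ x y, mA x (πA y) = πA (x * y) := fun x y => (hA x y).symm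
  replace hB : ∀ x y, mB (πB x) (πB y) = πB (x * y) := fun x y => (hB x y).symm
  replace hm : ∀ x y, m x (p y) = p (x * y) := fun x y => (hm x y).symm
  have hδm := map_comul_mul (fun x y => (hA x y).symm) (fun x y => (hB x y).symm)
  have hm₁ : ∀ x y, p (x * y) = m (LinearMap.id (R := k) x) (p y) := fun x y => (hm x y).symm
  refine LinearMap.ext fun v => lTensor_injective_of_injective hδ ?_
  -- The stages are R₁₃R₁₂(h₍₁₎ ⊗ h₍₂₎ ⊗ h₍₃₎), then R₁₃(h₍₂₎ ⊗ h₍₁₎ ⊗ h₍₃₎)R₁₂, then (h₍₃₎ ⊗ h₍₁₎ ⊗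
  -- h₍₂₎)R₁₃R₁₂, projected by p, πA, πB.
  let L : H × H → H × H → H ⊗[k] (H ⊗[k] H) →ₗ[k] C ⊗[k] (A ⊗[k] B) := fun i j =>
    TensorProduct.map (p ∘ₗ LinearMap.mulLeft k (i.1 * j.1))
      (TensorProduct.map (πA ∘ₗ LinearMap.mulLeft k j.2) (πB ∘ₗ LinearMap.mulLeft k i.2))
  let M : H × H → H × H → H ⊗[k] (H ⊗[k] H) →ₗ[k] C ⊗[k] (A ⊗[k] B) := fun i j =>
    TensorProduct.map (p ∘ₗ LinearMap.mulLeft k i.1 ∘ₗ LinearMap.mulRight k j.1)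
      (TensorProduct.map (πA ∘ₗ LinearMap.mulRight k j.2) (πB ∘ₗ LinearMap.mulLeft k i.2)) ∘ₗ
      (TensorProduct.leftComm k H H H).toLinearMap
  let K : H × H → H × H → H ⊗[k] (H ⊗[k] H) →ₗ[k] C ⊗[k] (A ⊗[k] B) := fun i j =>
    TensorProduct.map (p ∘ₗ LinearMap.mulRight k (i.1 * j.1))
      (TensorProduct.map (πA ∘ₗ LinearMap.mulRight k j.2) (πB ∘ₗ LinearMap.mulRight k i.2)) ∘ₗ
      (TensorProduct.comm k (H ⊗[k] H) H).toLinearMap ∘ₗ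
      (TensorProduct.assoc k H H H).symm.toLinearMap
  let Φ := TensorProduct.map₂ m (TensorProduct.map₂ mA mB)
  have hΦ : ∀ u v : H ⊗[k] H, (TensorProduct.map πA πB ∘ₗ comul).lTensor C
      (TensorProduct.map p LinearMap.id (u * v)) =
        Φ (TensorProduct.map LinearMap.id (TensorProduct.map LinearMap.id πB ∘ₗ comul) u)
          (TensorProduct.map p (TensorProduct.map πA πB ∘ₗ comul) v) := fun u v => by
    rw [← LinearMap.comp_apply, LinearMap.lTensor_comp_map, LinearMap.comp_id,
      map_mul_eq_map₂ hm₁ hδm]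
  have sumL : ∀ x, (TensorProduct.map πA πB ∘ₗ comul).lTensor C (mulComul s p LinearMap.id x) =
      ∑ i ∈ s, ∑ j ∈ s, L i j (comulTwice x) := fun x => by
    have e : ∀ i j : H × H, ∀ t : H ⊗[k] (H ⊗[k] H),
        Φ (LinearMap.id (R := k) (i.1 * j.1) ⊗ₜ[k] (LinearMap.id (R := k) j.2 ⊗ₜ[k] πB i.2))
          (TensorProduct.map p (TensorProduct.map πA πB) t) = L i j t := fun i j t => by
      have : Φ (LinearMap.id (R := k) (i.1 * j.1) ⊗ₜ[k]
          (LinearMap.id (R := k) j.2 ⊗ₜ[k] πB i.2)) ∘ₗ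
          TensorProduct.map p (TensorProduct.map πA πB) = L i j := by
        ext a b c
        simp [Φ, L, hA, hB, hm, mul_assoc]
      exact LinearMap.congr_fun this t
    have triple : TensorProduct.map p (TensorProduct.map πA πB ∘ₗ comul) (comul (R := k) x) =
        TensorProduct.map p (TensorProduct.map πA πB) (comulTwice (k := k) x) := by
      rw [comulTwice, ← LinearMap.comp_apply, ← LinearMap.map_comp_lTensor]
      rfl
    have := congrArg (fun w => Φ w (TensorProduct.map p (TensorProduct.map πA πB)
      (comulTwice (k := k) x))) h₁
    simp only [map_sum, LinearMap.sum_apply, e] at this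
    rw [← this]
    simp only [mulComul_apply, map_sum, hΦ, triple]
    rfl
  have sumK : ∀ x, (TensorProduct.map πA πB ∘ₗ comul).lTensor C (opComulMul s p LinearMap.id x) =
      ∑ i ∈ s, ∑ j ∈ s, K i j (comulTwice x) := fun x => by
    have e : ∀ i j : H × H, ∀ t : H ⊗[k] (H ⊗[k] H),
        Φ (TensorProduct.map LinearMap.id (TensorProduct.map LinearMap.id πB)
            (TensorProduct.comm k (H ⊗[k] H) H ((TensorProduct.assoc k H H H).symm t)))
          (p (i.1 * j.1) ⊗ₜ[k] (πA j.2 ⊗ₜ[k] πB i.2)) = K i j t := fun i j t => by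
      have : Φ.flip (p (i.1 * j.1) ⊗ₜ[k] (πA j.2 ⊗ₜ[k] πB i.2)) ∘ₗ
          TensorProduct.map LinearMap.id (TensorProduct.map LinearMap.id πB) ∘ₗ
            (TensorProduct.comm k (H ⊗[k] H) H).toLinearMap ∘ₗ
            (TensorProduct.assoc k H H H).symm.toLinearMap = K i j := by
        ext a b c
        simp [Φ, K, hA, hB, hm, mul_assoc]
      exact LinearMap.congr_fun this t
    have triple : TensorProduct.map LinearMap.id (TensorProduct.map LinearMap.id πB ∘ₗ comul)
        (TensorProduct.comm k H H (comul (R := k) x)) =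
        TensorProduct.map LinearMap.id (TensorProduct.map LinearMap.id πB)
          (TensorProduct.comm k (H ⊗[k] H) H
            ((TensorProduct.assoc k H H H).symm (comulTwice (k := k) x))) := by
      rw [comulTwice, LinearMap.comp_apply, ← coassoc_apply, LinearEquiv.symm_apply_apply]
      induction comul (R := k) x with
      | zero => simp
      | add u v hu hv => simp only [map_add, hu, hv]
      | tmul a b => simp
    have := congrArg (Φ (TensorProduct.map LinearMap.id (TensorProduct.map LinearMap.id πB)
      (TensorProduct.comm k (H ⊗[k] H) H
        ((TensorProduct.assoc k H H H).symm (comulTwice (k := k) x))))) h₂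
    simp only [map_sum, e] at this
    rw [← this]
    simp only [opComulMul_apply, map_sum, hΦ, triple]
    rfl
  have sumLM : ∀ v, ∀ i : H × H, ∑ j ∈ s, L i j (comulTwice (g v)) =
      ∑ j ∈ s, M i j (comulTwice (g v)) := fun v i => by
    rw [comulTwice, LinearMap.comp_apply, ← coassoc_apply]
    let Θ : (C ⊗[k] A) ⊗[k] B →ₗ[k] C ⊗[k] (A ⊗[k] B) :=
      (TensorProduct.assoc k C A B).toLinearMap ∘ₗ
        TensorProduct.map ((m i.1).rTensor A) (mB (πB i.2))
    have eL : ∀ u : H ⊗[k] H, ∑ j ∈ s, L i j (TensorProduct.assoc k H H H (comul.rTensor H u)) =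
        Θ ((mulComul s p πA).rTensor B (TensorProduct.map LinearMap.id πB u)) := fun u => by
      induction u with
      | zero => simp
      | add u v hu hv => simp only [map_add, Finset.sum_add_distrib, hu, hv]
      | tmul a b =>
        simp only [LinearMap.rTensor_tmul, TensorProduct.map_tmul, mulComul_apply,
          TensorProduct.sum_tmul, map_sum, LinearMap.id_apply]
        refine Finset.sum_congr rfl fun j _ => ?_
        induction comul (R := k) a with
        | zero => simp
        | add u v hu hv => simp only [map_add, mul_add, TensorProduct.add_tmul, hu, hv]
        | tmul c d => simp [L, Θ, hB, hm]
    have eM : ∀ u : H ⊗[k] H, ∑ j ∈ s, M i j (TensorProduct.assoc k H H H (comul.rTensor H u)) =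
        Θ ((opComulMul s p πA).rTensor B (TensorProduct.map LinearMap.id πB u)) := fun u => by
      induction u with
      | zero => simp
      | add u v hu hv => simp only [map_add, Finset.sum_add_distrib, hu, hv]
      | tmul a b =>
        simp only [LinearMap.rTensor_tmul, TensorProduct.map_tmul, opComulMul_apply,
          TensorProduct.sum_tmul, map_sum, LinearMap.id_apply]
        refine Finset.sum_congr rfl fun j _ => ?_
        induction comul (R := k) a with
        | zero => simp
        | add u v hu hv => simp only [map_add, add_mul, TensorProduct.add_tmul, hu, hv]
        | tmul c d => simp [M, Θ, hB, hm]
    rw [eL, eM, hg, ← LinearMap.comp_apply (LinearMap.rTensor B _), ← LinearMap.rTensor_comp, h₄,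
      LinearMap.rTensor_comp]
    rfl
  have sumMK : ∀ x, ∀ j : H × H, ∑ i ∈ s, M i j (comulTwice x) =
      ∑ i ∈ s, K i j (comulTwice x) := fun x j => by
    rw [comulTwice, LinearMap.comp_apply]
    induction comul (R := k) x with
    | zero => simp
    | add u v hu hv => simp only [map_add, Finset.sum_add_distrib, hu, hv]
    | tmul a b =>
      let F := TensorProduct.map (m.flip (p j.1)) (TensorProduct.mk k A B (πA (a * j.2)))
      have eM : ∀ i : H × H, ∀ w, M i j (a ⊗ₜ[k] w) =
          F (TensorProduct.map LinearMap.id πB ((i.1 ⊗ₜ[k] i.2) * w)) := fun i w => by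
        induction w with
        | zero => simp
        | add u v hu hv => simp only [map_add, mul_add, TensorProduct.tmul_add, hu, hv]
        | tmul b c => simp [M, F, hm, mul_assoc]
      have eK : ∀ i : H × H, ∀ w, K i j (a ⊗ₜ[k] w) =
          F (TensorProduct.map LinearMap.id πB
            (TensorProduct.comm k H H w * (i.1 ⊗ₜ[k] i.2))) := fun i w => by
        induction w with
        | zero => simp
        | add u v hu hv => simp only [map_add, add_mul, TensorProduct.tmul_add, hu, hv]
        | tmul b c => simp [K, F, hm, mul_assoc]
      have := congrArg F (LinearMap.congr_fun h₃ b)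
      simpa only [mulComul_apply, opComulMul_apply, map_sum, LinearMap.lTensor_tmul, eM, eK]
        using this
  simp only [LinearMap.comp_apply, sumL, sumK, sumLM]
  rw [Finset.sum_comm]
  simp only [sumMK]
  rw [Finset.sum_comm]

end Legs

/-! ### Reduction of quasitriangularity to the projections of a splitting -/

section Legs

variable {k : Type*} [Field k]
variable {H C D E C' D' E' A B V V' : Type*} [Ring H] [Bialgebra k H]
  [AddCommGroup C] [Module k C] [AddCommGroup D] [Module k D] [AddCommGroup E] [Module k E]
  [AddCommGroup C'] [Module k C'] [AddCommGroup D'] [Module k D'] [AddCommGroup E'] [Module k E']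
  [AddCommGroup A] [Module k A] [AddCommGroup B] [Module k B]
  [AddCommGroup V] [Module k V] [AddCommGroup V'] [Module k V']
variable {s : Finset (H × H)} {p : H →ₗ[k] C} {q : H →ₗ[k] D} {r : H →ₗ[k] E}
  {πA : H →ₗ[k] A} {πB : H →ₗ[k] B} {g : V →ₗ[k] H} {g' : V' →ₗ[k] H}

theorem LeftHexagon.comp (h : LeftHexagon s p q r) (f : C →ₗ[k] C') (f' : D →ₗ[k] D')
    (f'' : E →ₗ[k] E') : LeftHexagon s (f ∘ₗ p) (f' ∘ₗ q) (f'' ∘ₗ r) := by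
  have := h.apply (TensorProduct.map f f') f''
  simpa only [LeftHexagon, TensorProduct.map_comp, LinearMap.comp_apply, TensorProduct.map_tmul]
    using this

theorem RightHexagon.comp (h : RightHexagon s p q r) (f : C →ₗ[k] C') (f' : D →ₗ[k] D')
    (f'' : E →ₗ[k] E') : RightHexagon s (f ∘ₗ p) (f' ∘ₗ q) (f'' ∘ₗ r) := by
  have := h.apply f (TensorProduct.map f' f'')
  simpa only [RightHexagon, TensorProduct.map_comp, LinearMap.comp_apply, TensorProduct.map_tmul]
    using this

theorem map_mulComul (f : C →ₗ[k] C') (f' : D →ₗ[k] D') :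
    TensorProduct.map f f' ∘ₗ mulComul s p q = mulComul s (f ∘ₗ p) (f' ∘ₗ q) := by
  ext x
  simp only [LinearMap.comp_apply, mulComul_apply, map_sum, TensorProduct.map_comp]

theorem map_opComulMul (f : C →ₗ[k] C') (f' : D →ₗ[k] D') :
    TensorProduct.map f f' ∘ₗ opComulMul s p q = opComulMul s (f ∘ₗ p) (f' ∘ₗ q) := by
  ext x
  simp only [LinearMap.comp_apply, opComulMul_apply, map_sum, TensorProduct.map_comp]

theorem mulFactors_id : MulFactors (LinearMap.id (R := k) (M := H)) LinearMap.id :=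
  ⟨LinearMap.mul k H, fun _ _ => rfl⟩

theorem MulFactors.of_id (h : MulFactors p p) : MulFactors LinearMap.id p := by
  obtain ⟨m, hm⟩ := h
  exact ⟨m ∘ₗ p, hm⟩

theorem comulFactors_id : ComulFactors LinearMap.id p q :=
  ⟨TensorProduct.map p q ∘ₗ comul, fun _ => rfl⟩

/-- RΔ(x)Δ(y) = Δᵒᵖ(x)RΔ(y) = Δᵒᵖ(x)Δᵒᵖ(y)R. The first equality multiplies a projected equation on
the right, so both projections must be multiplicative; this excludes πA. -/
theorem mulComul_eq_opComulMul_mul (hp : MulFactors p p) (hq : MulFactors q q) {x y : H}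
    (hx : mulComul s p q x = opComulMul s p q x) (hy : mulComul s p q y = opComulMul s p q y) :
    mulComul s p q (x * y) = opComulMul s p q (x * y) := by
  obtain ⟨m, hm⟩ := hp
  obtain ⟨m', hm'⟩ := hq
  have key := map_mul_eq_map₂ hm hm'
  have hL : mulComul s p q (x * y) =
      TensorProduct.map₂ m m' (mulComul s p q x) (TensorProduct.map p q (comul y)) := by
    simp only [mulComul_apply, map_sum, LinearMap.sum_apply, Bialgebra.comul_mul, ← key, mul_assoc]
  have hR : opComulMul s p q (x * y) = TensorProduct.map₂ m m'
      (TensorProduct.map p q (TensorProduct.comm k H H (comul x))) (opComulMul s p q y) := by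
    have hc : ∀ u v : H ⊗[k] H, TensorProduct.comm k H H (u * v) =
        TensorProduct.comm k H H u * TensorProduct.comm k H H v :=
      fun u v => map_mul (Algebra.TensorProduct.comm k H H) u v
    simp only [opComulMul_apply, map_sum, Bialgebra.comul_mul, hc, ← key, mul_assoc]
  rw [hL, hR, hx, ← hy]
  simp only [opComulMul_apply, mulComul_apply, map_sum, LinearMap.sum_apply, ← key, mul_assoc]

theorem mulComul_eq_opComulMul_of_span (hp : MulFactors p p) (hq : MulFactors q q)
    (hspan : Submodule.span k {x : H | ∃ v v', x = g v * g' v'} = ⊤)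
    (h : mulComul s p q ∘ₗ g = opComulMul s p q ∘ₗ g)
    (h' : mulComul s p q ∘ₗ g' = opComulMul s p q ∘ₗ g') :
    mulComul s p q = opComulMul s p q := by
  refine LinearMap.ext_on hspan ?_
  rintro x ⟨v, v', rfl⟩
  exact mulComul_eq_opComulMul_mul hp hq (LinearMap.congr_fun h v) (LinearMap.congr_fun h' v')

/-- A bialgebra `H` with a left `H`-module quotient `A` and an algebra and coalgebra quotient `B`
such that `∑ πA h₍₁₎ ⊗ πB h₍₂₎` determines `h`, generated by two right `B`-subcomodules. -/
structure IsSplitting (πA : H →ₗ[k] A) (πB : H →ₗ[k] B) (g : V →ₗ[k] H) (g' : V' →ₗ[k] H) :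
    Prop where
  injective : Function.Injective (TensorProduct.map πA πB ∘ₗ comul)
  mul_left : MulFactors LinearMap.id πA
  mul_right : MulFactors πB πB
  comul_right : ComulFactors πB πB πB
  subcomodule : ∃ c : V →ₗ[k] V ⊗[k] B,
    ∀ v, TensorProduct.map LinearMap.id πB (comul (R := k) (g v)) = g.rTensor B (c v)
  subcomodule' : ∃ c : V' →ₗ[k] V' ⊗[k] B,
    ∀ v, TensorProduct.map LinearMap.id πB (comul (R := k) (g' v)) = g'.rTensor B (c v)
  span_eq_top : Submodule.span k {x : H | ∃ v v', x = g v * g' v'} = ⊤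

/-- The images under `πA` and `πB` of the hexagon identities. -/
structure ProjectedHexagons (s : Finset (H × H)) (πA : H →ₗ[k] A) (πB : H →ₗ[k] B) : Prop where
  left_ABid : LeftHexagon s πA πB LinearMap.id
  left_AAA : LeftHexagon s πA πA πA
  left_AAB : LeftHexagon s πA πA πB
  left_BAA : LeftHexagon s πB πA πA
  left_BAB : LeftHexagon s πB πA πB
  left_BBA : LeftHexagon s πB πB πA
  left_BBB : LeftHexagon s πB πB πB
  right_AAB : RightHexagon s πA πA πB
  right_BAB : RightHexagon s πB πA πB
  right_AAA : RightHexagon s πA πA πA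
  right_ABA : RightHexagon s πA πB πA
  right_ABB : RightHexagon s πA πB πB
  right_BAA : RightHexagon s πB πA πA
  right_BBA : RightHexagon s πB πB πA
  right_BBB : RightHexagon s πB πB πB

/-- The images under `πA` and `πB` of `R Δ(h) = Δᵒᵖ(h) R` for `h` in the image of `g`. -/
structure ProjectedIntertwining (s : Finset (H × H)) (πA : H →ₗ[k] A) (πB : H →ₗ[k] B)
    (g : V →ₗ[k] H) : Prop where
  AA : mulComul s πA πA ∘ₗ g = opComulMul s πA πA ∘ₗ g
  AB : mulComul s πA πB ∘ₗ g = opComulMul s πA πB ∘ₗ g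
  BA : mulComul s πB πA ∘ₗ g = opComulMul s πB πA ∘ₗ g
  BB : mulComul s πB πB ∘ₗ g = opComulMul s πB πB ∘ₗ g

theorem ProjectedHexagons.of_hexagons
    (hl : LeftHexagon (k := k) s LinearMap.id LinearMap.id LinearMap.id)
    (hr : RightHexagon (k := k) s LinearMap.id LinearMap.id LinearMap.id) :
    ProjectedHexagons s πA πB where
  left_ABid := hl.comp πA πB LinearMap.id
  left_AAA := hl.comp πA πA πA
  left_AAB := hl.comp πA πA πB
  left_BAA := hl.comp πB πA πA
  left_BAB := hl.comp πB πA πB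
  left_BBA := hl.comp πB πB πA
  left_BBB := hl.comp πB πB πB
  right_AAB := hr.comp πA πA πB
  right_BAB := hr.comp πB πA πB
  right_AAA := hr.comp πA πA πA
  right_ABA := hr.comp πA πB πA
  right_ABB := hr.comp πA πB πB
  right_BAA := hr.comp πB πA πA
  right_BBA := hr.comp πB πB πA
  right_BBB := hr.comp πB πB πB

theorem mulComul_comp_eq
    (h : mulComul s (LinearMap.id (R := k)) LinearMap.id = opComulMul s LinearMap.id LinearMap.id)
    (p : H →ₗ[k] C) (q : H →ₗ[k] D) : mulComul s p q ∘ₗ g = opComulMul s p q ∘ₗ g := by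
  have := congrArg (fun f => (TensorProduct.map p q ∘ₗ f) ∘ₗ g) h
  simpa only [map_mulComul, map_opComulMul, LinearMap.comp_id] using this

theorem ProjectedIntertwining.of_eq
    (h : mulComul s (LinearMap.id (R := k)) LinearMap.id = opComulMul s LinearMap.id LinearMap.id) :
    ProjectedIntertwining s πA πB g :=
  ⟨mulComul_comp_eq h πA πA, mulComul_comp_eq h πA πB, mulComul_comp_eq h πB πA,
    mulComul_comp_eq h πB πB⟩

/-- `LeftHexagon.id_left` is used twice: with second leg πB, whose coproduct stays in B, and then
with second leg `id`, after `id_middle` has supplied the hexagons with a full middle leg. -/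
theorem IsSplitting.leftHexagons (hs : IsSplitting πA πB g g') (hr : MulFactors r r)
    (hAB : LeftHexagon s πA πB r) (hAA : LeftHexagon s πA πA r) (hBA : LeftHexagon s πB πA r)
    (hBB : LeftHexagon s πB πB r) :
    LeftHexagon s LinearMap.id πB r ∧ LeftHexagon s LinearMap.id LinearMap.id r :=
  have a := LeftHexagon.id_left hs.injective hs.comul_right hr hAB hBB hAB
  ⟨a, LeftHexagon.id_left hs.injective comulFactors_id hr (a.id_middle hs.injective hr hAA hAB)
    (a.id_middle hs.injective hr hBA hAB) hAB⟩

theorem IsSplitting.leftHexagon_id_B_B (hs : IsSplitting πA πB g g')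
    (h : ProjectedHexagons s πA πB) :
    LeftHexagon s LinearMap.id πB πB ∧ LeftHexagon s LinearMap.id LinearMap.id πB :=
  hs.leftHexagons hs.mul_right (h.left_ABid.comp LinearMap.id LinearMap.id πB)
    h.left_AAB h.left_BAB h.left_BBB

/-- The promotion has to alternate between the two hexagons. Left hexagons over B in the last leg
give right hexagons with a full first leg; these give left hexagons with a full last leg, and a full
left hexagon then allows the last right ones. The hypothesis `left_ABid`, the only one with a full
leg, starts every expansion of δ on the first tensor factor of R. -/
theorem IsSplitting.hexagons (hs : IsSplitting πA πB g g') (h : ProjectedHexagons s πA πB) :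
    LeftHexagon (k := k) s LinearMap.id LinearMap.id LinearMap.id ∧
      RightHexagon (k := k) s LinearMap.id LinearMap.id LinearMap.id := by
  have hδ := hs.injective
  have hA := hs.mul_left
  have hB := hs.mul_right
  have hΔ := hs.comul_right
  have h1 : MulFactors (LinearMap.id (R := k) (M := H)) LinearMap.id := mulFactors_id
  have hB' := hB.of_id
  -- Names record the hexagon, `l` or `r`, and its three legs, with `1` for a full leg.
  obtain ⟨l1BB, l11B⟩ := hs.leftHexagon_id_B_B h
  have r1BB := RightHexagon.id_left hδ hA hB hB hB h.left_ABid h.right_ABB h.right_BBB l1BB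
  have rA1B := RightHexagon.id_middle hδ hΔ hA h.right_AAB r1BB h.right_AAB
  have rB1B := RightHexagon.id_middle hδ hΔ hB' h.right_BAB r1BB h.right_BAB
  -- The leg πA is only a module quotient, so its coefficients come from the full algebra; hence
  -- `rA1B` and not just `right_AAB` is needed.
  have r1AB := RightHexagon.id_left hδ hA hB hA hB h.left_ABid rA1B h.right_BAB l1BB
  have lAA1 := LeftHexagon.id_right hδ hA hB hA hA r1AB l11B h.left_AAA rA1B h.right_AAB
  have lBA1 := LeftHexagon.id_right hδ hA hB hB' hA r1AB l11B h.left_BAA rB1B h.right_AAB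
  have lBB1 := LeftHexagon.id_right hδ hA hB hB' hB' r1AB l11B h.left_BBA rB1B h.right_BAB
  obtain ⟨l1B1, l111⟩ := hs.leftHexagons h1 h.left_ABid lAA1 lBA1 lBB1
  have rAB1 := RightHexagon.id_right hδ hA rA1B h.right_ABA r1AB
  have rAA1 := RightHexagon.id_right hδ hA rA1B h.right_AAA r1AB
  have rBB1 := RightHexagon.id_right hδ hB' rB1B h.right_BBA r1AB
  have rBA1 := RightHexagon.id_right hδ hB' rB1B h.right_BAA r1AB
  have r1B1 := RightHexagon.id_left hδ hA hB hB h1 h.left_ABid rAB1 rBB1 l1B1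
  have rA11 := RightHexagon.id_middle hδ comulFactors_id hA rAA1 r1B1 h.right_AAB
  have rB11 := RightHexagon.id_middle hδ comulFactors_id hB' rBA1 r1B1 h.right_BAB
  exact ⟨l111, RightHexagon.id_left hδ hA hB h1 h1 h.left_ABid rA11 rB11 l1B1⟩

/-- A relation passes from the two generating subspaces to all of H only when neither leg is πA. So
πA is first promoted to a full leg on each subspace, and extension to H by multiplicativity follows.
The order is BB, (1,B), (B,1), and finally (A,1) promoted to (1,1). -/
theorem IsSplitting.mulComul_eq (hs : IsSplitting πA πB g g')
    (hl : LeftHexagon (k := k) s LinearMap.id LinearMap.id LinearMap.id)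
    (hr : RightHexagon (k := k) s LinearMap.id LinearMap.id LinearMap.id)
    (h : ProjectedIntertwining s πA πB g) (h' : ProjectedIntertwining s πA πB g') :
    mulComul s (LinearMap.id (R := k)) LinearMap.id =
      opComulMul s LinearMap.id LinearMap.id := by
  have hδ := hs.injective
  have hA := hs.mul_left
  have hB := hs.mul_right
  have h1 : MulFactors (LinearMap.id (R := k) (M := H)) LinearMap.id := mulFactors_id
  obtain ⟨c, hc⟩ := hs.subcomodule
  obtain ⟨c', hc'⟩ := hs.subcomodule'
  have lBB := hl.comp LinearMap.id πB πB
  have lAB := hl.comp πA πB πB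
  have r1B := hr.comp LinearMap.id LinearMap.id πB
  have eBB := mulComul_eq_opComulMul_of_span hB hB hs.span_eq_top h.BB h'.BB
  have e1B := mulComul_eq_opComulMul_of_span h1 hB hs.span_eq_top
    (mulComul_eq_of_subcomodule_left hδ hA hB hB hc lBB lAB eBB h.AB)
    (mulComul_eq_of_subcomodule_left hδ hA hB hB hc' lBB lAB eBB h'.AB)
  have eB1 := mulComul_eq_opComulMul_of_span hB h1 hs.span_eq_top
    (mulComul_eq_of_subcomodule_right hδ hA hB hB.of_id hc r1B (hr.comp πB πA πB) e1B h.BA)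
    (mulComul_eq_of_subcomodule_right hδ hA hB hB.of_id hc' r1B (hr.comp πB πA πB) e1B h'.BA)
  -- The (A,1) relation stays restricted to the two subspaces; this is all that the last promotion
  -- asks of it.
  have eA := mulComul_eq_of_subcomodule_right hδ hA hB hA hc r1B (hr.comp πA πA πB) e1B h.AA
  have eA' := mulComul_eq_of_subcomodule_right hδ hA hB hA hc' r1B (hr.comp πA πA πB) e1B h'.AA
  exact mulComul_eq_opComulMul_of_span h1 h1 hs.span_eq_top
    (mulComul_eq_of_subcomodule_left hδ hA hB h1 hc (hl.comp LinearMap.id πB LinearMap.id)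
      (hl.comp πA πB LinearMap.id) eB1 eA)
    (mulComul_eq_of_subcomodule_left hδ hA hB h1 hc' (hl.comp LinearMap.id πB LinearMap.id)
      (hl.comp πA πB LinearMap.id) eB1 eA')

/-! ### Comparison with quasitriangular structures -/

theorem leftHexagon_id_iff : LeftHexagon (k := k) s LinearMap.id LinearMap.id LinearMap.id ↔
    (comul (R := k) (A := H)).rTensor H (∑ i ∈ s, i.1 ⊗ₜ[k] i.2) =
      leg13 k (∑ i ∈ s, i.1 ⊗ₜ[k] i.2) * leg23 k (∑ i ∈ s, i.1 ⊗ₜ[k] i.2) := by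
  simp [LeftHexagon, leg13, leg23, Finset.sum_mul_sum, TensorProduct.map_id]

theorem rightHexagon_id_iff : RightHexagon (k := k) s LinearMap.id LinearMap.id LinearMap.id ↔
    (TensorProduct.assoc k H H H).symm ((comul (R := k) (A := H)).lTensor H
      (∑ i ∈ s, i.1 ⊗ₜ[k] i.2)) =
      leg13 k (∑ i ∈ s, i.1 ⊗ₜ[k] i.2) * leg12 k (∑ i ∈ s, i.1 ⊗ₜ[k] i.2) := by
  rw [LinearEquiv.symm_apply_eq]
  simp [RightHexagon, leg13, leg12, Finset.sum_mul_sum, TensorProduct.map_id]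

theorem mulComul_id_iff :
    mulComul s (LinearMap.id (R := k)) LinearMap.id =
      opComulMul s LinearMap.id (LinearMap.id (R := k) (M := H)) ↔
    ∀ h : H, (∑ i ∈ s, i.1 ⊗ₜ[k] i.2) * comul (R := k) h =
      TensorProduct.comm k H H (comul (R := k) h) * (∑ i ∈ s, i.1 ⊗ₜ[k] i.2) := by
  simp [LinearMap.ext_iff, mulComul_apply, opComulMul_apply, TensorProduct.map_id,
    Finset.sum_mul, Finset.mul_sum]

/-- The forward direction projects the axioms; the converse is the promotion of legs in
`IsSplitting.hexagons` and `IsSplitting.mulComul_eq`. -/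
theorem IsSplitting.isQuasitriangular_iff (hs : IsSplitting πA πB g g') :
    IsQuasitriangular k (∑ i ∈ s, i.1 ⊗ₜ[k] i.2) ↔
      TensorProduct.lid k H ((counit (R := k) (A := H)).rTensor H (∑ i ∈ s, i.1 ⊗ₜ[k] i.2)) = 1 ∧
      TensorProduct.rid k H ((counit (R := k) (A := H)).lTensor H (∑ i ∈ s, i.1 ⊗ₜ[k] i.2)) = 1 ∧
      ProjectedHexagons s πA πB ∧ ProjectedIntertwining s πA πB g ∧
        ProjectedIntertwining s πA πB g' := by
  constructor
  · rintro ⟨h₁, h₂, h₃, h₄, h₅⟩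
    rw [← leftHexagon_id_iff] at h₃
    rw [← rightHexagon_id_iff] at h₄
    rw [← mulComul_id_iff] at h₅
    exact ⟨h₁, h₂, .of_hexagons h₃ h₄, .of_eq h₅, .of_eq h₅⟩
  · rintro ⟨h₁, h₂, h₃, h₄, h₅⟩
    obtain ⟨hl, hr⟩ := hs.hexagons h₃
    exact ⟨h₁, h₂, leftHexagon_id_iff.1 hl, rightHexagon_id_iff.1 hr,
      mulComul_id_iff.1 (hs.mulComul_eq hl hr h₄ h₅)⟩

end Legs

/-! ### The splitting of a smash biproduct -/

section Smash

variable {k A B : Type*} [Field k]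

section

variable {M N N' P P' Q V V' : Type*} [AddCommGroup M] [AddCommGroup N] [AddCommGroup N']
    [AddCommGroup P] [AddCommGroup P'] [AddCommGroup Q] [Module k M] [Module k N] [Module k N']
    [Module k P] [Module k P'] [Module k Q]

theorem midMap_tmul (f : N ⊗[k] P →ₗ[k] N' ⊗[k] P') (m : M) (n : N) (p : P) (q : Q) :
    midMap f ((m ⊗ₜ[k] n) ⊗ₜ[k] (p ⊗ₜ[k] q)) =
      TensorProduct.map (TensorProduct.mk k M N' m) ((TensorProduct.mk k P' Q).flip q)
        (f (n ⊗ₜ[k] p)) := by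
  simp only [midMap, LinearMap.comp_apply, LinearEquiv.coe_coe, TensorProduct.assoc_tmul,
    LinearMap.lTensor_tmul, TensorProduct.assoc_symm_tmul, LinearMap.rTensor_tmul]
  induction f (n ⊗ₜ[k] p) with
  | zero => simp
  | add u v hu hv => simp only [map_add, TensorProduct.add_tmul, TensorProduct.tmul_add, hu, hv]
  | tmul a b => simp

end

variable (k A B) in
/-- `a ⊗ b ↦ ε(b) a`. -/
noncomputable def counitRight [AddCommGroup A] [Module k A] [AddCommGroup B] [Module k B]
    [Coalgebra k B] : A ⊗[k] B →ₗ[k] A :=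
  (TensorProduct.rid k A).toLinearMap ∘ₗ (counit (R := k) (A := B)).lTensor A

variable (k A B) in
/-- `a ⊗ b ↦ ε(a) b`. -/
noncomputable def counitLeft [AddCommGroup A] [Module k A] [AddCommGroup B] [Module k B]
    [Coalgebra k A] : A ⊗[k] B →ₗ[k] B :=
  (TensorProduct.lid k B).toLinearMap ∘ₗ (counit (R := k) (A := A)).rTensor B

section

variable [AddCommGroup A] [Module k A] [AddCommGroup B] [Module k B]

@[simp]
theorem counitRight_tmul [Coalgebra k B] (a : A) (b : B) :
    counitRight k A B (a ⊗ₜ[k] b) = counit (R := k) b • a := by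
  simp [counitRight]

@[simp]
theorem counitLeft_tmul [Coalgebra k A] (a : A) (b : B) :
    counitLeft k A B (a ⊗ₜ[k] b) = counit (R := k) a • b := by
  simp [counitLeft]

@[simp]
theorem counitRight_comul [Coalgebra k A] (a : A) :
    counitRight k A A (comul (R := k) a) = a := by
  simp [counitRight]

@[simp]
theorem counitLeft_comul [Coalgebra k A] (a : A) :
    counitLeft k A A (comul (R := k) a) = a := by
  simp [counitLeft]

@[simp]
theorem counit_counitRight [Coalgebra k A] [Coalgebra k B] (x : A ⊗[k] B) :
    counit (R := k) (counitRight k A B x) = smashCounit k A B x := by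
  induction x with
  | zero => simp
  | add u v hu hv => simp only [map_add, hu, hv]
  | tmul a b => simp [smashCounit, mul_comm]

@[simp]
theorem counit_counitLeft [Coalgebra k A] [Coalgebra k B] (x : A ⊗[k] B) :
    counit (R := k) (counitLeft k A B x) = smashCounit k A B x := by
  induction x with
  | zero => simp
  | add u v hu hv => simp only [map_add, hu, hv]
  | tmul a b => simp [smashCounit]

end

/-! ### Projections of the smash coproduct -/

section Coalgebra

variable [AddCommGroup A] [Module k A] [Coalgebra k A] [AddCommGroup B] [Module k B]
  [Coalgebra k B] {τ : A ⊗[k] B →ₗ[k] B ⊗[k] A}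

variable {M N P Q P' : Type*} [AddCommGroup M] [Module k M] [AddCommGroup N] [Module k N]
  [AddCommGroup P] [Module k P] [AddCommGroup Q] [Module k Q] [AddCommGroup P'] [Module k P']

/-- The tensor `comul a ⊗ₜ comul b` is not pure, while `midMap` is explicit only on pure tensors.
Identities for the smash coproduct are therefore phrased as equalities of linear maps and checked
there. -/
theorem eq_of_eq_on_tmul_four {F G : (M ⊗[k] N) ⊗[k] (P ⊗[k] Q) →ₗ[k] P'}
    (h : ∀ m n p q, F ((m ⊗ₜ[k] n) ⊗ₜ[k] (p ⊗ₜ[k] q)) = G ((m ⊗ₜ[k] n) ⊗ₜ[k] (p ⊗ₜ[k] q)))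
    (u : M ⊗[k] N) (v : P ⊗[k] Q) : F (u ⊗ₜ[k] v) = G (u ⊗ₜ[k] v) :=
  LinearMap.congr_fun (TensorProduct.ext_fourfold' h) _

theorem smashComul_tmul (a : A) (b : B) :
    smashComul τ (a ⊗ₜ[k] b) = midMap τ (comul a ⊗ₜ[k] comul b) := rfl

/-- Conormality of τ is not assumed: it follows from the left counit axiom of the smash coproduct on
applying the counit of B to the remaining factor. -/
theorem IsSmashCoproduct.counitLeft_apply (h : IsSmashCoproduct τ) (a : A) (b : B) :
    counitLeft k B A (τ (a ⊗ₜ[k] b)) = counit (R := k) b • a := by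
  have key := eq_of_eq_on_tmul_four
    (F := (TensorProduct.lid k A).toLinearMap ∘ₗ (counitRight k A B).lTensor k ∘ₗ
      (smashCounit k A B).rTensor (A ⊗[k] B) ∘ₗ midMap τ)
    (G := counitLeft k B A ∘ₗ τ ∘ₗ
      TensorProduct.map (counitLeft k A A) (counitRight k B B))
    (fun a₁ a₂ b₁ b₂ => by
      simp only [LinearMap.comp_apply, midMap_tmul, TensorProduct.map_tmul, counitLeft_tmul,
        counitRight_tmul, TensorProduct.smul_tmul_smul, map_smul]
      induction τ (a₂ ⊗ₜ[k] b₁) with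
      | zero => simp
      | add u u' hu hu' => simp only [map_add, smul_add, hu, hu']
      | tmul c d =>
        simp [smashCounit, smul_smul, mul_comm, mul_left_comm]) (comul a) (comul b)
  have h₂ := h.counit_left (a ⊗ₜ[k] b)
  simp only [LinearMap.comp_apply, ← smashComul_tmul, h₂] at key
  simpa using key.symm

theorem IsSmashCoproduct.counitRight_apply (h : IsSmashCoproduct τ) (a : A) (b : B) :
    counitRight k B A (τ (a ⊗ₜ[k] b)) = counit (R := k) a • b := by
  have key := eq_of_eq_on_tmul_four
    (F := (TensorProduct.rid k B).toLinearMap ∘ₗ (counitLeft k A B).rTensor k ∘ₗ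
      (smashCounit k A B).lTensor (A ⊗[k] B) ∘ₗ midMap τ)
    (G := counitRight k B A ∘ₗ τ ∘ₗ
      TensorProduct.map (counitLeft k A A) (counitRight k B B))
    (fun a₁ a₂ b₁ b₂ => by
      simp only [LinearMap.comp_apply, midMap_tmul, TensorProduct.map_tmul, counitLeft_tmul,
        counitRight_tmul, TensorProduct.smul_tmul_smul, map_smul]
      induction τ (a₂ ⊗ₜ[k] b₁) with
      | zero => simp
      | add u u' hu hu' => simp only [map_add, smul_add, hu, hu']
      | tmul c d =>
        simp [smashCounit, smul_smul, mul_comm, mul_left_comm]) (comul a) (comul b)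
  have h₂ := h.counit_right (a ⊗ₜ[k] b)
  simp only [LinearMap.comp_apply, ← smashComul_tmul, h₂] at key
  simpa using key.symm

theorem IsSmashCoproduct.smashCounit_apply (h : IsSmashCoproduct τ) (a : A) (b : B) :
    smashCounit k B A (τ (a ⊗ₜ[k] b)) = counit (R := k) a * counit (R := k) b := by
  rw [← counit_counitRight, h.counitRight_apply]
  simp

theorem IsSmashCoproduct.map_counitLeft_counitLeft (h : IsSmashCoproduct τ) (x : A ⊗[k] B) :
    TensorProduct.map (counitLeft k A B) (counitLeft k A B) (smashComul τ x) =
      comul (counitLeft k A B x) := by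
  induction x with
  | zero => simp
  | add u v hu hv => simp only [map_add, hu, hv]
  | tmul a b =>
    have key := eq_of_eq_on_tmul_four
      (F := TensorProduct.map (counitLeft k A B) (counitLeft k A B) ∘ₗ midMap τ)
      (G := TensorProduct.lift (LinearMap.lsmul k (B ⊗[k] B)) ∘ₗ
        (smashCounit k A A).rTensor (B ⊗[k] B))
      (fun a₁ a₂ b₁ b₂ => by
        have : ∀ t, TensorProduct.map (counitLeft k A B) (counitLeft k A B)
            (TensorProduct.map (TensorProduct.mk k A B a₁) ((TensorProduct.mk k A B).flip b₂) t) =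
            counit (R := k) a₁ • counitRight k B A t ⊗ₜ[k] b₂ := by
          intro t
          induction t with
          | zero => simp
          | add u u' hu hu' => simp only [map_add, TensorProduct.add_tmul, smul_add, hu, hu']
          | tmul c d =>
            simp [← TensorProduct.smul_tmul', TensorProduct.tmul_smul]
            rw [smul_comm]
        simp only [LinearMap.comp_apply, midMap_tmul, this, h.counitRight_apply]
        simp [smashCounit, ← TensorProduct.smul_tmul', smul_smul]) (comul a) (comul b)
    rw [smashComul_tmul, ← LinearMap.comp_apply, key]
    simp [← counit_counitRight]

theorem IsSmashCoproduct.map_counitRight_counitRight (h : IsSmashCoproduct τ) (x : A ⊗[k] B) :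
    TensorProduct.map (counitRight k A B) (counitRight k A B) (smashComul τ x) =
      comul (counitRight k A B x) := by
  induction x with
  | zero => simp
  | add u v hu hv => simp only [map_add, hu, hv]
  | tmul a b =>
    have key := eq_of_eq_on_tmul_four
      (F := TensorProduct.map (counitRight k A B) (counitRight k A B) ∘ₗ midMap τ)
      (G := (TensorProduct.lift (LinearMap.lsmul k (A ⊗[k] A)).flip) ∘ₗ
        (smashCounit k B B).lTensor (A ⊗[k] A))
      (fun a₁ a₂ b₁ b₂ => by
        have : ∀ t, TensorProduct.map (counitRight k A B) (counitRight k A B)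
            (TensorProduct.map (TensorProduct.mk k A B a₁) ((TensorProduct.mk k A B).flip b₂) t) =
            counit (R := k) b₂ • a₁ ⊗ₜ[k] counitLeft k B A t := by
          intro t
          induction t with
          | zero => simp
          | add u u' hu hu' => simp only [map_add, TensorProduct.tmul_add, smul_add, hu, hu']
          | tmul c d =>
            simp [← TensorProduct.smul_tmul', TensorProduct.tmul_smul]
        simp only [LinearMap.comp_apply, midMap_tmul, this, h.counitLeft_apply]
        simp [smashCounit, TensorProduct.tmul_smul, smul_smul, mul_comm]) (comul a) (comul b)
    rw [smashComul_tmul, ← LinearMap.comp_apply, key]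
    simp [← counit_counitRight]

/-- The outer factors a₍₁₎ and b₍₂₎ survive, and the inner ones are killed because τ preserves the
counit. This gives injectivity of δ. -/
theorem IsSmashCoproduct.map_counitRight_counitLeft (h : IsSmashCoproduct τ) (x : A ⊗[k] B) :
    TensorProduct.map (counitRight k A B) (counitLeft k A B) (smashComul τ x) = x := by
  induction x with
  | zero => simp
  | add u v hu hv => simp only [map_add, hu, hv]
  | tmul a b =>
    have key := eq_of_eq_on_tmul_four
      (F := TensorProduct.map (counitRight k A B) (counitLeft k A B) ∘ₗ midMap τ)
      (G := TensorProduct.map (counitRight k A A) (counitLeft k B B))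
      (fun a₁ a₂ b₁ b₂ => by
        have : ∀ t, TensorProduct.map (counitRight k A B) (counitLeft k A B)
            (TensorProduct.map (TensorProduct.mk k A B a₁) ((TensorProduct.mk k A B).flip b₂) t) =
            smashCounit k B A t • a₁ ⊗ₜ[k] b₂ := by
          intro t
          induction t with
          | zero => simp
          | add u u' hu hu' => simp only [map_add, add_smul, hu, hu']
          | tmul c d =>
            simp [smashCounit, ← TensorProduct.smul_tmul', TensorProduct.tmul_smul, smul_smul,
              mul_comm]
        simp only [LinearMap.comp_apply, midMap_tmul, this, h.smashCounit_apply]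
        simp [← TensorProduct.smul_tmul', TensorProduct.tmul_smul, smul_smul, mul_comm])
      (comul a) (comul b)
    rw [smashComul_tmul, ← LinearMap.comp_apply, key]
    simp

/-- The opposite choice of projections kills the outer factors and leaves τ; no counit property of τ
is involved. -/
theorem map_counitLeft_counitRight_smashComul (x : A ⊗[k] B) :
    TensorProduct.map (counitLeft k A B) (counitRight k A B) (smashComul τ x) = τ x := by
  induction x with
  | zero => simp
  | add u v hu hv => simp only [map_add, hu, hv]
  | tmul a b =>
    have key := eq_of_eq_on_tmul_four
      (F := TensorProduct.map (counitLeft k A B) (counitRight k A B) ∘ₗ midMap τ)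
      (G := τ ∘ₗ TensorProduct.map (counitLeft k A A) (counitRight k B B))
      (fun a₁ a₂ b₁ b₂ => by
        simp only [LinearMap.comp_apply, midMap_tmul, TensorProduct.map_tmul, counitLeft_tmul,
          counitRight_tmul, TensorProduct.smul_tmul_smul, map_smul]
        induction τ (a₂ ⊗ₜ[k] b₁) with
        | zero => simp
        | add u u' hu hu' => simp only [map_add, smul_add, hu, hu']
        | tmul c d =>
          simp [← TensorProduct.smul_tmul', TensorProduct.tmul_smul, smul_smul, mul_comm])
      (comul a) (comul b)
    rw [smashComul_tmul, ← LinearMap.comp_apply, key]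
    simp

/-- The right coaction of B on H touches only the factor b. Hence A ⊗ 1 (when 1 is grouplike) and 1
⊗ B are subcomodules. -/
theorem IsSmashCoproduct.map_id_counitLeft (h : IsSmashCoproduct τ) (a : A) (b : B) :
    TensorProduct.map LinearMap.id (counitLeft k A B) (smashComul τ (a ⊗ₜ[k] b)) =
      (TensorProduct.mk k A B a).rTensor B (comul b) := by
  have key := eq_of_eq_on_tmul_four
    (F := TensorProduct.map LinearMap.id (counitLeft k A B) ∘ₗ midMap τ)
    (G := (TensorProduct.assoc k A B B).symm.toLinearMap ∘ₗ
      (counitRight k A A).rTensor (B ⊗[k] B))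
    (fun a₁ a₂ b₁ b₂ => by
      have : ∀ t, TensorProduct.map LinearMap.id (counitLeft k A B)
          (TensorProduct.map (TensorProduct.mk k A B a₁) ((TensorProduct.mk k A B).flip b₂) t) =
          (a₁ ⊗ₜ[k] counitRight k B A t) ⊗ₜ[k] b₂ := by
        intro t
        induction t with
        | zero => simp
        | add u u' hu hu' =>
          simp only [map_add, TensorProduct.add_tmul, TensorProduct.tmul_add, hu, hu']
        | tmul c d => simp [← TensorProduct.smul_tmul', TensorProduct.tmul_smul]
      simp only [LinearMap.comp_apply, midMap_tmul, this, h.counitRight_apply]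
      simp [← TensorProduct.smul_tmul', TensorProduct.tmul_smul]) (comul a) (comul b)
  rw [smashComul_tmul, ← LinearMap.comp_apply, key]
  simp only [LinearMap.comp_apply, LinearMap.rTensor_tmul, counitRight_comul]
  induction comul (R := k) b with
  | zero => simp
  | add u v hu hv => simp only [map_add, TensorProduct.tmul_add, hu, hv]
  | tmul c d => simp

theorem map_counitLeft_id_smashComul (a : A) (b : B) :
    TensorProduct.map (counitLeft k A B) LinearMap.id (smashComul τ (a ⊗ₜ[k] b)) =
      TensorProduct.assoc k B A B
        ((τ ∘ₗ TensorProduct.mk k A B a).rTensor B (comul b)) := by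
  have key := eq_of_eq_on_tmul_four
    (F := TensorProduct.map (counitLeft k A B) LinearMap.id ∘ₗ midMap τ)
    (G := (TensorProduct.assoc k B A B).toLinearMap ∘ₗ τ.rTensor B ∘ₗ
      (TensorProduct.assoc k A B B).symm.toLinearMap ∘ₗ (counitLeft k A A).rTensor (B ⊗[k] B))
    (fun a₁ a₂ b₁ b₂ => by
      simp only [LinearMap.comp_apply, midMap_tmul, LinearMap.rTensor_tmul, counitLeft_tmul,
        LinearEquiv.coe_coe, TensorProduct.assoc_symm_tmul, ← TensorProduct.smul_tmul', map_smul]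
      induction τ (a₂ ⊗ₜ[k] b₁) with
      | zero => simp
      | add u u' hu hu' => simp only [map_add, smul_add, TensorProduct.add_tmul, hu, hu']
      | tmul c d => simp [← TensorProduct.smul_tmul']) (comul a) (comul b)
  rw [smashComul_tmul, ← LinearMap.comp_apply, key]
  simp only [LinearMap.comp_apply, LinearMap.rTensor_tmul, counitLeft_comul]
  induction comul (R := k) b with
  | zero => simp
  | add u v hu hv => simp only [map_add, TensorProduct.tmul_add, hu, hv]
  | tmul c d => simp

end Coalgebra

end Smash

/-! ### The smash product, its action on A, and the splitting -/

section Smash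

variable {k A B : Type*} [Field k]

section Algebra

variable [Ring A] [Algebra k A] [Ring B] [Algebra k B] {σ : B ⊗[k] A →ₗ[k] A ⊗[k] B}

theorem smashMul_tmul (a a' : A) (b b' : B) :
    smashMul σ ((a ⊗ₜ[k] b) ⊗ₜ[k] (a' ⊗ₜ[k] b')) =
      TensorProduct.map (LinearMap.mulLeft k a) (LinearMap.mulRight k b') (σ (b ⊗ₜ[k] a')) := by
  simp only [smashMul, LinearMap.comp_apply, midMap_tmul]
  induction σ (b ⊗ₜ[k] a') with
  | zero => simp
  | add u v hu hv => simp only [map_add, hu, hv]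
  | tmul c d => simp

theorem IsSmashProduct.apply_one_tmul (h : IsSmashProduct σ) (a : A) :
    σ ((1 : B) ⊗ₜ[k] a) = a ⊗ₜ[k] 1 := by
  have := h.one_mul (a ⊗ₜ[k] (1 : B))
  simpa [smashMul_tmul, LinearMap.mulLeft_one, LinearMap.mulRight_one] using this

theorem IsSmashProduct.apply_tmul_one (h : IsSmashProduct σ) (b : B) :
    σ (b ⊗ₜ[k] (1 : A)) = 1 ⊗ₜ[k] b := by
  have := h.mul_one ((1 : A) ⊗ₜ[k] b)
  simpa [smashMul_tmul, LinearMap.mulLeft_one, LinearMap.mulRight_one] using this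

theorem IsSmashProduct.smashMul_tmul_one_one_tmul (h : IsSmashProduct σ) (a : A) (b : B) :
    smashMul σ ((a ⊗ₜ[k] (1 : B)) ⊗ₜ[k] ((1 : A) ⊗ₜ[k] b)) = a ⊗ₜ[k] b := by
  simp [smashMul_tmul, h.apply_one_tmul]

/-- `(a ⊗ b) ⊗ c ↦ ∑ a c_σ ε(b_σ)`. -/
noncomputable def smashAct [Coalgebra k B] (σ : B ⊗[k] A →ₗ[k] A ⊗[k] B) :
    A ⊗[k] B →ₗ[k] A →ₗ[k] A :=
  TensorProduct.curry
    (counitRight k A B ∘ₗ smashMul σ ∘ₗ ((TensorProduct.mk k A B).flip 1).lTensor (A ⊗[k] B))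

theorem smashAct_tmul [Coalgebra k B] (a c : A) (b : B) :
    smashAct σ (a ⊗ₜ[k] b) c = a * counitRight k A B (σ (b ⊗ₜ[k] c)) := by
  simp only [smashAct, TensorProduct.curry_apply, LinearMap.comp_apply, LinearMap.lTensor_tmul,
    LinearMap.flip_apply, TensorProduct.mk_apply, smashMul_tmul, LinearMap.mulRight_one]
  induction σ (b ⊗ₜ[k] c) with
  | zero => simp
  | add u v hu hv => simp only [map_add, mul_add, hu, hv]
  | tmul c d => simp

/-- The last factor of the product is multiplied only into the B-component, where the counit is
multiplicative. So the kernel of a ⊗ b ↦ ε(b)a is a left ideal, and A is a quotient module. -/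
theorem counitRight_smashMul [Coalgebra k B] (hB : IsCounitalAlgebra k B) (x y : A ⊗[k] B) :
    counitRight k A B (smashMul σ (x ⊗ₜ[k] y)) = smashAct σ x (counitRight k A B y) := by
  induction x with
  | zero => simp
  | add u v hu hv => simp only [map_add, TensorProduct.add_tmul, LinearMap.add_apply, hu, hv]
  | tmul a b =>
    induction y with
    | zero => simp
    | add u v hu hv => simp only [map_add, TensorProduct.tmul_add, hu, hv]
    | tmul a' b' =>
      rw [counitRight_tmul, map_smul, smashAct_tmul, smashMul_tmul]
      induction σ (b ⊗ₜ[k] a') with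
      | zero => simp
      | add u v hu hv => simp only [map_add, mul_add, smul_add, hu, hv]
      | tmul c d => simp [hB.counit_mul, smul_smul, mul_comm]

/-- Multiplicativity of the counit of A leaves ε(a'_σ)b_σ, and right conormality evaluates it. This
is where that hypothesis enters. -/
theorem counitLeft_smashMul [Coalgebra k A] [Coalgebra k B] (hA : IsCounitalAlgebra k A)
    (hσ : IsRightConormal σ) (x y : A ⊗[k] B) :
    counitLeft k A B (smashMul σ (x ⊗ₜ[k] y)) = counitLeft k A B x * counitLeft k A B y := by
  induction x with
  | zero => simp
  | add u v hu hv => simp only [map_add, TensorProduct.add_tmul, add_mul, hu, hv]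
  | tmul a b =>
    induction y with
    | zero => simp
    | add u v hu hv => simp only [map_add, TensorProduct.tmul_add, mul_add, hu, hv]
    | tmul a' b' =>
      have key : ∀ t : A ⊗[k] B, counitLeft k A B
          (TensorProduct.map (LinearMap.mulLeft k a) (LinearMap.mulRight k b') t) =
          counit (R := k) a • (counitLeft k A B t * b') := fun t => by
        induction t with
        | zero => simp
        | add u v hu hv => simp only [map_add, add_mul, smul_add, hu, hv]
        | tmul c d => simp [hA.counit_mul, smul_smul]
      have h₁ : counitLeft k A B (σ (b ⊗ₜ[k] a')) = counit (R := k) a' • b := hσ b a'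
      rw [smashMul_tmul, key, h₁]
      simp [smul_smul, mul_comm]

end Algebra

namespace SmashBiproduct

variable [Ring A] [Algebra k A] [Coalgebra k A] [Ring B] [Algebra k B] [Coalgebra k B]
  {σ : B ⊗[k] A →ₗ[k] A ⊗[k] B} {τ : A ⊗[k] B →ₗ[k] B ⊗[k] A} (h : IsSmashBiproduct σ τ)

/-- The projection `a ⊗ b ↦ ε(b) a`. -/
noncomputable def projA : SmashBiproduct h →ₗ[k] A :=
  counitRight k A B ∘ₗ (of h).symm.toLinearMap

/-- The projection `a ⊗ b ↦ ε(a) b`. -/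
noncomputable def projB : SmashBiproduct h →ₗ[k] B :=
  counitLeft k A B ∘ₗ (of h).symm.toLinearMap

/-- The inclusion `a ↦ a ⊗ 1`. -/
noncomputable def inclA : A →ₗ[k] SmashBiproduct h :=
  (of h).toLinearMap ∘ₗ (TensorProduct.mk k A B).flip 1

/-- The inclusion `b ↦ 1 ⊗ b`. -/
noncomputable def inclB : B →ₗ[k] SmashBiproduct h :=
  (of h).toLinearMap ∘ₗ TensorProduct.mk k A B 1

theorem projA_apply (x : SmashBiproduct h) : projA h x = counitRight k A B ((of h).symm x) := rfl

theorem projB_apply (x : SmashBiproduct h) : projB h x = counitLeft k A B ((of h).symm x) := rfl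

theorem inclA_apply (a : A) : inclA h a = of h (a ⊗ₜ[k] 1) := rfl

theorem inclB_apply (b : B) : inclB h b = of h (1 ⊗ₜ[k] b) := rfl

theorem projA_mul (hB : IsCounitalAlgebra k B) (x y : SmashBiproduct h) :
    projA h (x * y) = (smashAct σ ∘ₗ (of h).symm.toLinearMap) x (projA h y) := by
  rw [mul_def, projA_apply, LinearEquiv.symm_apply_apply, counitRight_smashMul hB]
  rfl

theorem projB_mul (hA : IsCounitalAlgebra k A) (hσ : IsRightConormal σ) (x y : SmashBiproduct h) :
    projB h (x * y) = projB h x * projB h y := by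
  rw [mul_def, projB_apply, LinearEquiv.symm_apply_apply, counitLeft_smashMul hA hσ]
  rfl

theorem map_comul {V V' : Type*} [AddCommGroup V] [Module k V] [AddCommGroup V'] [Module k V']
    (f : A ⊗[k] B →ₗ[k] V) (g : A ⊗[k] B →ₗ[k] V') (x : SmashBiproduct h) :
    TensorProduct.map (f ∘ₗ (of h).symm.toLinearMap) (g ∘ₗ (of h).symm.toLinearMap)
      (comul (R := k) x) = TensorProduct.map f g (smashComul τ ((of h).symm x)) := by
  rw [comul_def, ← LinearMap.comp_apply, ← TensorProduct.map_comp, LinearMap.comp_assoc,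
    LinearMap.comp_assoc, LinearEquiv.symm_comp, LinearMap.comp_id, LinearMap.comp_id]

theorem map_projA_projB (x : SmashBiproduct h) :
    TensorProduct.map (projA h) (projB h) (comul (R := k) x) = (of h).symm x := by
  rw [projA, projB, map_comul, h.map_counitRight_counitLeft]

theorem map_projB_projA (x : SmashBiproduct h) :
    TensorProduct.map (projB h) (projA h) (comul (R := k) x) = τ ((of h).symm x) := by
  rw [projA, projB, map_comul, map_counitLeft_counitRight_smashComul]

theorem map_projA_projA (x : SmashBiproduct h) :
    TensorProduct.map (projA h) (projA h) (comul (R := k) x) = comul (projA h x) := by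
  rw [projA, map_comul, h.map_counitRight_counitRight]
  rfl

theorem map_projB_projB (x : SmashBiproduct h) :
    TensorProduct.map (projB h) (projB h) (comul (R := k) x) = comul (projB h x) := by
  rw [projB, map_comul, h.map_counitLeft_counitLeft]
  rfl

theorem inclA_mul_inclB (a : A) (b : B) : inclA h a * inclB h b = of h (a ⊗ₜ[k] b) := by
  rw [mul_def, inclA_apply, inclB_apply, LinearEquiv.symm_apply_apply,
    LinearEquiv.symm_apply_apply, h.smashMul_tmul_one_one_tmul]

theorem map_id_projB (a : A) (b : B) :
    TensorProduct.map LinearMap.id (projB h) (comul (R := k) (of h (a ⊗ₜ[k] b))) =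
      ((of h).toLinearMap ∘ₗ TensorProduct.mk k A B a).rTensor B (comul b) := by
  rw [LinearMap.rTensor_comp, LinearMap.comp_apply, ← h.map_id_counitLeft,
    ← LinearMap.comp_apply (LinearMap.rTensor B _), LinearMap.rTensor_comp_map, LinearMap.comp_id,
    comul_def, ← LinearMap.comp_apply (TensorProduct.map LinearMap.id _), ← TensorProduct.map_comp]
  rfl

variable {h} in
theorem isSplitting (hA : IsCounitalAlgebra k A) (hB : IsCounitalAlgebra k B)
    (hB' : IsUnitalCoalgebra k B) (hσ : IsRightConormal σ) :
    IsSplitting (projA h) (projB h) (inclA h) (inclB h) where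
  injective := by
    have : TensorProduct.map (projA h) (projB h) ∘ₗ comul = (of h).symm.toLinearMap :=
      LinearMap.ext (map_projA_projB h)
    rw [this]
    exact (of h).symm.injective
  mul_left := ⟨_, projA_mul h hB⟩
  mul_right := ⟨LinearMap.mul k B, projB_mul h hA hσ⟩
  comul_right := ⟨comul, map_projB_projB h⟩
  subcomodule := ⟨(TensorProduct.mk k A B).flip 1, fun a => by
    -- Since 1 is grouplike in B, the coaction on A ⊗ 1 is trivial.
    rw [inclA_apply, map_id_projB, hB'.comul_one]
    rfl⟩
  subcomodule' := ⟨comul, fun b => by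
    rw [inclB_apply, map_id_projB]
    rfl⟩
  span_eq_top := by
    refine Submodule.eq_top_iff'.2 fun x => ?_
    obtain ⟨t, rfl⟩ := (of h).surjective x
    induction t with
    | zero => simp
    | add u v hu hv =>
      rw [map_add]
      exact add_mem hu hv
    | tmul a b => exact Submodule.subset_span ⟨a, b, (inclA_mul_inclB h a b).symm⟩

end SmashBiproduct

end Smash

set_option linter.unusedSimpArgs false

set_option linter.unusedSectionVars false

/-! ### Sweedler sums -/

section Sweedler

variable {k M N P Q M' N' : Type*} [CommSemiring k] [AddCommMonoid M] [AddCommMonoid N]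
  [AddCommMonoid P] [AddCommMonoid Q] [Module k M] [Module k N] [Module k P] [Module k Q]
  [AddCommMonoid M'] [AddCommMonoid N'] [Module k M'] [Module k N']

/-- A `sweedler` sum is tied to one chosen expression of the tensor. Re-expressing the tensor
requires returning to a linear map, and this is the passage in both directions. -/
theorem map_eq_sweedler (g : M ⊗[k] N →ₗ[k] P) (t : M ⊗[k] N) :
    g t = sweedler t fun x y => g (x ⊗ₜ[k] y) := by
  conv_lhs => rw [← sweedler_tmul_self t]
  simp only [sweedler, map_sum]

theorem map_sweedler (g : P →ₗ[k] Q) (t : M ⊗[k] N) (f : M → N → P) :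
    g (sweedler t f) = sweedler t fun x y => g (f x y) := by
  simp only [sweedler, map_sum]

theorem sweedler_apply (t : M ⊗[k] N) (f : M → N → P →ₗ[k] Q) (z : P) :
    sweedler t f z = sweedler t fun x y => f x y z := by
  simp only [sweedler, LinearMap.sum_apply]

theorem sweedler_tmul (t : M ⊗[k] N) (f : M → N → P) (z : Q) :
    sweedler t f ⊗ₜ[k] z = sweedler t fun x y => f x y ⊗ₜ[k] z := by
  simp only [sweedler, TensorProduct.sum_tmul]

theorem tmul_sweedler (t : M ⊗[k] N) (f : M → N → P) (z : Q) :
    z ⊗ₜ[k] sweedler t f = sweedler t fun x y => z ⊗ₜ[k] f x y := by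
  simp only [sweedler, TensorProduct.tmul_sum]

theorem smul_sweedler (t : M ⊗[k] N) (f : M → N → P) (c : k) :
    c • sweedler t f = sweedler t fun x y => c • f x y := by
  simp only [sweedler, Finset.smul_sum]

theorem sweedler_comm (t : M ⊗[k] N) (u : M' ⊗[k] N') (f : M → N → M' → N' → P) :
    sweedler t (fun a b => sweedler u fun c d => f a b c d) =
      sweedler u fun c d => sweedler t fun a b => f a b c d := by
  simp only [sweedler]
  exact Finset.sum_comm

theorem mul_sweedler {C : Type*} [Semiring C] [Module k C] (t : M ⊗[k] N) (f : M → N → C) (c : C) :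
    c * sweedler t f = sweedler t fun x y => c * f x y := by
  simp only [sweedler, Finset.mul_sum]

theorem sweedler_mul {C : Type*} [Semiring C] [Module k C] (t : M ⊗[k] N) (f : M → N → C) (c : C) :
    sweedler t f * c = sweedler t fun x y => f x y * c := by
  simp only [sweedler, Finset.sum_mul]

theorem tensor_tmul_eq_sweedler (u : M ⊗[k] N) (z : P) :
    u ⊗ₜ[k] z = sweedler u fun a b => (a ⊗ₜ[k] b) ⊗ₜ[k] z := by
  rw [← sweedler_tmul, sweedler_tmul_self]

theorem tmul_tensor_eq_sweedler (u : M ⊗[k] N) (z : P) :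
    z ⊗ₜ[k] u = sweedler u fun a b => z ⊗ₜ[k] (a ⊗ₜ[k] b) := by
  rw [← tmul_sweedler, sweedler_tmul_self]

theorem rTensor_eq_sweedler (f : M →ₗ[k] P) (u : M ⊗[k] N) :
    f.rTensor N u = sweedler u fun a b => f a ⊗ₜ[k] b :=
  map_eq_sweedler _ u

theorem lTensor_eq_sweedler (f : N →ₗ[k] P) (u : M ⊗[k] N) :
    f.lTensor M u = sweedler u fun a b => a ⊗ₜ[k] f b :=
  map_eq_sweedler _ u

theorem map₂_tmul_eq_sweedler {C D P' Q' : Type*} [AddCommMonoid C] [AddCommMonoid D] [Module k C]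
    [Module k D] [AddCommMonoid P'] [AddCommMonoid Q'] [Module k P'] [Module k Q']
    (m : C →ₗ[k] M →ₗ[k] P') (m' : D →ₗ[k] N →ₗ[k] Q') (c : C) (d : D) (u : M ⊗[k] N) :
    TensorProduct.map₂ m m' (c ⊗ₜ[k] d) u = sweedler u fun a b => m c a ⊗ₜ[k] m' d b := by
  rw [TensorProduct.map₂_apply_tmul]
  exact map_eq_sweedler _ u

theorem map₂_eq_sweedler {C D P' Q' : Type*} [AddCommMonoid C] [AddCommMonoid D] [Module k C]
    [Module k D] [AddCommMonoid P'] [AddCommMonoid Q'] [Module k P'] [Module k Q']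
    (m : C →ₗ[k] M →ₗ[k] P') (m' : D →ₗ[k] N →ₗ[k] Q') (t : C ⊗[k] D) (u : M ⊗[k] N) :
    TensorProduct.map₂ m m' t u =
      sweedler t fun c d => sweedler u fun a b => m c a ⊗ₜ[k] m' d b := by
  rw [← LinearMap.flip_apply, map_eq_sweedler]
  simp only [LinearMap.flip_apply, map₂_tmul_eq_sweedler]

end Sweedler

/-! ### Combining two tensors along one leg -/

section Merge

variable {k : Type*} [Field k] {C D E H' E' C' : Type*}
  [AddCommGroup C] [Module k C] [AddCommGroup D] [Module k D] [AddCommGroup E] [Module k E]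
  [AddCommGroup H'] [Module k H'] [AddCommGroup E'] [Module k E'] [AddCommGroup C'] [Module k C']

/-- `(c ⊗ h) ⊗ (d ⊗ e) ↦ (c ⊗ d) ⊗ m h e`. -/
noncomputable def mergeRight (m : H' →ₗ[k] E →ₗ[k] E') :
    (C ⊗[k] H') ⊗[k] (D ⊗[k] E) →ₗ[k] (C ⊗[k] D) ⊗[k] E' :=
  (TensorProduct.lift m).lTensor (C ⊗[k] D) ∘ₗ
    (TensorProduct.tensorTensorTensorComm k C H' D E).toLinearMap

/-- `(h ⊗ e) ⊗ (c ⊗ d) ↦ m h c ⊗ (d ⊗ e)`. -/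
noncomputable def mergeLeft (m : H' →ₗ[k] C →ₗ[k] C') :
    (H' ⊗[k] E) ⊗[k] (C ⊗[k] D) →ₗ[k] C' ⊗[k] (D ⊗[k] E) :=
  TensorProduct.map (TensorProduct.lift m) (TensorProduct.comm k E D).toLinearMap ∘ₗ
    (TensorProduct.tensorTensorTensorComm k H' E C D).toLinearMap

theorem mergeRight_tmul (m : H' →ₗ[k] E →ₗ[k] E') (c : C) (h : H') (d : D) (e : E) :
    mergeRight m ((c ⊗ₜ[k] h) ⊗ₜ[k] (d ⊗ₜ[k] e)) = (c ⊗ₜ[k] d) ⊗ₜ[k] m h e := by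
  simp [mergeRight]

theorem mergeLeft_tmul (m : H' →ₗ[k] C →ₗ[k] C') (c : C) (h : H') (d : D) (e : E) :
    mergeLeft m ((h ⊗ₜ[k] e) ⊗ₜ[k] (c ⊗ₜ[k] d)) = m h c ⊗ₜ[k] (d ⊗ₜ[k] e) := by
  simp [mergeLeft]

theorem mergeRight_tmul_eq_sweedler (m : H' →ₗ[k] E →ₗ[k] E') (c : C) (h : H') (u : D ⊗[k] E) :
    mergeRight m ((c ⊗ₜ[k] h) ⊗ₜ[k] u) =
      sweedler u fun d e => (c ⊗ₜ[k] d) ⊗ₜ[k] m h e := by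
  simpa only [LinearMap.comp_apply, TensorProduct.mk_apply, mergeRight_tmul] using
    map_eq_sweedler (mergeRight m ∘ₗ TensorProduct.mk k _ (D ⊗[k] E) (c ⊗ₜ[k] h)) u

theorem mergeLeft_tmul_eq_sweedler (m : H' →ₗ[k] C →ₗ[k] C') (h : H') (e : E) (u : C ⊗[k] D) :
    mergeLeft m ((h ⊗ₜ[k] e) ⊗ₜ[k] u) =
      sweedler u fun c d => m h c ⊗ₜ[k] (d ⊗ₜ[k] e) := by
  simpa only [LinearMap.comp_apply, TensorProduct.mk_apply, mergeLeft_tmul] using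
    map_eq_sweedler (mergeLeft m ∘ₗ TensorProduct.mk k _ (C ⊗[k] D) (h ⊗ₜ[k] e)) u

theorem mergeRight_eq_sweedler (m : H' →ₗ[k] E →ₗ[k] E') (t : C ⊗[k] H') (u : D ⊗[k] E) :
    mergeRight m (t ⊗ₜ[k] u) = sweedler t fun c h => sweedler u fun d e =>
      (c ⊗ₜ[k] d) ⊗ₜ[k] m h e := by
  simpa only [LinearMap.comp_apply, LinearMap.flip_apply, TensorProduct.mk_apply,
    mergeRight_tmul_eq_sweedler] using
    map_eq_sweedler (mergeRight m ∘ₗ (TensorProduct.mk k (C ⊗[k] H') (D ⊗[k] E)).flip u) t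

theorem mergeLeft_eq_sweedler (m : H' →ₗ[k] C →ₗ[k] C') (t : H' ⊗[k] E) (u : C ⊗[k] D) :
    mergeLeft m (t ⊗ₜ[k] u) = sweedler t fun h e => sweedler u fun c d =>
      m h c ⊗ₜ[k] (d ⊗ₜ[k] e) := by
  simpa only [LinearMap.comp_apply, LinearMap.flip_apply, TensorProduct.mk_apply,
    mergeLeft_tmul_eq_sweedler] using
    map_eq_sweedler (mergeLeft m ∘ₗ (TensorProduct.mk k (H' ⊗[k] E) (C ⊗[k] D)).flip u) t

end Merge

/-! ### The twelve hexagon identities in Sweedler form -/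

section Smash

variable {k A B : Type*} [Field k]
  [Ring A] [Algebra k A] [Coalgebra k A] [Ring B] [Algebra k B] [Coalgebra k B]
  (σ : B ⊗[k] A →ₗ[k] A ⊗[k] B) (τ : A ⊗[k] B →ₗ[k] B ⊗[k] A)
  (W : B ⊗[k] B) (X : A ⊗[k] B) (Y : B ⊗[k] A) (Z : A ⊗[k] A)

/-- `∑ Z¹_τ X¹ ⊗ (Z² ⊗ 1_τ X²)`. -/
noncomputable def legsAH : A ⊗[k] (A ⊗[k] B) :=
  sweedler Z fun z₁ z₂ => sweedler X fun x₁ x₂ => sweedler (τ (z₁ ⊗ₜ[k] (1 : B))) fun e z₁' =>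
    (z₁' * x₁) ⊗ₜ[k] (z₂ ⊗ₜ[k] (e * x₂))

/-- `∑ (X¹ ⊗ W¹) ⊗ X² W²`. -/
noncomputable def legsHB : (A ⊗[k] B) ⊗[k] B :=
  sweedler X fun x₁ x₂ => sweedler W fun w₁ w₂ => (x₁ ⊗ₜ[k] w₁) ⊗ₜ[k] (x₂ * w₂)

/-- `∑ W¹ Y¹ ⊗ (Y² ⊗ W²)`. -/
noncomputable def legsBH : B ⊗[k] (A ⊗[k] B) :=
  sweedler W fun w₁ w₂ => sweedler Y fun y₁ y₂ => (w₁ * y₁) ⊗ₜ[k] (y₂ ⊗ₜ[k] w₂)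

/-- `∑ (Z¹_τ X¹ ⊗ Y¹) ⊗ Z² Y²_σ ε((1_τ X²)_σ)`. -/
noncomputable def legsHA : (A ⊗[k] B) ⊗[k] A :=
  sweedler Z fun z₁ z₂ => sweedler X fun x₁ x₂ => sweedler Y fun y₁ y₂ =>
  sweedler (τ (z₁ ⊗ₜ[k] (1 : B))) fun e z₁' => sweedler (σ ((e * x₂) ⊗ₜ[k] y₂)) fun y₂' u =>
    counit (R := k) u • ((z₁' * x₁) ⊗ₜ[k] y₁) ⊗ₜ[k] (z₂ * y₂')

theorem smashAct_eq_sweedler (a c : A) (b : B) : smashAct σ (a ⊗ₜ[k] b) c =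
    sweedler (σ (b ⊗ₜ[k] c)) fun c' b' => counit (R := k) b' • (a * c') := by
  rw [smashAct_tmul, map_eq_sweedler (counitRight k A B), mul_sweedler]
  simp only [counitRight_tmul, mul_smul_comm]

variable {σ τ W X Y Z}

/-- This and the next eleven equivalences match a projected hexagon, written with `mergeRight` or
`mergeLeft`, with one of the identities `C8`–`C19`. The content is an expansion into Sweedler sums
and a reordering of independent sums; the name gives the hexagon and its three legs. -/
theorem left_AAA_iff :
    (comul (R := k)).rTensor A Z = mergeRight (smashAct σ) (legsAH τ X Z ⊗ₜ[k] Z) ↔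
    (sweedler Z fun z₁ z₂ => sweedler (comul (R := k) z₁) fun s t =>
      s ⊗ₜ[k] (t ⊗ₜ[k] z₂)) =
    (sweedler Z fun z₁ z₂ => sweedler X fun x₁ x₂ => sweedler Z fun q₁ q₂ =>
      sweedler (τ (z₁ ⊗ₜ[k] (1 : B))) fun e z₁' =>
      sweedler (σ ((e * x₂) ⊗ₜ[k] q₂)) fun q₂' u =>
        counit (R := k) u • ((z₁' * x₁) ⊗ₜ[k] (q₁ ⊗ₜ[k] (z₂ * q₂')))) := by
  -- Left hexagons come bracketed to the left and the identities to the right.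
  rw [← (TensorProduct.assoc k A A A).injective.eq_iff, ← LinearEquiv.coe_coe]
  simp only [legsAH, rTensor_eq_sweedler _ Z,
    map_sweedler, sweedler_tmul, tmul_sweedler, smul_sweedler,
    mergeRight_tmul_eq_sweedler, mergeLeft_tmul_eq_sweedler, smashAct_eq_sweedler,
    LinearMap.mul_apply', LinearMap.rTensor_tmul, LinearMap.lTensor_tmul,
    tensor_tmul_eq_sweedler (comul _), tmul_tensor_eq_sweedler (comul _),
    tensor_tmul_eq_sweedler (τ _), tmul_tensor_eq_sweedler (τ _), TensorProduct.tmul_smul,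
    ← TensorProduct.smul_tmul', map_smul, LinearEquiv.coe_coe, TensorProduct.assoc_tmul, smul_smul]
  simp only [sweedler_comm Z (τ _)]

theorem left_AAB_iff :
    (comul (R := k)).rTensor B X = mergeRight (LinearMap.mul k B) (X ⊗ₜ[k] X) ↔
    (sweedler X fun x₁ x₂ => sweedler (comul (R := k) x₁) fun s t =>
      s ⊗ₜ[k] (t ⊗ₜ[k] x₂)) =
    (sweedler X fun x₁ x₂ => sweedler X fun p₁ p₂ =>
      x₁ ⊗ₜ[k] (p₁ ⊗ₜ[k] (x₂ * p₂))) := by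
  rw [← (TensorProduct.assoc k A A B).injective.eq_iff, ← LinearEquiv.coe_coe]
  simp only [rTensor_eq_sweedler _ X, mergeRight_eq_sweedler _ X,
    map_sweedler, sweedler_tmul, tmul_sweedler, smul_sweedler,
    mergeRight_tmul_eq_sweedler, mergeLeft_tmul_eq_sweedler, smashAct_eq_sweedler,
    LinearMap.mul_apply', LinearMap.rTensor_tmul, LinearMap.lTensor_tmul,
    tensor_tmul_eq_sweedler (comul _), tmul_tensor_eq_sweedler (comul _),
    TensorProduct.tmul_smul,
    ← TensorProduct.smul_tmul', map_smul, LinearEquiv.coe_coe, TensorProduct.assoc_tmul, smul_smul]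

theorem left_BAA_iff :
    τ.rTensor A (legsHA σ τ X Y Z) = mergeRight (smashAct σ) (legsBH W Y ⊗ₜ[k] Z) ↔
    (sweedler Z fun z₁ z₂ => sweedler X fun x₁ x₂ => sweedler Y fun y₁ y₂ =>
      sweedler (τ (z₁ ⊗ₜ[k] (1 : B))) fun e z₁' =>
      sweedler (τ ((z₁' * x₁) ⊗ₜ[k] y₁)) fun y₁' v =>
      sweedler (σ ((e * x₂) ⊗ₜ[k] y₂)) fun y₂' u =>
        counit (R := k) u • (y₁' ⊗ₜ[k] (v ⊗ₜ[k] (z₂ * y₂')))) =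
    (sweedler W fun w₁ w₂ => sweedler Y fun y₁ y₂ => sweedler Z fun z₁ z₂ =>
      sweedler (σ (w₂ ⊗ₜ[k] z₂)) fun z₂' w₂' =>
        counit (R := k) w₂' • ((w₁ * y₁) ⊗ₜ[k] (z₁ ⊗ₜ[k] (y₂ * z₂')))) := by
  rw [← (TensorProduct.assoc k B A A).injective.eq_iff, ← LinearEquiv.coe_coe]
  simp only [legsHA, legsBH,
    map_sweedler, sweedler_tmul, tmul_sweedler, smul_sweedler,
    mergeRight_tmul_eq_sweedler, mergeLeft_tmul_eq_sweedler, smashAct_eq_sweedler,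
    LinearMap.mul_apply', LinearMap.rTensor_tmul, LinearMap.lTensor_tmul,
    tensor_tmul_eq_sweedler (comul _), tmul_tensor_eq_sweedler (comul _),
    tensor_tmul_eq_sweedler (τ _), tmul_tensor_eq_sweedler (τ _), TensorProduct.tmul_smul,
    ← TensorProduct.smul_tmul', map_smul, LinearEquiv.coe_coe, TensorProduct.assoc_tmul, smul_smul]
  simp only [sweedler_comm (σ _) (τ _)]

theorem left_BAB_iff :
    τ.rTensor B (legsHB W X) = mergeRight (LinearMap.mul k B) (W ⊗ₜ[k] X) ↔
    (sweedler W fun w₁ w₂ => sweedler X fun x₁ x₂ =>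
      sweedler (τ (x₁ ⊗ₜ[k] w₁)) fun w₁' x₁' =>
        w₁' ⊗ₜ[k] (x₁' ⊗ₜ[k] (x₂ * w₂))) =
    (sweedler W fun w₁ w₂ => sweedler X fun x₁ x₂ =>
      w₁ ⊗ₜ[k] (x₁ ⊗ₜ[k] (w₂ * x₂))) := by
  rw [← (TensorProduct.assoc k B A B).injective.eq_iff, ← LinearEquiv.coe_coe]
  simp only [legsHB, mergeRight_eq_sweedler _ W,
    map_sweedler, sweedler_tmul, tmul_sweedler, smul_sweedler,
    mergeRight_tmul_eq_sweedler, mergeLeft_tmul_eq_sweedler, smashAct_eq_sweedler,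
    LinearMap.mul_apply', LinearMap.rTensor_tmul, LinearMap.lTensor_tmul,
    tensor_tmul_eq_sweedler (comul _), tmul_tensor_eq_sweedler (comul _),
    tensor_tmul_eq_sweedler (τ _), tmul_tensor_eq_sweedler (τ _), TensorProduct.tmul_smul,
    ← TensorProduct.smul_tmul', map_smul, LinearEquiv.coe_coe, TensorProduct.assoc_tmul, smul_smul]
  rw [sweedler_comm X W]

theorem left_BBA_iff :
    (comul (R := k)).rTensor A Y = mergeRight (smashAct σ) (legsBH W Y ⊗ₜ[k] Y) ↔
    (sweedler Y fun y₁ y₂ => sweedler (comul (R := k) y₁) fun s t =>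
      s ⊗ₜ[k] (t ⊗ₜ[k] y₂)) =
    (sweedler W fun w₁ w₂ => sweedler Y fun y₁ y₂ => sweedler Y fun q₁ q₂ =>
      sweedler (σ (w₂ ⊗ₜ[k] q₂)) fun q₂' w₂' =>
        counit (R := k) w₂' • ((w₁ * y₁) ⊗ₜ[k] (q₁ ⊗ₜ[k] (y₂ * q₂')))) := by
  rw [← (TensorProduct.assoc k B B A).injective.eq_iff, ← LinearEquiv.coe_coe]
  simp only [legsBH, rTensor_eq_sweedler _ Y,
    map_sweedler, sweedler_tmul, tmul_sweedler, smul_sweedler,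
    mergeRight_tmul_eq_sweedler, mergeLeft_tmul_eq_sweedler, smashAct_eq_sweedler,
    LinearMap.mul_apply', LinearMap.rTensor_tmul, LinearMap.lTensor_tmul,
    tensor_tmul_eq_sweedler (comul _), tmul_tensor_eq_sweedler (comul _),
    TensorProduct.tmul_smul,
    ← TensorProduct.smul_tmul', map_smul, LinearEquiv.coe_coe, TensorProduct.assoc_tmul, smul_smul]

theorem left_BBB_iff :
    (comul (R := k)).rTensor B W = mergeRight (LinearMap.mul k B) (W ⊗ₜ[k] W) ↔
    (sweedler W fun w₁ w₂ => sweedler (comul (R := k) w₁) fun s t =>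
      s ⊗ₜ[k] (t ⊗ₜ[k] w₂)) =
    (sweedler W fun w₁ w₂ => sweedler W fun q₁ q₂ =>
      w₁ ⊗ₜ[k] (q₁ ⊗ₜ[k] (w₂ * q₂))) := by
  rw [← (TensorProduct.assoc k B B B).injective.eq_iff, ← LinearEquiv.coe_coe]
  simp only [rTensor_eq_sweedler _ W, mergeRight_eq_sweedler _ W,
    map_sweedler, sweedler_tmul, tmul_sweedler, smul_sweedler,
    mergeRight_tmul_eq_sweedler, mergeLeft_tmul_eq_sweedler, smashAct_eq_sweedler,
    LinearMap.mul_apply', LinearMap.rTensor_tmul, LinearMap.lTensor_tmul,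
    tensor_tmul_eq_sweedler (comul _), tmul_tensor_eq_sweedler (comul _),
    TensorProduct.tmul_smul,
    ← TensorProduct.smul_tmul', map_smul, LinearEquiv.coe_coe, TensorProduct.assoc_tmul, smul_smul]

theorem right_AAA_iff :
    (comul (R := k)).lTensor A Z = mergeLeft (smashAct σ) (legsHA σ τ X Y Z ⊗ₜ[k] Z) ↔
    (sweedler Z fun z₁ z₂ => sweedler (comul (R := k) z₂) fun s t =>
      z₁ ⊗ₜ[k] (s ⊗ₜ[k] t)) =
    (sweedler Z fun z₁ z₂ => sweedler X fun x₁ x₂ => sweedler Z fun q₁ q₂ =>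
      sweedler Y fun y₁ y₂ =>
      sweedler (τ (z₁ ⊗ₜ[k] (1 : B))) fun e z₁' =>
      sweedler (σ (y₁ ⊗ₜ[k] q₁)) fun q₁' y₁' =>
      sweedler (σ ((e * x₂) ⊗ₜ[k] y₂)) fun y₂' u =>
        (counit (R := k) y₁' * counit (R := k) u) •
          ((z₁' * x₁ * q₁') ⊗ₜ[k] (q₂ ⊗ₜ[k] (z₂ * y₂')))) := by
  simp only [legsHA, lTensor_eq_sweedler _ Z,
    map_sweedler, sweedler_tmul, tmul_sweedler, smul_sweedler,
    mergeRight_tmul_eq_sweedler, mergeLeft_tmul_eq_sweedler, smashAct_eq_sweedler,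
    LinearMap.mul_apply', LinearMap.rTensor_tmul, LinearMap.lTensor_tmul,
    tensor_tmul_eq_sweedler (comul _), tmul_tensor_eq_sweedler (comul _),
    tensor_tmul_eq_sweedler (τ _), tmul_tensor_eq_sweedler (τ _), TensorProduct.tmul_smul,
    ← TensorProduct.smul_tmul', map_smul, LinearEquiv.coe_coe, TensorProduct.assoc_tmul, smul_smul]
  simp only [sweedler_comm (σ _) Z, sweedler_comm (τ _) Z, sweedler_comm Y Z,
    sweedler_comm (σ ((_ * _) ⊗ₜ[k] _)) (σ _)]
  simp only [mul_comm]

theorem right_ABA_iff :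
    τ.lTensor A (legsAH τ X Z) = mergeLeft (smashAct σ) (legsHA σ τ X Y Z ⊗ₜ[k] X) ↔
    (sweedler Z fun z₁ z₂ => sweedler X fun x₁ x₂ =>
      sweedler (τ (z₁ ⊗ₜ[k] (1 : B))) fun e z₁' =>
      sweedler (τ (z₂ ⊗ₜ[k] (e * x₂))) fun u z₂' =>
        (z₁' * x₁) ⊗ₜ[k] (u ⊗ₜ[k] z₂')) =
    (sweedler Z fun z₁ z₂ => sweedler X fun x₁ x₂ => sweedler X fun p₁ p₂ =>
      sweedler Y fun y₁ y₂ =>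
      sweedler (τ (z₁ ⊗ₜ[k] (1 : B))) fun e z₁' =>
      sweedler (σ (y₁ ⊗ₜ[k] p₁)) fun p₁' y₁' =>
      sweedler (σ ((e * x₂) ⊗ₜ[k] y₂)) fun y₂' u =>
        (counit (R := k) y₁' * counit (R := k) u) •
          ((z₁' * x₁ * p₁') ⊗ₜ[k] (p₂ ⊗ₜ[k] (z₂ * y₂')))) := by
  simp only [legsAH, legsHA,
    map_sweedler, sweedler_tmul, tmul_sweedler, smul_sweedler,
    mergeRight_tmul_eq_sweedler, mergeLeft_tmul_eq_sweedler, smashAct_eq_sweedler,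
    LinearMap.mul_apply', LinearMap.rTensor_tmul, LinearMap.lTensor_tmul,
    tensor_tmul_eq_sweedler (comul _), tmul_tensor_eq_sweedler (comul _),
    tensor_tmul_eq_sweedler (τ _), tmul_tensor_eq_sweedler (τ _), TensorProduct.tmul_smul,
    ← TensorProduct.smul_tmul', map_smul, LinearEquiv.coe_coe, TensorProduct.assoc_tmul, smul_smul]
  simp only [sweedler_comm (σ _) X, sweedler_comm (τ _) X, sweedler_comm Y X,
    sweedler_comm (σ ((_ * _) ⊗ₜ[k] _)) (σ _)]
  simp only [mul_comm]

theorem right_ABB_iff :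
    (comul (R := k)).lTensor A X = mergeLeft (smashAct σ) (legsHB W X ⊗ₜ[k] X) ↔
    (sweedler X fun x₁ x₂ => sweedler (comul (R := k) x₂) fun s t =>
      x₁ ⊗ₜ[k] (s ⊗ₜ[k] t)) =
    (sweedler X fun x₁ x₂ => sweedler X fun p₁ p₂ => sweedler W fun w₁ w₂ =>
      sweedler (σ (w₁ ⊗ₜ[k] p₁)) fun p₁' w₁' =>
        counit (R := k) w₁' • ((x₁ * p₁') ⊗ₜ[k] (p₂ ⊗ₜ[k] (x₂ * w₂)))) := by
  simp only [legsHB, lTensor_eq_sweedler _ X,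
    map_sweedler, sweedler_tmul, tmul_sweedler, smul_sweedler,
    mergeRight_tmul_eq_sweedler, mergeLeft_tmul_eq_sweedler, smashAct_eq_sweedler,
    LinearMap.mul_apply', LinearMap.rTensor_tmul, LinearMap.lTensor_tmul,
    tensor_tmul_eq_sweedler (comul _), tmul_tensor_eq_sweedler (comul _),
    TensorProduct.tmul_smul,
    ← TensorProduct.smul_tmul', map_smul, LinearEquiv.coe_coe, TensorProduct.assoc_tmul, smul_smul]
  simp only [sweedler_comm W X]

theorem right_BAA_iff :
    (comul (R := k)).lTensor B Y = mergeLeft (LinearMap.mul k B) (Y ⊗ₜ[k] Y) ↔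
    (sweedler Y fun y₁ y₂ => sweedler (comul (R := k) y₂) fun s t =>
      y₁ ⊗ₜ[k] (s ⊗ₜ[k] t)) =
    (sweedler Y fun y₁ y₂ => sweedler Y fun q₁ q₂ =>
      (y₁ * q₁) ⊗ₜ[k] (q₂ ⊗ₜ[k] y₂)) := by
  simp only [lTensor_eq_sweedler _ Y, mergeLeft_eq_sweedler _ Y,
    map_sweedler, sweedler_tmul, tmul_sweedler, smul_sweedler,
    mergeRight_tmul_eq_sweedler, mergeLeft_tmul_eq_sweedler, smashAct_eq_sweedler,
    LinearMap.mul_apply', LinearMap.rTensor_tmul, LinearMap.lTensor_tmul,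
    tensor_tmul_eq_sweedler (comul _), tmul_tensor_eq_sweedler (comul _),
    TensorProduct.tmul_smul,
    ← TensorProduct.smul_tmul', map_smul, LinearEquiv.coe_coe, TensorProduct.assoc_tmul, smul_smul]

theorem right_BBA_iff :
    τ.lTensor B (legsBH W Y) = mergeLeft (LinearMap.mul k B) (Y ⊗ₜ[k] W) ↔
    (sweedler W fun w₁ w₂ => sweedler Y fun y₁ y₂ =>
      sweedler (τ (y₂ ⊗ₜ[k] w₂)) fun w₂' y₂' =>
        (w₁ * y₁) ⊗ₜ[k] (w₂' ⊗ₜ[k] y₂')) =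
    (sweedler Y fun y₁ y₂ => sweedler W fun w₁ w₂ =>
      (y₁ * w₁) ⊗ₜ[k] (w₂ ⊗ₜ[k] y₂)) := by
  simp only [legsBH, mergeLeft_eq_sweedler _ Y,
    map_sweedler, sweedler_tmul, tmul_sweedler, smul_sweedler,
    mergeRight_tmul_eq_sweedler, mergeLeft_tmul_eq_sweedler, smashAct_eq_sweedler,
    LinearMap.mul_apply', LinearMap.rTensor_tmul, LinearMap.lTensor_tmul,
    tensor_tmul_eq_sweedler (comul _), tmul_tensor_eq_sweedler (comul _),
    tensor_tmul_eq_sweedler (τ _), tmul_tensor_eq_sweedler (τ _), TensorProduct.tmul_smul,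
    ← TensorProduct.smul_tmul', map_smul, LinearEquiv.coe_coe, TensorProduct.assoc_tmul, smul_smul]

theorem right_BBB_iff :
    (comul (R := k)).lTensor B W = mergeLeft (LinearMap.mul k B) (W ⊗ₜ[k] W) ↔
    (sweedler W fun w₁ w₂ => sweedler (comul (R := k) w₂) fun s t =>
      w₁ ⊗ₜ[k] (s ⊗ₜ[k] t)) =
    (sweedler W fun w₁ w₂ => sweedler W fun q₁ q₂ =>
      (w₁ * q₁) ⊗ₜ[k] (q₂ ⊗ₜ[k] w₂)) := by
  simp only [lTensor_eq_sweedler _ W, mergeLeft_eq_sweedler _ W,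
    map_sweedler, sweedler_tmul, tmul_sweedler, smul_sweedler,
    mergeRight_tmul_eq_sweedler, mergeLeft_tmul_eq_sweedler, smashAct_eq_sweedler,
    LinearMap.mul_apply', LinearMap.rTensor_tmul, LinearMap.lTensor_tmul,
    tensor_tmul_eq_sweedler (comul _), tmul_tensor_eq_sweedler (comul _),
    TensorProduct.tmul_smul,
    ← TensorProduct.smul_tmul', map_smul, LinearEquiv.coe_coe, TensorProduct.assoc_tmul, smul_smul]

end Smash

/-! ### The intertwining identities in Sweedler form -/

section Smash

variable {k A B : Type*} [Field k]
  [Ring A] [Algebra k A] [Coalgebra k A] [Ring B] [Algebra k B] [Coalgebra k B]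
  {σ : B ⊗[k] A →ₗ[k] A ⊗[k] B} {τ : A ⊗[k] B →ₗ[k] B ⊗[k] A}
  {W : B ⊗[k] B} {X : A ⊗[k] B} {Y : B ⊗[k] A} {Z : A ⊗[k] A}

theorem IsSmashProduct.smashAct_tmul_one (h : IsSmashProduct σ) (hB : IsCounitalAlgebra k B)
    (a c : A) : smashAct σ (a ⊗ₜ[k] (1 : B)) c = a * c := by
  simp [smashAct_tmul, h.apply_one_tmul, hB.counit_one]

theorem IsSmashProduct.smashAct_one (h : IsSmashProduct σ) (x : A ⊗[k] B) :
    smashAct σ x 1 = counitRight k A B x := by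
  induction x with
  | zero => simp
  | add u v hu hv => simp only [map_add, LinearMap.add_apply, hu, hv]
  | tmul a b => simp [smashAct_tmul, h.apply_tmul_one]

/-- The element σ(b ⊗ a) is the product (1 ⊗ b)(a ⊗ 1) in H. Applying δ, which is the identity, and
multiplicativity of Δ expresses it as ∑ (b₍₁₎ ▷ a) ⊗ b₍₂₎. So σ is determined by the action on A and
the coproduct of B. -/
theorem SmashBiproduct.apply_tmul_eq_sweedler (h : IsSmashBiproduct σ τ)
    (hA : IsCounitalAlgebra k A) (hB : IsCounitalAlgebra k B) 
    (hσ : IsRightConormal σ) (b : B) (a : A) :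
    σ (b ⊗ₜ[k] a) =
      sweedler (comul (R := k) b) fun b₁ b₂ => smashAct σ ((1 : A) ⊗ₜ[k] b₁) a ⊗ₜ[k] b₂ := by
  have e : (of h).symm (inclB h b * inclA h a) = σ (b ⊗ₜ[k] a) := by
    rw [mul_def, inclB_apply, inclA_apply, LinearEquiv.symm_apply_apply,
      LinearEquiv.symm_apply_apply, LinearEquiv.symm_apply_apply, smashMul_tmul]
    simp [LinearMap.mulLeft_one, LinearMap.mulRight_one]
  have e₂ : TensorProduct.map (of h).symm.toLinearMap (projB h) (comul (R := k) (inclB h b)) =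
      (TensorProduct.mk k A B 1).rTensor B (comul b) := by
    have := congrArg ((of h).symm.toLinearMap.rTensor B) (map_id_projB h 1 b)
    rw [← LinearMap.comp_apply, LinearMap.rTensor_comp_map, LinearMap.comp_id] at this
    rw [inclB_apply, this, ← LinearMap.comp_apply, ← LinearMap.rTensor_comp, ← LinearMap.comp_assoc,
      LinearEquiv.symm_comp, LinearMap.id_comp]
  rw [← e, ← map_projA_projB, Bialgebra.comul_mul,
    map_mul_eq_map₂ (m := smashAct σ) (m' := LinearMap.mul k B) (p' := (of h).symm.toLinearMap)
      (q' := projB h) (projA_mul h hB) (projB_mul h hA hσ), e₂, map_projA_projB, inclA_apply,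
    LinearEquiv.symm_apply_apply, rTensor_eq_sweedler, map_sweedler, sweedler_apply]
  simp

theorem smashComul_tmul_one (hB' : IsUnitalCoalgebra k B) (a : A) :
    smashComul τ (a ⊗ₜ[k] (1 : B)) = sweedler (comul (R := k) a) fun a₁ a₂ =>
      sweedler (τ (a₂ ⊗ₜ[k] (1 : B))) fun e a₂' => (a₁ ⊗ₜ[k] e) ⊗ₜ[k] (a₂' ⊗ₜ[k] 1) := by
  rw [smashComul_tmul, hB'.comul_one, tensor_tmul_eq_sweedler, map_sweedler]
  simp only [midMap_tmul, map_eq_sweedler _ (τ _), TensorProduct.map_tmul, LinearMap.flip_apply,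
    TensorProduct.mk_apply]

theorem smashComul_one_tmul (hA' : IsUnitalCoalgebra k A) (b : B) :
    smashComul τ ((1 : A) ⊗ₜ[k] b) = sweedler (comul (R := k) b) fun b₁ b₂ =>
      sweedler (τ ((1 : A) ⊗ₜ[k] b₁)) fun b₁' u => (1 ⊗ₜ[k] b₁') ⊗ₜ[k] (u ⊗ₜ[k] b₂) := by
  rw [smashComul_tmul, hA'.comul_one, tmul_tensor_eq_sweedler, map_sweedler]
  simp only [midMap_tmul, map_eq_sweedler _ (τ _), TensorProduct.map_tmul, LinearMap.flip_apply,
    TensorProduct.mk_apply]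

theorem map_counitLeft_id_smashComul_one_tmul (b : B) :
    TensorProduct.map (counitLeft k A B) LinearMap.id (smashComul τ ((1 : A) ⊗ₜ[k] b)) =
      sweedler (comul (R := k) b) fun b₁ b₂ =>
      sweedler (τ ((1 : A) ⊗ₜ[k] b₁)) fun b₁' u => b₁' ⊗ₜ[k] (u ⊗ₜ[k] b₂) := by
  rw [map_counitLeft_id_smashComul, ← LinearEquiv.coe_coe, rTensor_eq_sweedler, map_sweedler]
  simp only [LinearMap.comp_apply, TensorProduct.mk_apply, tensor_tmul_eq_sweedler (τ _),
    map_sweedler, LinearEquiv.coe_coe, TensorProduct.assoc_tmul]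

/-- On the left, the two legs of R act on a₍₁₎ and a₍₂₎; on the right, the flipped coproduct of a ⊗
1 acts on Z. Evaluating the actions gives the two sides of `C1`. -/
theorem mulComul_AA_inclA_iff (h : IsSmashProduct σ) (hB : IsCounitalAlgebra k B)
    (hB' : IsUnitalCoalgebra k B) (a : A) :
    TensorProduct.map₂ (smashAct σ) (smashAct σ) (reconstruct σ τ W X Y Z) (comul (R := k) a) =
      TensorProduct.map₂ (smashAct σ) (smashAct σ)
        (TensorProduct.comm k _ _ (smashComul τ (a ⊗ₜ[k] (1 : B)))) Z ↔
    (sweedler Z fun z₁ z₂ => sweedler X fun p₁ p₂ => sweedler X fun x₁ x₂ =>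
      sweedler W fun w₁ w₂ => sweedler Y fun y₁ y₂ =>
      sweedler (comul (R := k) a) fun a₁ a₂ =>
      sweedler (τ (z₁ ⊗ₜ[k] (1 : B))) fun e₁ z₁' =>
      sweedler (τ (z₁' ⊗ₜ[k] (1 : B))) fun e₂ z₁'' =>
      sweedler (τ (p₁ ⊗ₜ[k] (1 : B))) fun e₃ p₁' =>
      sweedler (σ (p₂ ⊗ₜ[k] y₂)) fun y₂' p₂' =>
      sweedler (σ (e₁ ⊗ₜ[k] y₂')) fun y₂'' e₁' =>
      sweedler (σ ((w₁ * y₁) ⊗ₜ[k] a₁)) fun a₁' u =>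
      sweedler (σ ((e₂ * e₃ * x₂ * w₂) ⊗ₜ[k] a₂)) fun a₂' v =>
        (counit (R := k) u * counit (R := k) (e₁' * p₂') * counit (R := k) v) •
          ((z₁'' * p₁' * x₁ * a₁') ⊗ₜ[k] (z₂ * y₂'' * a₂'))) =
    (sweedler Z fun z₁ z₂ => sweedler (comul (R := k) a) fun a₁ a₂ =>
      sweedler (τ (a₂ ⊗ₜ[k] (1 : B))) fun e a₂' =>
      sweedler (σ (e ⊗ₜ[k] z₂)) fun z₂' e' =>
        counit (R := k) e' • ((a₂' * z₁) ⊗ₜ[k] (a₁ * z₂'))) := by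
  rw [← LinearMap.flip_apply]
  simp only [reconstruct, smashComul_tmul_one hB', ← LinearEquiv.coe_coe (TensorProduct.comm k _ _),
    map_sweedler, sweedler_apply, map_smul, LinearMap.smul_apply, LinearMap.flip_apply,
    map₂_tmul_eq_sweedler, LinearEquiv.coe_coe, TensorProduct.comm_tmul, h.smashAct_tmul_one hB, smashAct_eq_sweedler,
    sweedler_tmul, TensorProduct.tmul_smul, ← TensorProduct.smul_tmul', smul_smul,
    smul_sweedler]
  simp only [tmul_sweedler, TensorProduct.tmul_smul, smul_sweedler, smul_smul,
    sweedler_comm (σ _) (comul _), sweedler_comm (τ _) (comul _), sweedler_comm (τ _) Z,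
    sweedler_comm (comul _) Z]
  simp only [mul_assoc, mul_left_comm, mul_comm]

theorem mulComul_AB_inclA_iff (h : IsSmashProduct σ) (hB : IsCounitalAlgebra k B)
    (hB' : IsUnitalCoalgebra k B) (a : A) :
    TensorProduct.map₂ (smashAct σ) (LinearMap.mul k B) (legsHB W X) (a ⊗ₜ[k] (1 : B)) =
      TensorProduct.map₂ (smashAct σ) (LinearMap.mul k B) (TensorProduct.comm k _ _
        (TensorProduct.map (counitLeft k A B) LinearMap.id (smashComul τ (a ⊗ₜ[k] (1 : B))))) X ↔
    (sweedler X fun x₁ x₂ => sweedler W fun w₁ w₂ =>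
      sweedler (σ (w₁ ⊗ₜ[k] a)) fun a' w₁' =>
        counit (R := k) w₁' • ((x₁ * a') ⊗ₜ[k] (x₂ * w₂))) =
    (sweedler X fun x₁ x₂ => sweedler (τ (a ⊗ₜ[k] (1 : B))) fun e a' =>
      (a' * x₁) ⊗ₜ[k] (e * x₂)) := by
  rw [map_counitLeft_id_smashComul, hB'.comul_one, LinearMap.rTensor_tmul, LinearMap.comp_apply,
    TensorProduct.mk_apply, ← LinearMap.flip_apply]
  simp only [legsHB, tensor_tmul_eq_sweedler (τ _),
    ← LinearEquiv.coe_coe (TensorProduct.comm k _ _),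
    ← LinearEquiv.coe_coe (TensorProduct.assoc k _ _ _), map_sweedler, sweedler_apply,
    LinearMap.flip_apply, LinearEquiv.coe_coe, TensorProduct.assoc_tmul, TensorProduct.comm_tmul,
    TensorProduct.map₂_apply_tmul, map_eq_sweedler _ X, TensorProduct.map_tmul,
    h.smashAct_tmul_one hB,
    smashAct_eq_sweedler, sweedler_tmul, ← TensorProduct.smul_tmul', LinearMap.mul_apply', mul_one,
    sweedler_comm (τ _) X]

theorem mulComul_BA_inclA_iff (h : IsSmashBiproduct σ τ) (hB : IsCounitalAlgebra k B)
    (hB' : IsUnitalCoalgebra k B) (a : A) :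
    TensorProduct.map₂ (LinearMap.mul k B) (smashAct σ) (legsBH W Y) (τ (a ⊗ₜ[k] (1 : B))) =
      TensorProduct.map₂ (LinearMap.mul k B) (smashAct σ) (TensorProduct.comm k _ _
        (TensorProduct.map LinearMap.id (counitLeft k A B) (smashComul τ (a ⊗ₜ[k] (1 : B))))) Y ↔
    (sweedler W fun w₁ w₂ => sweedler Y fun y₁ y₂ =>
      sweedler (τ (a ⊗ₜ[k] (1 : B))) fun e a' =>
      sweedler (σ (w₂ ⊗ₜ[k] a')) fun a'' w₂' =>
        counit (R := k) w₂' • ((w₁ * y₁ * e) ⊗ₜ[k] (y₂ * a''))) =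
    (sweedler Y fun y₁ y₂ => y₁ ⊗ₜ[k] (a * y₂)) := by
  rw [h.map_id_counitLeft, hB'.comul_one, LinearMap.rTensor_tmul, TensorProduct.comm_tmul,
    TensorProduct.mk_apply, map₂_tmul_eq_sweedler, ← LinearMap.flip_apply]
  simp only [legsBH, map_sweedler, sweedler_apply, LinearMap.flip_apply, map₂_tmul_eq_sweedler,
    h.smashAct_tmul_one hB, smashAct_eq_sweedler, tmul_sweedler, TensorProduct.tmul_smul,
    LinearMap.mul_apply', one_mul]

theorem mulComul_AA_inclB_iff (hA' : IsUnitalCoalgebra k A) (b : B) :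
    counit (R := k) b • Z = TensorProduct.map₂ (smashAct σ) (smashAct σ)
        (TensorProduct.comm k _ _ (smashComul τ ((1 : A) ⊗ₜ[k] b))) Z ↔
    (sweedler Z fun z₁ z₂ => counit (R := k) b • (z₁ ⊗ₜ[k] z₂)) =
    (sweedler Z fun z₁ z₂ => sweedler (comul (R := k) b) fun b₁ b₂ =>
      sweedler (τ ((1 : A) ⊗ₜ[k] b₁)) fun b₁' u =>
      sweedler (σ (b₂ ⊗ₜ[k] z₁)) fun z₁' b₂' =>
      sweedler (σ (b₁' ⊗ₜ[k] z₂)) fun z₂' b₁'' =>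
        (counit (R := k) b₁'' * counit (R := k) b₂') • ((u * z₁') ⊗ₜ[k] z₂')) := by
  rw [← smul_sweedler, sweedler_tmul_self]
  simp only [smashComul_one_tmul hA', ← LinearEquiv.coe_coe (TensorProduct.comm k _ _),
    map_sweedler, sweedler_apply,
    LinearEquiv.coe_coe, TensorProduct.comm_tmul, map₂_tmul_eq_sweedler, smashAct_eq_sweedler,
    sweedler_tmul, ← TensorProduct.smul_tmul', one_mul]
  simp only [tmul_sweedler, TensorProduct.tmul_smul, smul_sweedler, smul_smul,
    sweedler_comm (τ _) Z, sweedler_comm (comul _) Z]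
  simp only [mul_comm]

theorem mulComul_AB_inclB_iff (b : B) :
    (LinearMap.mulRight k b).lTensor A X =
      TensorProduct.map₂ (smashAct σ) (LinearMap.mul k B) (TensorProduct.comm k _ _
        (TensorProduct.map (counitLeft k A B) LinearMap.id (smashComul τ ((1 : A) ⊗ₜ[k] b)))) X ↔
    (sweedler X fun x₁ x₂ => x₁ ⊗ₜ[k] (x₂ * b)) =
    (sweedler X fun x₁ x₂ => sweedler (comul (R := k) b) fun b₁ b₂ =>
      sweedler (τ ((1 : A) ⊗ₜ[k] b₁)) fun b₁' u =>
      sweedler (σ (b₂ ⊗ₜ[k] x₁)) fun x₁' b₂' =>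
        counit (R := k) b₂' • ((u * x₁') ⊗ₜ[k] (b₁' * x₂))) := by
  rw [map_counitLeft_id_smashComul_one_tmul, lTensor_eq_sweedler]
  simp only [← LinearEquiv.coe_coe (TensorProduct.comm k _ _),
    map_sweedler, sweedler_apply,
    LinearEquiv.coe_coe, TensorProduct.comm_tmul, map₂_tmul_eq_sweedler, smashAct_eq_sweedler,
    sweedler_tmul, ← TensorProduct.smul_tmul', LinearMap.mul_apply', LinearMap.mulRight_apply,
    sweedler_comm (τ _) X, sweedler_comm (comul _) X]

theorem mulComul_BA_inclB_iff (h : IsSmashBiproduct σ τ)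
    (hA : IsCounitalAlgebra k A) (hB : IsCounitalAlgebra k B)
    (hσ : IsRightConormal σ) (b : B) :
    TensorProduct.map₂ (LinearMap.mul k B) (smashAct σ) (legsBH W Y) (τ ((1 : A) ⊗ₜ[k] b)) =
      TensorProduct.map₂ (LinearMap.mul k B) (smashAct σ) (TensorProduct.comm k _ _
        (TensorProduct.map LinearMap.id (counitLeft k A B) (smashComul τ ((1 : A) ⊗ₜ[k] b)))) Y ↔
    (sweedler W fun w₁ w₂ => sweedler Y fun y₁ y₂ =>
      sweedler (τ ((1 : A) ⊗ₜ[k] b)) fun b' u =>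
      sweedler (σ (w₂ ⊗ₜ[k] u)) fun u' w₂' =>
        counit (R := k) w₂' • ((w₁ * y₁ * b') ⊗ₜ[k] (y₂ * u'))) =
    (sweedler Y fun y₁ y₂ => sweedler (σ (b ⊗ₜ[k] y₂)) fun y₂' b' =>
      (b' * y₁) ⊗ₜ[k] y₂') := by
  -- `C6` contains σ(b ⊗ Y²), whereas the projection yields b₍₁₎ ▷ Y² together with b₍₂₎Y¹. The
  -- formula for σ through the action identifies them.
  have key (y₁ : B) (y₂ : A) : (sweedler (σ (b ⊗ₜ[k] y₂)) fun y₂' b' => (b' * y₁) ⊗ₜ[k] y₂') =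
      sweedler (comul (R := k) b) fun b₁ b₂ =>
        (b₂ * y₁) ⊗ₜ[k] smashAct σ ((1 : A) ⊗ₜ[k] b₁) y₂ := by
    have := map_eq_sweedler ((LinearMap.mulRight k y₁).rTensor A ∘ₗ
      (TensorProduct.comm k A B).toLinearMap) (σ (b ⊗ₜ[k] y₂))
    simp only [LinearMap.comp_apply, LinearEquiv.coe_coe, TensorProduct.comm_tmul,
      LinearMap.rTensor_tmul, LinearMap.mulRight_apply] at this
    rw [← this, SmashBiproduct.apply_tmul_eq_sweedler h hA hB hσ, ← LinearEquiv.coe_coe]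
    simp only [map_sweedler, LinearEquiv.coe_coe, TensorProduct.comm_tmul,
      LinearMap.rTensor_tmul, LinearMap.mulRight_apply]
  rw [h.map_id_counitLeft, ← LinearMap.flip_apply, rTensor_eq_sweedler]
  simp only [key, legsBH, ← LinearEquiv.coe_coe (TensorProduct.comm k _ _), map_sweedler,
    sweedler_apply, LinearMap.flip_apply, TensorProduct.comm_tmul, LinearEquiv.coe_coe,
    TensorProduct.mk_apply, map₂_tmul_eq_sweedler, LinearMap.mul_apply',
    sweedler_comm (comul _) Y]
  simp only [smashAct_eq_sweedler _ _ (_ : A) (_ : B), tmul_sweedler, TensorProduct.tmul_smul]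

theorem mulComul_BB_inclB_iff (b : B) :
    TensorProduct.map₂ (LinearMap.mul k B) (LinearMap.mul k B) W (comul (R := k) b) =
      TensorProduct.map₂ (LinearMap.mul k B) (LinearMap.mul k B)
        (TensorProduct.comm k _ _ (comul (R := k) b)) W ↔
    (sweedler W fun w₁ w₂ => sweedler (comul (R := k) b) fun b₁ b₂ =>
      (w₁ * b₁) ⊗ₜ[k] (w₂ * b₂)) =
    (sweedler W fun w₁ w₂ => sweedler (comul (R := k) b) fun b₁ b₂ =>
      (b₂ * w₁) ⊗ₜ[k] (b₁ * w₂)) := by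
  rw [map₂_eq_sweedler, ← LinearEquiv.coe_coe,
    map_eq_sweedler (TensorProduct.comm k B B).toLinearMap, map_sweedler, sweedler_apply]
  simp only [LinearEquiv.coe_coe, TensorProduct.comm_tmul, map₂_tmul_eq_sweedler,
    LinearMap.mul_apply', sweedler_comm (comul _) W]

end Smash

/-! ### Projected conditions as equations between projections of R -/

section Legs

variable {k : Type*} [Field k]
variable {H C D E N C' D' E' : Type*} [Ring H] [Bialgebra k H]
  [AddCommGroup C] [Module k C] [AddCommGroup D] [Module k D] [AddCommGroup E] [Module k E]
  [AddCommGroup N] [Module k N] [AddCommGroup C'] [Module k C'] [AddCommGroup D'] [Module k D']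
  [AddCommGroup E'] [Module k E']
  {s : Finset (H × H)} {R : H ⊗[k] H} {p : H →ₗ[k] C} {q : H →ₗ[k] D} {r : H →ₗ[k] E}
  {n : H →ₗ[k] N} {p' : H →ₗ[k] C'} {q' : H →ₗ[k] D'} {r' : H →ₗ[k] E'}

/-- The point is to remove the sum over `s`: once the coproduct and product factor through
projections, the hexagon involves only three partial projections of R. -/
theorem leftHexagon_iff_mergeRight (hR : R = ∑ i ∈ s, i.1 ⊗ₜ[k] i.2) {ν : N →ₗ[k] C ⊗[k] D}
    {m : E' →ₗ[k] E →ₗ[k] E} (hν : ∀ x, TensorProduct.map p q (comul (R := k) x) = ν (n x))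
    (hm : ∀ x y, r (x * y) = m (r' x) (r y)) :
    LeftHexagon s p q r ↔ ν.rTensor E (TensorProduct.map n r R) =
      mergeRight m (TensorProduct.map p r' R ⊗ₜ[k] TensorProduct.map q r R) := by
  rw [LeftHexagon, Finset.sum_comm]
  simp only [hR, map_sum, TensorProduct.map_tmul, LinearMap.rTensor_tmul,
    TensorProduct.sum_tmul, TensorProduct.tmul_sum, mergeRight_tmul, hν, hm]

theorem rightHexagon_iff_mergeLeft (hR : R = ∑ i ∈ s, i.1 ⊗ₜ[k] i.2) {ν : N →ₗ[k] D ⊗[k] E}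
    {m : C' →ₗ[k] C →ₗ[k] C} (hν : ∀ x, TensorProduct.map q r (comul (R := k) x) = ν (n x))
    (hm : ∀ x y, p (x * y) = m (p' x) (p y)) :
    RightHexagon s p q r ↔ ν.lTensor C (TensorProduct.map p n R) =
      mergeLeft m (TensorProduct.map p' r R ⊗ₜ[k] TensorProduct.map p q R) := by
  rw [RightHexagon, Finset.sum_comm]
  simp only [hR, map_sum, TensorProduct.map_tmul, LinearMap.lTensor_tmul,
    TensorProduct.sum_tmul, TensorProduct.tmul_sum, mergeLeft_tmul, hν, hm]

theorem mulComul_eq_map₂ (hR : R = ∑ i ∈ s, i.1 ⊗ₜ[k] i.2) {m : C' →ₗ[k] C →ₗ[k] C}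
    {m' : D' →ₗ[k] D →ₗ[k] D} (hm : ∀ x y, p (x * y) = m (p' x) (p y))
    (hm' : ∀ x y, q (x * y) = m' (q' x) (q y)) (x : H) :
    mulComul s p q x = TensorProduct.map₂ m m' (TensorProduct.map p' q' R)
      (TensorProduct.map p q (comul x)) := by
  rw [← map_mul_eq_map₂ hm hm', mulComul_apply, hR, Finset.sum_mul, map_sum]

theorem opComulMul_eq_map₂ (hR : R = ∑ i ∈ s, i.1 ⊗ₜ[k] i.2) {m : C' →ₗ[k] C →ₗ[k] C}
    {m' : D' →ₗ[k] D →ₗ[k] D} (hm : ∀ x y, p (x * y) = m (p' x) (p y))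
    (hm' : ∀ x y, q (x * y) = m' (q' x) (q y)) (x : H) :
    opComulMul s p q x = TensorProduct.map₂ m m'
      (TensorProduct.comm k D' C' (TensorProduct.map q' p' (comul x)))
      (TensorProduct.map p q R) := by
  rw [← TensorProduct.map_comm, ← map_mul_eq_map₂ hm hm', opComulMul_apply, hR, Finset.mul_sum,
    map_sum]

end Legs

/-! ### The nineteen identities as projected conditions -/

namespace SmashBiproduct

variable {k A B : Type*} [Field k]
  [Ring A] [Algebra k A] [Coalgebra k A] [Ring B] [Algebra k B] [Coalgebra k B]
  {σ : B ⊗[k] A →ₗ[k] A ⊗[k] B} {τ : A ⊗[k] B →ₗ[k] B ⊗[k] A}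
  {W : B ⊗[k] B} {X : A ⊗[k] B} {Y : B ⊗[k] A} {Z : A ⊗[k] A}

theorem of_symm_mul (h : IsSmashBiproduct σ τ) (x y : SmashBiproduct h) :
    (of h).symm.toLinearMap (x * y) = TensorProduct.curry (smashMul σ)
      ((of h).symm.toLinearMap x) ((of h).symm.toLinearMap y) := rfl

/-- `W`, `X`, `Y`, `Z` are the projections of `R`, and the partial projections of `R` and `R`
itself are the expressions in them. -/
structure IsFactorization (h : IsSmashBiproduct σ τ) (R : SmashBiproduct h ⊗[k] SmashBiproduct h)
    (W : B ⊗[k] B) (X : A ⊗[k] B) (Y : B ⊗[k] A) (Z : A ⊗[k] A) : Prop where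
  BB : TensorProduct.map (projB h) (projB h) R = W
  AB : TensorProduct.map (projA h) (projB h) R = X
  BA : TensorProduct.map (projB h) (projA h) R = Y
  AA : TensorProduct.map (projA h) (projA h) R = Z
  HB : TensorProduct.map (of h).symm.toLinearMap (projB h) R = legsHB W X
  BH : TensorProduct.map (projB h) (of h).symm.toLinearMap R = legsBH W Y
  AH : TensorProduct.map (projA h) (of h).symm.toLinearMap R = legsAH τ X Z
  HA : TensorProduct.map (of h).symm.toLinearMap (projA h) R = legsHA σ τ X Y Z
  HH : TensorProduct.map (of h).symm.toLinearMap (of h).symm.toLinearMap R =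
    reconstruct σ τ W X Y Z

variable {h : IsSmashBiproduct σ τ} {s : Finset (SmashBiproduct h × SmashBiproduct h)}
  {R : SmashBiproduct h ⊗[k] SmashBiproduct h}

theorem projA_inclA (hB : IsCounitalAlgebra k B) (a : A) : projA h (inclA h a) = a := by
  simp [projA_apply, inclA_apply, hB.counit_one]

theorem projB_inclA (a : A) : projB h (inclA h a) = counit (R := k) a • 1 := by
  simp [projB_apply, inclA_apply]

theorem projA_inclB (b : B) : projA h (inclB h b) = counit (R := k) b • 1 := by
  simp [projA_apply, inclB_apply]

theorem projB_inclB (hA : IsCounitalAlgebra k A) (b : B) : projB h (inclB h b) = b := by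
  simp [projB_apply, inclB_apply, hA.counit_one]

theorem map_of_symm_of_symm (x : SmashBiproduct h) :
    TensorProduct.map (of h).symm.toLinearMap (of h).symm.toLinearMap (comul (R := k) x) =
      smashComul τ ((of h).symm x) := by
  have := map_comul h LinearMap.id LinearMap.id x
  rwa [LinearMap.id_comp, TensorProduct.map_id, LinearMap.id_apply] at this

theorem map_of_symm_projB (x : SmashBiproduct h) :
    TensorProduct.map (of h).symm.toLinearMap (projB h) (comul (R := k) x) =
      TensorProduct.map LinearMap.id (counitLeft k A B) (smashComul τ ((of h).symm x)) :=
  map_comul h LinearMap.id (counitLeft k A B) x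

theorem map_projB_of_symm (x : SmashBiproduct h) :
    TensorProduct.map (projB h) (of h).symm.toLinearMap (comul (R := k) x) =
      TensorProduct.map (counitLeft k A B) LinearMap.id (smashComul τ ((of h).symm x)) :=
  map_comul h (counitLeft k A B) LinearMap.id x

/-- Acting on 1 is projecting to A. Thus on 1 ⊗ b the action of R on the A-legs collapses to a
projection, which gives the short left-hand side of `C4`, and of `C5` through the next lemma. -/
theorem map₂_smashAct_one_one (h : IsSmashProduct σ) (t : (A ⊗[k] B) ⊗[k] (A ⊗[k] B)) :
    TensorProduct.map₂ (smashAct σ) (smashAct σ) t ((1 : A) ⊗ₜ[k] (1 : A)) =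
      TensorProduct.map (counitRight k A B) (counitRight k A B) t := by
  induction t with
  | zero => simp
  | add u v hu hv => simp only [map_add, LinearMap.add_apply, hu, hv]
  | tmul x y => simp [h.smashAct_one]

theorem map₂_smashAct_mul_one_tmul (h : IsSmashProduct σ) (t : (A ⊗[k] B) ⊗[k] B) (b : B) :
    TensorProduct.map₂ (smashAct σ) (LinearMap.mul k B) t ((1 : A) ⊗ₜ[k] b) =
      (LinearMap.mulRight k b).lTensor A ((counitRight k A B).rTensor B t) := by
  induction t with
  | zero => simp
  | add u v hu hv => simp only [map_add, LinearMap.add_apply, hu, hv]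
  | tmul x y => simp [h.smashAct_one]

theorem projA_mul_eq_smashAct (hB : IsCounitalAlgebra k B) (x y : SmashBiproduct h) :
    projA h (x * y) = smashAct σ ((of h).symm.toLinearMap x) (projA h y) :=
  projA_mul h hB x y

theorem projB_mul_eq_mul (hA : IsCounitalAlgebra k A) (hσ : IsRightConormal σ)
    (x y : SmashBiproduct h) :
    projB h (x * y) = LinearMap.mul k B (projB h x) (projB h y) :=
  projB_mul h hA hσ x y

theorem mulComul_AA_iff (hR : R = ∑ i ∈ s, i.1 ⊗ₜ[k] i.2) (hB : IsCounitalAlgebra k B)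
    (x : SmashBiproduct h) :
    mulComul s (projA h) (projA h) x = opComulMul s (projA h) (projA h) x ↔
    TensorProduct.map₂ (smashAct σ) (smashAct σ)
        (TensorProduct.map (of h).symm.toLinearMap (of h).symm.toLinearMap R)
        (comul (R := k) (projA h x)) =
      TensorProduct.map₂ (smashAct σ) (smashAct σ)
        (TensorProduct.comm k _ _ (smashComul τ ((of h).symm x)))
        (TensorProduct.map (projA h) (projA h) R) := by
  rw [mulComul_eq_map₂ hR (projA_mul_eq_smashAct hB) (projA_mul_eq_smashAct hB),
    opComulMul_eq_map₂ hR (projA_mul_eq_smashAct hB) (projA_mul_eq_smashAct hB), map_projA_projA,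
    map_of_symm_of_symm]

theorem mulComul_AB_iff (hR : R = ∑ i ∈ s, i.1 ⊗ₜ[k] i.2) (hA : IsCounitalAlgebra k A)
    (hB : IsCounitalAlgebra k B) (hσ : IsRightConormal σ) (x : SmashBiproduct h) :
    mulComul s (projA h) (projB h) x = opComulMul s (projA h) (projB h) x ↔
    TensorProduct.map₂ (smashAct σ) (LinearMap.mul k B)
        (TensorProduct.map (of h).symm.toLinearMap (projB h) R) ((of h).symm x) =
      TensorProduct.map₂ (smashAct σ) (LinearMap.mul k B)
        (TensorProduct.comm k _ _
          (TensorProduct.map (counitLeft k A B) LinearMap.id (smashComul τ ((of h).symm x))))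
        (TensorProduct.map (projA h) (projB h) R) := by
  rw [mulComul_eq_map₂ hR (projA_mul_eq_smashAct hB) (projB_mul_eq_mul hA hσ),
    opComulMul_eq_map₂ hR (projA_mul_eq_smashAct hB) (projB_mul_eq_mul hA hσ), map_projA_projB,
    map_projB_of_symm]

theorem mulComul_BA_iff (hR : R = ∑ i ∈ s, i.1 ⊗ₜ[k] i.2) (hA : IsCounitalAlgebra k A)
    (hB : IsCounitalAlgebra k B) (hσ : IsRightConormal σ) (x : SmashBiproduct h) :
    mulComul s (projB h) (projA h) x = opComulMul s (projB h) (projA h) x ↔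
    TensorProduct.map₂ (LinearMap.mul k B) (smashAct σ)
        (TensorProduct.map (projB h) (of h).symm.toLinearMap R) (τ ((of h).symm x)) =
      TensorProduct.map₂ (LinearMap.mul k B) (smashAct σ)
        (TensorProduct.comm k _ _
          (TensorProduct.map LinearMap.id (counitLeft k A B) (smashComul τ ((of h).symm x))))
        (TensorProduct.map (projB h) (projA h) R) := by
  rw [mulComul_eq_map₂ hR (projB_mul_eq_mul hA hσ) (projA_mul_eq_smashAct hB),
    opComulMul_eq_map₂ hR (projB_mul_eq_mul hA hσ) (projA_mul_eq_smashAct hB), map_projB_projA,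
    map_of_symm_projB]

theorem mulComul_BB_iff (hR : R = ∑ i ∈ s, i.1 ⊗ₜ[k] i.2) (hA : IsCounitalAlgebra k A)
    (hσ : IsRightConormal σ) (x : SmashBiproduct h) :
    mulComul s (projB h) (projB h) x = opComulMul s (projB h) (projB h) x ↔
    TensorProduct.map₂ (LinearMap.mul k B) (LinearMap.mul k B)
        (TensorProduct.map (projB h) (projB h) R) (comul (R := k) (projB h x)) =
      TensorProduct.map₂ (LinearMap.mul k B) (LinearMap.mul k B)
        (TensorProduct.comm k _ _ (comul (R := k) (projB h x)))
        (TensorProduct.map (projB h) (projB h) R) := by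
  rw [mulComul_eq_map₂ hR (projB_mul_eq_mul hA hσ) (projB_mul_eq_mul hA hσ),
    opComulMul_eq_map₂ hR (projB_mul_eq_mul hA hσ) (projB_mul_eq_mul hA hσ), map_projB_projB]

/-- πB sends a ⊗ 1 to a multiple of 1, which is grouplike, so both sides equal ε(a)W. Hence there
are seven intertwining identities and not eight. -/
theorem mulComul_BB_inclA (hR : R = ∑ i ∈ s, i.1 ⊗ₜ[k] i.2) (hA : IsCounitalAlgebra k A)
    (hB' : IsUnitalCoalgebra k B) (hσ : IsRightConormal σ) (a : A) :
    mulComul s (projB h) (projB h) (inclA h a) = opComulMul s (projB h) (projB h) (inclA h a) := by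
  rw [mulComul_BB_iff hR hA hσ, projB_inclA, map_smul, hB'.comul_one, map_smul, map_smul, map_smul,
    LinearMap.smul_apply, TensorProduct.comm_tmul]
  congr 1
  generalize TensorProduct.map (projB h) (projB h) R = t
  induction t with
  | zero => simp
  | add u v hu hv => simp only [map_add, LinearMap.add_apply, hu, hv]
  | tmul x y => simp

/-- The nineteen identities are the projections of the quasitriangularity conditions. -/
theorem factorIdentities_iff (hR : R = ∑ i ∈ s, i.1 ⊗ₜ[k] i.2) (hA : IsCounitalAlgebra k A)
    (hA' : IsUnitalCoalgebra k A) (hB : IsCounitalAlgebra k B) (hB' : IsUnitalCoalgebra k B)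
    (hσ : IsRightConormal σ) (hF : IsFactorization h R W X Y Z) :
    FactorIdentities σ τ W X Y Z ↔
      (LeftHexagon s (projA h) (projA h) (projA h) ∧ LeftHexagon s (projA h) (projA h) (projB h) ∧
      LeftHexagon s (projB h) (projA h) (projA h) ∧ LeftHexagon s (projB h) (projA h) (projB h) ∧
      LeftHexagon s (projB h) (projB h) (projA h) ∧ LeftHexagon s (projB h) (projB h) (projB h) ∧
      RightHexagon s (projA h) (projA h) (projA h) ∧
      RightHexagon s (projA h) (projB h) (projA h) ∧
      RightHexagon s (projA h) (projB h) (projB h) ∧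
      RightHexagon s (projB h) (projA h) (projA h) ∧
      RightHexagon s (projB h) (projB h) (projA h) ∧
      RightHexagon s (projB h) (projB h) (projB h)) ∧
      ProjectedIntertwining s (projA h) (projB h) (inclA h) ∧
      ProjectedIntertwining s (projA h) (projB h) (inclB h) := by
  have mA := projA_mul_eq_smashAct (h := h) hB
  have mB := projB_mul_eq_mul (h := h) hA hσ
  have e8 := leftHexagon_iff_mergeRight hR (map_projA_projA h) mA
  have e9 := leftHexagon_iff_mergeRight hR (map_projA_projA h) mB
  have e10 := leftHexagon_iff_mergeRight (n := (of h).symm.toLinearMap) hR (map_projB_projA h) mA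
  have e11 := leftHexagon_iff_mergeRight (n := (of h).symm.toLinearMap) hR (map_projB_projA h) mB
  have e12 := leftHexagon_iff_mergeRight hR (map_projB_projB h) mA
  have e13 := leftHexagon_iff_mergeRight hR (map_projB_projB h) mB
  have e14 := rightHexagon_iff_mergeLeft hR (map_projA_projA h) mA
  have e15 := rightHexagon_iff_mergeLeft (n := (of h).symm.toLinearMap) hR (map_projB_projA h) mA
  have e16 := rightHexagon_iff_mergeLeft hR (map_projB_projB h) mA
  have e17 := rightHexagon_iff_mergeLeft hR (map_projA_projA h) mB
  have e18 := rightHexagon_iff_mergeLeft (n := (of h).symm.toLinearMap) hR (map_projB_projA h) mB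
  have e19 := rightHexagon_iff_mergeLeft hR (map_projB_projB h) mB
  rw [hF.AA, hF.AH, left_AAA_iff] at e8
  rw [hF.AB, left_AAB_iff] at e9
  rw [hF.HA, hF.BH, hF.AA, left_BAA_iff] at e10
  rw [hF.HB, hF.BB, hF.AB, left_BAB_iff] at e11
  rw [hF.BH, hF.BA, left_BBA_iff] at e12
  rw [hF.BB, left_BBB_iff] at e13
  rw [hF.HA, hF.AA, right_AAA_iff] at e14
  rw [hF.AH, hF.HA, hF.AB, right_ABA_iff] at e15
  rw [hF.HB, hF.AB, right_ABB_iff] at e16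
  rw [hF.BA, right_BAA_iff] at e17
  rw [hF.BH, hF.BA, hF.BB, right_BBA_iff] at e18
  rw [hF.BB, right_BBB_iff] at e19
  have e1 (a : A) := mulComul_AA_iff hR hB (inclA h a)
  have e2 (a : A) := mulComul_AB_iff hR hA hB hσ (inclA h a)
  have e3 (a : A) := mulComul_BA_iff hR hA hB hσ (inclA h a)
  have e4 (b : B) := mulComul_AA_iff hR hB (inclB h b)
  have e5 (b : B) := mulComul_AB_iff hR hA hB hσ (inclB h b)
  have e6 (b : B) := mulComul_BA_iff hR hA hB hσ (inclB h b)
  have e7 (b : B) := mulComul_BB_iff hR hA hσ (inclB h b)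
  simp only [projA_inclA hB] at e1
  simp only [projA_inclB, map_smul, hA'.comul_one] at e4
  simp only [hF.HH, hF.AA, inclA_apply, LinearEquiv.symm_apply_apply,
    mulComul_AA_inclA_iff h.toIsSmashProduct hB hB'] at e1
  simp only [hF.HB, hF.AB, inclA_apply, LinearEquiv.symm_apply_apply,
    mulComul_AB_inclA_iff h.toIsSmashProduct hB hB'] at e2
  simp only [hF.BH, hF.BA, inclA_apply, LinearEquiv.symm_apply_apply,
    mulComul_BA_inclA_iff h hB hB'] at e3
  -- The collapsed actions leave projections of projections of R, which have to be recognised as Z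
  -- and X.
  have hAA : TensorProduct.map (counitRight k A B) (counitRight k A B) (TensorProduct.map
      (of h).symm.toLinearMap (of h).symm.toLinearMap R) = Z := by
    rw [← LinearMap.comp_apply, ← TensorProduct.map_comp]
    exact hF.AA
  have hAB : (counitRight k A B).rTensor B (TensorProduct.map
      (of h).symm.toLinearMap (projB h) R) = X := by
    rw [← LinearMap.comp_apply, LinearMap.rTensor_comp_map]
    exact hF.AB
  simp only [hAA, hF.AA,
    map₂_smashAct_one_one h.toIsSmashProduct, inclB_apply, LinearEquiv.symm_apply_apply,
    mulComul_AA_inclB_iff hA'] at e4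
  simp only [hF.AB, inclB_apply, LinearEquiv.symm_apply_apply,
    map₂_smashAct_mul_one_tmul h.toIsSmashProduct, hAB, mulComul_AB_inclB_iff] at e5
  simp only [hF.BH, hF.BA, inclB_apply, LinearEquiv.symm_apply_apply,
    mulComul_BA_inclB_iff h hA hB hσ] at e6
  simp only [hF.BB, projB_inclB hA, mulComul_BB_inclB_iff] at e7
  constructor
  · intro H
    exact ⟨⟨e8.2 H.C8, e9.2 H.C9, e10.2 H.C10, e11.2 H.C11, e12.2 H.C12, e13.2 H.C13, e14.2 H.C14,
        e15.2 H.C15, e16.2 H.C16, e17.2 H.C17, e18.2 H.C18, e19.2 H.C19⟩,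
      ⟨LinearMap.ext fun a => (e1 a).2 (H.C1 a), LinearMap.ext fun a => (e2 a).2 (H.C2 a),
        LinearMap.ext fun a => (e3 a).2 (H.C3 a),
        LinearMap.ext (mulComul_BB_inclA hR hA hB' hσ)⟩,
      ⟨LinearMap.ext fun b => (e4 b).2 (H.C4 b), LinearMap.ext fun b => (e5 b).2 (H.C5 b),
        LinearMap.ext fun b => (e6 b).2 (H.C6 b), LinearMap.ext fun b => (e7 b).2 (H.C7 b)⟩⟩
  · rintro ⟨⟨h8, h9, h10, h11, h12, h13, h14, h15, h16, h17, h18, h19⟩, hI, hJ⟩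
    exact
      { C1 := fun a => (e1 a).1 (LinearMap.congr_fun hI.AA a)
        C2 := fun a => (e2 a).1 (LinearMap.congr_fun hI.AB a)
        C3 := fun a => (e3 a).1 (LinearMap.congr_fun hI.BA a)
        C4 := fun b => (e4 b).1 (LinearMap.congr_fun hJ.AA b)
        C5 := fun b => (e5 b).1 (LinearMap.congr_fun hJ.AB b)
        C6 := fun b => (e6 b).1 (LinearMap.congr_fun hJ.BA b)
        C7 := fun b => (e7 b).1 (LinearMap.congr_fun hJ.BB b)
        C8 := e8.1 h8
        C9 := e9.1 h9
        C10 := e10.1 h10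
        C11 := e11.1 h11
        C12 := e12.1 h12
        C13 := e13.1 h13
        C14 := e14.1 h14
        C15 := e15.1 h15
        C16 := e16.1 h16
        C17 := e17.1 h17
        C18 := e18.1 h18
        C19 := e19.1 h19 }

end SmashBiproduct

/-! ### α as a product of its two half-projections -/

section Smash

variable {k A B : Type*} [Field k]
  [Ring A] [Algebra k A] [Coalgebra k A] [Ring B] [Algebra k B] [Coalgebra k B]
  {σ : B ⊗[k] A →ₗ[k] A ⊗[k] B} {τ : A ⊗[k] B →ₗ[k] B ⊗[k] A}
  {W : B ⊗[k] B} {X : A ⊗[k] B} {Y : B ⊗[k] A} {Z : A ⊗[k] A}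

/-- If the action of `W` on `A` is compatible with `τ`, it can be replaced by `τ`. -/
theorem mergeLeft_legsHB {N : Type*} [AddCommGroup N] [Module k N]
    (hC : ∀ a : A, (sweedler X fun x₁ x₂ => sweedler W fun w₁ w₂ =>
        sweedler (σ (w₁ ⊗ₜ[k] a)) fun a' w₁' =>
          counit (R := k) w₁' • ((x₁ * a') ⊗ₜ[k] (x₂ * w₂))) =
      (sweedler X fun x₁ x₂ => sweedler (τ (a ⊗ₜ[k] (1 : B))) fun e a' =>
        (a' * x₁) ⊗ₜ[k] (e * x₂)))
    (t : A ⊗[k] N) :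
    mergeLeft (smashAct σ) (legsHB W X ⊗ₜ[k] t) =
      sweedler t fun c d => sweedler X fun x₁ x₂ => sweedler (τ (c ⊗ₜ[k] (1 : B))) fun e c' =>
        (c' * x₁) ⊗ₜ[k] (d ⊗ₜ[k] (e * x₂)) := by
  have key (c : A) (d : N) := congrArg ((TensorProduct.mk k N B d).lTensor A) (hC c)
  simp only [map_sweedler, map_smul, LinearMap.lTensor_tmul, TensorProduct.mk_apply] at key
  simp only [legsHB, sweedler_tmul, map_sweedler, mergeLeft_tmul_eq_sweedler,
    smashAct_eq_sweedler, ← TensorProduct.smul_tmul', sweedler_comm W t, sweedler_comm X t, key]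

namespace SmashBiproduct

/-- Associativity of H, projected to A. -/
theorem smashAct_smashMul (h : IsSmashBiproduct σ τ) (hB : IsCounitalAlgebra k B)
    (x y : A ⊗[k] B) (c : A) :
    smashAct σ (smashMul σ (x ⊗ₜ[k] y)) c = smashAct σ x (smashAct σ y c) := by
  have e (x y : SmashBiproduct h) := projA_mul h hB x y
  have := e (of h x * of h y) (inclA h c)
  rw [mul_assoc, e, e, projA_inclA hB] at this
  exact this.symm

theorem smashAct_one_tmul_mul (h : IsSmashBiproduct σ τ) (hB : IsCounitalAlgebra k B)
    (b b' : B) (c : A) :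
    smashAct σ ((1 : A) ⊗ₜ[k] (b * b')) c =
      smashAct σ ((1 : A) ⊗ₜ[k] b) (smashAct σ ((1 : A) ⊗ₜ[k] b') c) := by
  rw [← smashAct_smashMul h hB, smashMul_tmul, h.apply_tmul_one]
  simp

/-- πB is a map of algebras and coalgebras, and 1 ⊗ b projects to b. So under right conormality the
coproduct of B is multiplicative, although this is not assumed. -/
theorem comul_mul_right (h : IsSmashBiproduct σ τ) (hA : IsCounitalAlgebra k A)
    (hσ : IsRightConormal σ) (b b' : B) :
    comul (R := k) (b * b') = sweedler (comul (R := k) b) fun b₁ b₂ =>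
      sweedler (comul (R := k) b') fun c₁ c₂ => (b₁ * c₁) ⊗ₜ[k] (b₂ * c₂) := by
  have := map_projB_projB h (inclB h b * inclB h b')
  rw [projB_mul h hA hσ, projB_inclB hA, projB_inclB hA, Bialgebra.comul_mul,
    map_mul_eq_map₂ (projB_mul_eq_mul hA hσ) (projB_mul_eq_mul hA hσ), map_projB_projB,
    map_projB_projB, projB_inclB hA, projB_inclB hA, map₂_eq_sweedler] at this
  exact this.symm

theorem smashMul_tmul_mul (h : IsSmashBiproduct σ τ) (hA : IsCounitalAlgebra k A)
    (hB : IsCounitalAlgebra k B) (hσ : IsRightConormal σ) (a c : A) (b b' d : B) :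
    smashMul σ ((a ⊗ₜ[k] (b * b')) ⊗ₜ[k] (c ⊗ₜ[k] d)) =
      sweedler (comul (R := k) b') fun c₁ c₂ => sweedler (comul (R := k) b) fun b₁ b₂ =>
        (a * smashAct σ ((1 : A) ⊗ₜ[k] b₁) (smashAct σ ((1 : A) ⊗ₜ[k] c₁) c)) ⊗ₜ[k]
          (b₂ * c₂ * d) := by
  rw [smashMul_tmul, apply_tmul_eq_sweedler h hA hB hσ, map_sweedler]
  simp only [TensorProduct.map_tmul]
  have := map_eq_sweedler (TensorProduct.map (LinearMap.mulLeft k a ∘ₗ (smashAct σ).flip c ∘ₗ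
    TensorProduct.mk k A B 1) (LinearMap.mulRight k d)) (comul (R := k) (b * b'))
  simp only [TensorProduct.map_tmul, LinearMap.comp_apply, LinearMap.flip_apply,
    TensorProduct.mk_apply] at this
  rw [← this, comul_mul_right h hA hσ, sweedler_comm]
  simp only [map_sweedler, TensorProduct.map_tmul, LinearMap.comp_apply, LinearMap.flip_apply,
    TensorProduct.mk_apply, smashAct_one_tmul_mul h hB, LinearMap.mulLeft_apply,
    LinearMap.mulRight_apply]

theorem mul_smashAct_smashAct (hB : IsCounitalAlgebra k B) (a c : A) (b b' : B) :
    a * smashAct σ ((1 : A) ⊗ₜ[k] b) (smashAct σ ((1 : A) ⊗ₜ[k] b') c) =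
      sweedler (σ (b' ⊗ₜ[k] c)) fun c' u => sweedler (σ (b ⊗ₜ[k] c')) fun c'' v =>
        counit (R := k) (v * u) • (a * c'') := by
  rw [smashAct_eq_sweedler σ 1 c b', map_sweedler, mul_sweedler]
  simp only [map_smul, smashAct_eq_sweedler, one_mul, mul_smul_comm, mul_sweedler, smul_sweedler,
    smul_smul, hB.counit_mul]
  simp only [mul_comm]

/-- Coassociativity in H projected by πB, πB, πA: grouping the factors in the two possible ways
gives Δ after τ on one side and τ twice on the other. -/
theorem assoc_rTensor_comul_apply_tmul_one (h : IsSmashBiproduct σ τ)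
    (hB' : IsUnitalCoalgebra k B) (a : A) :
    (sweedler (τ (a ⊗ₜ[k] (1 : B))) fun e a' => sweedler (comul (R := k) e) fun e₁ e₂ =>
      e₁ ⊗ₜ[k] (e₂ ⊗ₜ[k] a')) =
    sweedler (τ (a ⊗ₜ[k] (1 : B))) fun e₁ a' => sweedler (τ (a' ⊗ₜ[k] (1 : B))) fun e₂ a'' =>
      e₁ ⊗ₜ[k] (e₂ ⊗ₜ[k] a'') := by
  have e₁ : TensorProduct.map (projB h) (projB h) ∘ₗ comul = comul ∘ₗ projB h :=
    LinearMap.ext (map_projB_projB h)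
  have e₂ : TensorProduct.map (projB h) (projA h) ∘ₗ comul = τ ∘ₗ (of h).symm.toLinearMap :=
    LinearMap.ext (map_projB_projA h)
  have := assoc_map_comul (projB h) (projB h) (projA h) (inclA h a)
  rw [e₁, e₂, ← LinearMap.rTensor_comp_map, ← LinearMap.lTensor_comp_map, LinearMap.comp_apply,
    LinearMap.comp_apply, map_projB_projA, map_projB_of_symm, inclA_apply,
    LinearEquiv.symm_apply_apply, map_counitLeft_id_smashComul, hB'.comul_one,
    LinearMap.rTensor_tmul, LinearMap.comp_apply, TensorProduct.mk_apply] at this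
  simp only [← LinearEquiv.coe_coe, rTensor_eq_sweedler _ (τ _), tensor_tmul_eq_sweedler (τ _),
    tensor_tmul_eq_sweedler (comul _), map_sweedler] at this
  simp only [LinearEquiv.coe_coe, TensorProduct.assoc_tmul, LinearMap.lTensor_tmul,
    tmul_tensor_eq_sweedler (τ _)] at this
  exact this

/-- The product (Z² ⊗ eX²)(Y² ⊗ W²) in the last leg requires σ on eX² ⊗ Y², hence the coproducts of
e = 1_τ and of X². The first is a second application of τ. The second is given by `hC'` which, with
`hC`, brings in another copy of X and a further application of τ. This explains the three components
e₁, e₂, e₃ and the two copies of X in α. -/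
theorem reconstruct_eq_mergeRight (h : IsSmashBiproduct σ τ)
    (hA : IsCounitalAlgebra k A) (hB : IsCounitalAlgebra k B)
    (hB' : IsUnitalCoalgebra k B) (hσ : IsRightConormal σ)
    (hC : ∀ a : A, (sweedler X fun x₁ x₂ => sweedler W fun w₁ w₂ =>
        sweedler (σ (w₁ ⊗ₜ[k] a)) fun a' w₁' =>
          counit (R := k) w₁' • ((x₁ * a') ⊗ₜ[k] (x₂ * w₂))) =
      (sweedler X fun x₁ x₂ => sweedler (τ (a ⊗ₜ[k] (1 : B))) fun e a' =>
        (a' * x₁) ⊗ₜ[k] (e * x₂)))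
    (hC' : (comul (R := k)).lTensor A X = mergeLeft (smashAct σ) (legsHB W X ⊗ₜ[k] X)) :
    reconstruct σ τ W X Y Z =
      mergeRight (TensorProduct.curry (smashMul σ)) (legsAH τ X Z ⊗ₜ[k] legsBH W Y) := by
  -- The rule for Δ(e), transported by the linear map that places e₍₁₎, e₍₂₎ and a' in the expanded
  -- product.
  have hτ (a x₁ z₂ y₂ : A) (b c₁ c₂ w₂ : B) := congrArg ((TensorProduct.comm k _ _).toLinearMap ∘ₗ
    (TensorProduct.assoc k _ _ _).symm.toLinearMap ∘ₗ TensorProduct.map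
      (LinearMap.mulLeft k z₂ ∘ₗ (smashAct σ).flip (smashAct σ ((1 : A) ⊗ₜ[k] c₁) y₂) ∘ₗ
        TensorProduct.mk k A B 1)
      (TensorProduct.map (LinearMap.mulRight k (c₂ * w₂)) ((TensorProduct.mk k A B).flip b ∘ₗ
        LinearMap.mulRight k x₁)))
    (assoc_rTensor_comul_apply_tmul_one h hB' a)
  simp only [map_sweedler, LinearMap.comp_apply, TensorProduct.map_tmul, LinearMap.flip_apply,
    TensorProduct.mk_apply, LinearMap.mulLeft_apply, LinearMap.mulRight_apply, LinearEquiv.coe_coe,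
    TensorProduct.assoc_symm_tmul, TensorProduct.comm_tmul] at hτ
  rw [mergeLeft_legsHB hC, lTensor_eq_sweedler] at hC'
  simp only [tmul_tensor_eq_sweedler (comul _)] at hC'
  -- The same for X¹ ⊗ Δ(X²), where the action of W has already been replaced by τ.
  have hX (z₁ z₂ y₂ : A) (b e₁ e₂ w₂ : B) := congrArg (TensorProduct.map
      ((TensorProduct.mk k A B).flip b ∘ₗ LinearMap.mulLeft k z₁)
      (TensorProduct.map (LinearMap.mulLeft k z₂ ∘ₗ smashAct σ ((1 : A) ⊗ₜ[k] e₁) ∘ₗ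
        (smashAct σ).flip y₂ ∘ₗ TensorProduct.mk k A B 1)
      (LinearMap.mulLeft k e₂ ∘ₗ LinearMap.mulRight k w₂))) hC'
  simp only [map_sweedler, LinearMap.comp_apply, TensorProduct.map_tmul, LinearMap.flip_apply,
    TensorProduct.mk_apply, LinearMap.mulLeft_apply, LinearMap.mulRight_apply] at hX
  simp only [legsAH, legsBH, sweedler_tmul, tmul_sweedler, map_sweedler, mergeRight_tmul,
    TensorProduct.curry_apply, smashMul_tmul_mul h hA hB hσ, mul_assoc]
  simp only [sweedler_comm (τ _) (comul _), hτ]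
  simp only [sweedler_comm (comul _) (τ _), sweedler_comm X (τ _), hX]
  -- What remains are nested actions; turning them back into σ produces the factor ε(e₁'p₂').
  simp only [sweedler_comm (τ _) X, sweedler_comm Y Z, sweedler_comm Y X, sweedler_comm W Z,
    sweedler_comm W X, reconstruct, mul_smashAct_smashAct hB, sweedler_tmul, tmul_sweedler,
    mul_assoc, TensorProduct.tmul_smul, ← TensorProduct.smul_tmul']

end SmashBiproduct

end Smash

/-! ### Counits of partial projections and normalization -/

section Counit

variable {k : Type*} [Field k] {C D H E H' E' : Type*}
  [AddCommGroup C] [Module k C] [AddCommGroup D] [Module k D] [AddCommGroup H] [Module k H]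
  [AddCommGroup E] [Module k E] [AddCommGroup H'] [Module k H'] [AddCommGroup E'] [Module k E']
  [Coalgebra k C] [Coalgebra k D] [Coalgebra k H]

theorem lid_rTensor_counit_map {f : H →ₗ[k] C}
    (hf : ∀ x, counit (R := k) (f x) = counit (R := k) x) (g : H →ₗ[k] E) (R : H ⊗[k] H) :
    counitLeft k C E (TensorProduct.map f g R) =
      g (TensorProduct.lid k H ((counit (R := k) (A := H)).rTensor H R)) := by
  induction R with
  | zero => simp
  | add u v hu hv => simp only [map_add, hu, hv]
  | tmul x y => simp [hf]

theorem rid_lTensor_counit_map {f : H →ₗ[k] C}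
    (hf : ∀ x, counit (R := k) (f x) = counit (R := k) x) (g : H →ₗ[k] E) (R : H ⊗[k] H) :
    counitRight k E C (TensorProduct.map g f R) =
      g (TensorProduct.rid k H ((counit (R := k) (A := H)).lTensor H R)) := by
  induction R with
  | zero => simp
  | add u v hu hv => simp only [map_add, hu, hv]
  | tmul x y => simp [hf]

/-- Killing the second leg of a merged tensor replaces `u` by its counit contraction. When
normalization makes this contraction 1, only `t` is left. -/
theorem rTensor_counitRight_mergeRight (m : H' →ₗ[k] E →ₗ[k] E') (t : C ⊗[k] H') (u : D ⊗[k] E) :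
    (counitRight k C D).rTensor E' (mergeRight m (t ⊗ₜ[k] u)) =
      (m.flip (counitLeft k D E u)).lTensor C t := by
  rw [mergeRight_eq_sweedler, map_eq_sweedler (counitLeft k D E), lTensor_eq_sweedler]
  simp only [map_sweedler, LinearMap.rTensor_tmul, counitRight_tmul, counitLeft_tmul, map_smul,
    LinearMap.flip_apply, tmul_sweedler, TensorProduct.tmul_smul, sweedler_apply,
    LinearMap.smul_apply, ← TensorProduct.smul_tmul']

theorem rTensor_counitLeft_mergeRight (m : H' →ₗ[k] E →ₗ[k] E') (t : C ⊗[k] H') (u : D ⊗[k] E) :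
    (counitLeft k C D).rTensor E' (mergeRight m (t ⊗ₜ[k] u)) =
      (m (counitLeft k C H' t)).lTensor D u := by
  rw [mergeRight_eq_sweedler, map_eq_sweedler (counitLeft k C H'), lTensor_eq_sweedler,
    sweedler_comm]
  simp only [map_sweedler, LinearMap.rTensor_tmul, counitLeft_tmul, map_smul, sweedler_apply,
    LinearMap.smul_apply, tmul_sweedler, TensorProduct.smul_tmul]

theorem lTensor_mergeRight {H'' E'' F : Type*} [AddCommGroup H''] [Module k H''] [AddCommGroup E'']
    [Module k E''] [AddCommGroup F] [Module k F] {m : H' →ₗ[k] E →ₗ[k] E'}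
    {m' : H'' →ₗ[k] E'' →ₗ[k] F} {g : E' →ₗ[k] F} {f : H' →ₗ[k] H''} {f' : E →ₗ[k] E''}
    (hg : ∀ x y, g (m x y) = m' (f x) (f' y)) (t : C ⊗[k] H') (u : D ⊗[k] E) :
    g.lTensor (C ⊗[k] D) (mergeRight m (t ⊗ₜ[k] u)) =
      mergeRight m' (f.lTensor C t ⊗ₜ[k] f'.lTensor D u) := by
  rw [mergeRight_eq_sweedler, lTensor_eq_sweedler f, lTensor_eq_sweedler f']
  simp only [map_sweedler, LinearMap.lTensor_tmul, hg, sweedler_tmul, tmul_sweedler,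
    mergeRight_tmul]
  rw [sweedler_comm]

end Counit

section Smash

variable {k A B : Type*} [Field k]
  [Ring A] [Algebra k A] [Coalgebra k A] [Ring B] [Algebra k B] [Coalgebra k B]
  {σ : B ⊗[k] A →ₗ[k] A ⊗[k] B} {τ : A ⊗[k] B →ₗ[k] B ⊗[k] A}
  {W : B ⊗[k] B} {X : A ⊗[k] B} {Y : B ⊗[k] A} {Z : A ⊗[k] A}

theorem mergeRight_mul_eq_legsHB :
    mergeRight (LinearMap.mul k B) (X ⊗ₜ[k] W) = legsHB W X := by
  rw [mergeRight_eq_sweedler]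
  rfl

theorem mergeLeft_mul_eq_legsBH :
    mergeLeft (LinearMap.mul k B) (W ⊗ₜ[k] Y) = legsBH W Y := by
  rw [mergeLeft_eq_sweedler]
  rfl

theorem mergeRight_smashAct_eq_legsHA :
    mergeRight (smashAct σ) (legsAH τ X Z ⊗ₜ[k] Y) = legsHA σ τ X Y Z := by
  simp only [legsAH, legsHA, sweedler_tmul, map_sweedler, mergeRight_tmul_eq_sweedler,
    smashAct_eq_sweedler, tmul_sweedler, TensorProduct.tmul_smul, ← TensorProduct.smul_tmul',
    sweedler_comm (τ _) Y]

theorem counitLeft_legsBH (hB : IsCounitalAlgebra k B) (hW : IsNormalized W)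
    (hY : IsNormalized Y) : counitLeft k B (A ⊗[k] B) (legsBH W Y) = 1 ⊗ₜ[k] 1 := by
  have hW' : counitLeft k B B W = 1 := hW.left
  have hY' : counitLeft k B A Y = 1 := hY.left
  rw [← hW', ← hY', map_eq_sweedler (counitLeft k B B), map_eq_sweedler (counitLeft k B A)]
  simp only [legsBH, map_sweedler, counitLeft_tmul, hB.counit_mul, sweedler_tmul, tmul_sweedler,
    TensorProduct.tmul_smul, ← TensorProduct.smul_tmul', smul_sweedler, smul_smul]

theorem lTensor_counitLeft_legsBH (hY : IsNormalized Y) :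
    (counitLeft k A B).lTensor B (legsBH W Y) = W := by
  have hY' : counitRight k B A Y = 1 := hY.right
  trans sweedler W fun w₁ w₂ => (w₁ * counitRight k B A Y) ⊗ₜ[k] w₂
  · rw [map_eq_sweedler (counitRight k B A)]
    simp only [legsBH, map_sweedler, LinearMap.lTensor_tmul, counitLeft_tmul, counitRight_tmul,
      mul_sweedler, sweedler_tmul, mul_smul_comm, TensorProduct.smul_tmul]
  · simp only [hY', mul_one, sweedler_tmul_self]

theorem lTensor_counitRight_legsBH (hW : IsNormalized W) :
    (counitRight k A B).lTensor B (legsBH W Y) = Y := by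
  have hW' : counitRight k B B W = 1 := hW.right
  trans sweedler Y fun y₁ y₂ => (counitRight k B B W * y₁) ⊗ₜ[k] y₂
  · rw [map_eq_sweedler (counitRight k B B)]
    simp only [legsBH, map_sweedler, LinearMap.lTensor_tmul, counitRight_tmul,
      sweedler_mul, sweedler_tmul, smul_mul_assoc, TensorProduct.smul_tmul, sweedler_comm Y W]
  · simp only [hW', one_mul, sweedler_tmul_self]

theorem counitRight_legsHB (hB : IsCounitalAlgebra k B) (hW : IsNormalized W)
    (hX : IsNormalized X) : counitRight k (A ⊗[k] B) B (legsHB W X) = 1 ⊗ₜ[k] 1 := by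
  have hW' : counitRight k B B W = 1 := hW.right
  have hX' : counitRight k A B X = 1 := hX.right
  rw [← hW', ← hX', map_eq_sweedler (counitRight k B B), map_eq_sweedler (counitRight k A B)]
  simp only [legsHB, map_sweedler, counitRight_tmul, hB.counit_mul, sweedler_tmul, tmul_sweedler,
    TensorProduct.tmul_smul, ← TensorProduct.smul_tmul', smul_sweedler, smul_smul,
    sweedler_comm W X]
  simp only [mul_comm]

theorem counitLeft_legsAH (hτ : IsSmashCoproduct τ) (hA : IsCounitalAlgebra k A)
    (hX : IsNormalized X) (hZ : IsNormalized Z) :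
    counitLeft k A (A ⊗[k] B) (legsAH τ X Z) = 1 ⊗ₜ[k] 1 := by
  have hX' : counitLeft k A B X = 1 := hX.left
  have hZ' : counitLeft k A A Z = 1 := hZ.left
  trans sweedler Z fun z₁ z₂ =>
    z₂ ⊗ₜ[k] (counitRight k B A (τ (z₁ ⊗ₜ[k] 1)) * counitLeft k A B X)
  · rw [map_eq_sweedler (counitLeft k A B)]
    simp only [map_eq_sweedler (counitRight k B A) (τ _), legsAH, map_sweedler, counitLeft_tmul,
      counitRight_tmul, hA.counit_mul, mul_sweedler, sweedler_mul, tmul_sweedler,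
      TensorProduct.tmul_smul, smul_mul_assoc, mul_smul_comm, smul_sweedler, smul_smul]
    simp only [mul_comm]
  · simp only [hX', hτ.counitRight_apply, mul_one, TensorProduct.tmul_smul]
    rw [← hZ', map_eq_sweedler (counitLeft k A A)]
    simp only [counitLeft_tmul, sweedler_tmul, TensorProduct.smul_tmul']

theorem lTensor_counitRight_legsAH (hτ : IsSmashCoproduct τ) (hB : IsCounitalAlgebra k B)
    (hX : IsNormalized X) : (counitRight k A B).lTensor A (legsAH τ X Z) = Z := by
  have hX' : counitRight k A B X = 1 := hX.right
  trans sweedler Z fun z₁ z₂ =>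
    (counitLeft k B A (τ (z₁ ⊗ₜ[k] 1)) * counitRight k A B X) ⊗ₜ[k] z₂
  · rw [map_eq_sweedler (counitRight k A B)]
    simp only [map_eq_sweedler (counitLeft k B A) (τ _), legsAH, map_sweedler, counitLeft_tmul,
      LinearMap.lTensor_tmul, counitRight_tmul, hB.counit_mul, mul_sweedler, sweedler_mul,
      sweedler_tmul, TensorProduct.tmul_smul, smul_mul_assoc, mul_smul_comm, smul_sweedler,
      smul_smul, ← TensorProduct.smul_tmul']
    simp only [mul_comm]
  · simp only [hX', hτ.counitLeft_apply, hB.counit_one, mul_one, one_smul, sweedler_tmul_self]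

namespace SmashBiproduct

variable {h : IsSmashBiproduct σ τ}

/-- The unit of H is grouplike, and τ is (πB ⊗ πA)Δ. -/
theorem apply_one_tmul_one (h : IsSmashBiproduct σ τ) (hA : IsCounitalAlgebra k A)
    (hB : IsCounitalAlgebra k B) : τ ((1 : A) ⊗ₜ[k] (1 : B)) = 1 ⊗ₜ[k] 1 := by
  have := map_projB_projA h 1
  rw [Bialgebra.comul_one, Algebra.TensorProduct.one_def, TensorProduct.map_tmul, one_def,
    projA_apply, projB_apply, LinearEquiv.symm_apply_apply, counitLeft_tmul, counitRight_tmul,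
    hA.counit_one, hB.counit_one, one_smul, one_smul] at this
  exact this.symm

theorem lTensor_counitLeft_legsAH (h : IsSmashBiproduct σ τ) (hA : IsCounitalAlgebra k A)
    (hB : IsCounitalAlgebra k B) (hZ : IsNormalized Z) :
    (counitLeft k A B).lTensor A (legsAH τ X Z) = X := by
  have hZ' : counitRight k A A Z = 1 := hZ.right
  trans sweedler X fun x₁ x₂ => sweedler (τ (counitRight k A A Z ⊗ₜ[k] (1 : B))) fun e z =>
    (z * x₁) ⊗ₜ[k] (e * x₂)
  · have key (x₁ : A) (x₂ : B) (a : A) := map_eq_sweedler (TensorProduct.map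
      (LinearMap.mulRight k x₁) (LinearMap.mulRight k x₂) ∘ₗ
        (TensorProduct.comm k B A).toLinearMap) (τ (a ⊗ₜ[k] (1 : B)))
    simp only [LinearMap.comp_apply, LinearEquiv.coe_coe, TensorProduct.comm_tmul,
      TensorProduct.map_tmul, LinearMap.mulRight_apply] at key
    simp only [← key, map_eq_sweedler (counitRight k A A) Z]
    simp only [legsAH, ← LinearEquiv.coe_coe, map_sweedler, sweedler_tmul, counitRight_tmul,
      ← TensorProduct.smul_tmul', map_smul, LinearMap.lTensor_tmul, counitLeft_tmul,
      TensorProduct.tmul_smul, sweedler_comm X Z]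
    simp only [LinearEquiv.coe_coe, key, smul_sweedler]
  · have (x₁ : A) (x₂ : B) := map_eq_sweedler (TensorProduct.map
      (LinearMap.mulRight k x₁) (LinearMap.mulRight k x₂) ∘ₗ
        (TensorProduct.comm k B A).toLinearMap) (τ ((1 : A) ⊗ₜ[k] (1 : B)))
    simp only [apply_one_tmul_one h hA hB, LinearMap.comp_apply, LinearEquiv.coe_coe,
      TensorProduct.comm_tmul, TensorProduct.map_tmul, LinearMap.mulRight_apply, one_mul] at this
    simp only [hZ', apply_one_tmul_one h hA hB, ← this, sweedler_tmul_self]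

end SmashBiproduct

end Smash

/-! ### Factorization of R and the two directions of the theorem -/

namespace SmashBiproduct

variable {k A B : Type*} [Field k]
  [Ring A] [Algebra k A] [Coalgebra k A] [Ring B] [Algebra k B] [Coalgebra k B]
  {σ : B ⊗[k] A →ₗ[k] A ⊗[k] B} {τ : A ⊗[k] B →ₗ[k] B ⊗[k] A}
  {W : B ⊗[k] B} {X : A ⊗[k] B} {Y : B ⊗[k] A} {Z : A ⊗[k] A} {h : IsSmashBiproduct σ τ}
  {s : Finset (SmashBiproduct h × SmashBiproduct h)} {R : SmashBiproduct h ⊗[k] SmashBiproduct h}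

theorem counit_projA (x : SmashBiproduct h) :
    counit (R := k) (projA h x) = counit (R := k) x :=
  counit_counitRight _

theorem counit_projB (x : SmashBiproduct h) :
    counit (R := k) (projB h x) = counit (R := k) x :=
  counit_counitLeft _

theorem map_of_symm_alpha :
    TensorProduct.map (of h).symm.toLinearMap (of h).symm.toLinearMap (alpha h W X Y Z) =
      reconstruct σ τ W X Y Z := by
  rw [alpha, ← LinearMap.comp_apply, ← TensorProduct.map_comp, LinearEquiv.symm_comp,
    TensorProduct.map_id, LinearMap.id_apply]

theorem map_of_map_of_symm (R : SmashBiproduct h ⊗[k] SmashBiproduct h) :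
    TensorProduct.map (of h).toLinearMap (of h).toLinearMap
      (TensorProduct.map (of h).symm.toLinearMap (of h).symm.toLinearMap R) = R := by
  rw [← LinearMap.comp_apply, ← TensorProduct.map_comp, LinearEquiv.comp_symm,
    TensorProduct.map_id, LinearMap.id_apply]

/-- Because δ is the identity, a hexagon whose comultiplied legs are A and B has a projection of R
itself on one side. Left ones give (H,B), (H,A) and R; right ones give (B,H) and (A,H). -/
theorem isFactorization_of_projectedHexagons (hA : IsCounitalAlgebra k A)
    (hB : IsCounitalAlgebra k B) (hB' : IsUnitalCoalgebra k B)
    (hσ : IsRightConormal σ) (hR : R = ∑ i ∈ s, i.1 ⊗ₜ[k] i.2)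
    (hH : ProjectedHexagons s (projA h) (projB h))
    (hI : ProjectedIntertwining s (projA h) (projB h) (inclA h)) :
    IsFactorization h R (TensorProduct.map (projB h) (projB h) R)
      (TensorProduct.map (projA h) (projB h) R) (TensorProduct.map (projB h) (projA h) R)
      (TensorProduct.map (projA h) (projA h) R) := by
  have mA := projA_mul_eq_smashAct (h := h) hB
  have mB := projB_mul_eq_mul (h := h) hA hσ
  have hl : LeftHexagon s (projA h) (projB h) (of h).symm.toLinearMap :=
    hH.left_ABid.comp LinearMap.id LinearMap.id (of h).symm.toLinearMap
  have HB := (leftHexagon_iff_mergeRight (n := (of h).symm.toLinearMap) (ν := LinearMap.id) hR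
    (map_projA_projB h) mB).1 (hl.comp LinearMap.id LinearMap.id (counitLeft k A B))
  rw [LinearMap.rTensor_id, LinearMap.id_apply, mergeRight_mul_eq_legsHB] at HB
  have BH := (rightHexagon_iff_mergeLeft (n := (of h).symm.toLinearMap) (ν := LinearMap.id) hR
    (map_projA_projB h) mB).1 hH.right_BAB
  rw [LinearMap.lTensor_id, LinearMap.id_apply, mergeLeft_mul_eq_legsBH] at BH
  have AH := (rightHexagon_iff_mergeLeft (n := (of h).symm.toLinearMap) (ν := LinearMap.id) hR
    (map_projA_projB h) mA).1 hH.right_AAB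
  have HA := (leftHexagon_iff_mergeRight (n := (of h).symm.toLinearMap) (ν := LinearMap.id) hR
    (map_projA_projB h) mA).1 (hl.comp LinearMap.id LinearMap.id (counitRight k A B))
  have HH := (leftHexagon_iff_mergeRight (n := (of h).symm.toLinearMap) (ν := LinearMap.id) hR
    (map_projA_projB h) (of_symm_mul h)).1 hl
  -- This is `C2`. It has to be obtained before the other identities, since the formula for the
  -- (A,H) projection contains the action of W until `C2` replaces it by τ.
  have hC (a : A) := (mulComul_AB_iff hR hA hB hσ (inclA h a)).1 (LinearMap.congr_fun hI.AB a)
  simp only [HB, inclA_apply, LinearEquiv.symm_apply_apply,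
    mulComul_AB_inclA_iff h.toIsSmashProduct hB hB'] at hC
  have hC' := (rightHexagon_iff_mergeLeft hR (map_projB_projB h) mA).1 hH.right_ABB
  rw [HB] at hC'
  rw [LinearMap.lTensor_id, LinearMap.id_apply, HB, mergeLeft_legsHB hC] at AH
  change _ = legsAH τ _ _ at AH
  rw [LinearMap.rTensor_id, LinearMap.id_apply, AH, mergeRight_smashAct_eq_legsHA] at HA
  rw [LinearMap.rTensor_id, LinearMap.id_apply, AH, BH,
    ← reconstruct_eq_mergeRight h hA hB hB' hσ hC hC'] at HH
  exact ⟨rfl, rfl, rfl, rfl, HB, BH, AH, HA, HH⟩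

/-- α is the merge of `legsAH` and `legsBH`, and normalization makes the complementary contraction
of each equal to 1 ⊗ 1. So they are the (A,H) and (B,H) projections of α, and everything else is
obtained by projecting further. -/
theorem isFactorization_alpha (hA : IsCounitalAlgebra k A)
    (hB : IsCounitalAlgebra k B) (hB' : IsUnitalCoalgebra k B)
    (hσ : IsRightConormal σ) (hD : IsFactorDatum σ τ W X Y Z) :
    IsFactorization h (alpha h W X Y Z) W X Y Z := by
  obtain ⟨hW, hX, hY, hZ, hI⟩ := hD
  have hrec : reconstruct σ τ W X Y Z = mergeRight (TensorProduct.curry (smashMul σ))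
      (legsAH τ X Z ⊗ₜ[k] legsBH W Y) :=
    reconstruct_eq_mergeRight h hA hB hB' hσ hI.C2 (right_ABB_iff.2 hI.C16)
  have HH := map_of_symm_alpha (h := h) (W := W) (X := X) (Y := Y) (Z := Z)
  have AH : TensorProduct.map (projA h) (of h).symm.toLinearMap (alpha h W X Y Z) =
      legsAH τ X Z := by
    have e := congrArg ((counitRight k A B).rTensor (A ⊗[k] B)) HH
    rw [← LinearMap.comp_apply, LinearMap.rTensor_comp_map, hrec, rTensor_counitRight_mergeRight,
      counitLeft_legsBH hB hW hY] at e
    refine e.trans ?_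
    have : (TensorProduct.curry (smashMul σ)).flip ((1 : A) ⊗ₜ[k] (1 : B)) = LinearMap.id :=
      LinearMap.ext h.mul_one
    rw [this, LinearMap.lTensor_id, LinearMap.id_apply]
  have BH : TensorProduct.map (projB h) (of h).symm.toLinearMap (alpha h W X Y Z) =
      legsBH W Y := by
    have e := congrArg ((counitLeft k A B).rTensor (A ⊗[k] B)) HH
    rw [← LinearMap.comp_apply, LinearMap.rTensor_comp_map, hrec, rTensor_counitLeft_mergeRight,
      counitLeft_legsAH h.toIsSmashCoproduct hA hX hZ] at e
    refine e.trans ?_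
    have : TensorProduct.curry (smashMul σ) ((1 : A) ⊗ₜ[k] (1 : B)) = LinearMap.id :=
      LinearMap.ext h.one_mul
    rw [this, LinearMap.lTensor_id, LinearMap.id_apply]
  have AA := congrArg ((counitRight k A B).lTensor A) AH
  have AB := congrArg ((counitLeft k A B).lTensor A) AH
  have BA := congrArg ((counitRight k A B).lTensor B) BH
  have BB := congrArg ((counitLeft k A B).lTensor B) BH
  have HA := congrArg ((counitRight k A B).lTensor (A ⊗[k] B)) HH
  have HB := congrArg ((counitLeft k A B).lTensor (A ⊗[k] B)) HH
  rw [← LinearMap.comp_apply, LinearMap.lTensor_comp_map] at AA AB BA BB HA HB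
  rw [lTensor_counitRight_legsAH h.toIsSmashCoproduct hB hX] at AA
  rw [lTensor_counitLeft_legsAH h hA hB hZ] at AB
  rw [lTensor_counitRight_legsBH hW] at BA
  rw [lTensor_counitLeft_legsBH hY] at BB
  -- Projecting the last leg turns multiplication in H into the action on A; the other projection,
  -- below, turns it into multiplication in B.
  rw [hrec, lTensor_mergeRight (m' := smashAct σ) (f := LinearMap.id) (f' := counitRight k A B)
    (counitRight_smashMul hB), LinearMap.lTensor_id, LinearMap.id_apply,
    lTensor_counitRight_legsBH hW, mergeRight_smashAct_eq_legsHA] at HA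
  rw [hrec, lTensor_mergeRight (m' := LinearMap.mul k B) (f := counitLeft k A B)
    (f' := counitLeft k A B) (counitLeft_smashMul hA hσ), lTensor_counitLeft_legsAH h hA hB hZ,
    lTensor_counitLeft_legsBH hY, mergeRight_mul_eq_legsHB] at HB
  exact ⟨BB, AB, BA, AA, HB, BH, AH, HA, HH⟩

theorem isQuasitriangular_alpha (hA : IsCounitalAlgebra k A) (hA' : IsUnitalCoalgebra k A)
    (hB : IsCounitalAlgebra k B) (hB' : IsUnitalCoalgebra k B)
    (hσ : IsRightConormal σ) (hD : IsFactorDatum σ τ W X Y Z) :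
    IsQuasitriangular k (alpha h W X Y Z) := by
  have hF := isFactorization_alpha (h := h) hA hB hB' hσ hD
  obtain ⟨hW, hX, hY, hZ, hI⟩ := hD
  obtain ⟨s, hR⟩ := TensorProduct.exists_finset (alpha h W X Y Z)
  obtain ⟨⟨h8, h9, h10, h11, h12, h13, h14, h15, h16, h17, h18, h19⟩, hJ, hJ'⟩ :=
    (factorIdentities_iff hR hA hA' hB hB' hσ hF).1 hI
  have mA := projA_mul_eq_smashAct (h := h) hB
  have mB := projB_mul_eq_mul (h := h) hA hσ
  -- The twelve hexagons just obtained omit the three that compute. These three hold by the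
  -- factorization of α.
  have hl : LeftHexagon s (projA h) (projB h) (of h).symm.toLinearMap := by
    refine (leftHexagon_iff_mergeRight (n := (of h).symm.toLinearMap) (ν := LinearMap.id) hR
      (map_projA_projB h) (of_symm_mul h)).2 ?_
    rw [LinearMap.rTensor_id, LinearMap.id_apply, hF.HH, hF.AH, hF.BH]
    exact reconstruct_eq_mergeRight h hA hB hB' hσ hI.C2 (right_ABB_iff.2 hI.C16)
  have hAAB : RightHexagon s (projA h) (projA h) (projB h) := by
    refine (rightHexagon_iff_mergeLeft (n := (of h).symm.toLinearMap) (ν := LinearMap.id) hR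
      (map_projA_projB h) mA).2 ?_
    rw [LinearMap.lTensor_id, LinearMap.id_apply, hF.AH, hF.HB, hF.AA, mergeLeft_legsHB hI.C2]
    rfl
  have hBAB : RightHexagon s (projB h) (projA h) (projB h) := by
    refine (rightHexagon_iff_mergeLeft (n := (of h).symm.toLinearMap) (ν := LinearMap.id) hR
      (map_projA_projB h) mB).2 ?_
    rw [LinearMap.lTensor_id, LinearMap.id_apply, hF.BH, hF.BB, hF.BA, mergeLeft_mul_eq_legsBH]
  -- The counit of H factors through πA and through πB, so each normalization of R can be read off a
  -- half-projection.
  have hleft := lid_rTensor_counit_map counit_projA (of h).symm.toLinearMap (alpha h W X Y Z)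
  rw [hF.AH, counitLeft_legsAH h.toIsSmashCoproduct hA hX hZ] at hleft
  have hright := rid_lTensor_counit_map counit_projB (of h).symm.toLinearMap (alpha h W X Y Z)
  rw [hF.HB, counitRight_legsHB hB hW hX] at hright
  rw [hR, (isSplitting hA hB hB' hσ).isQuasitriangular_iff, ← hR]
  refine ⟨hleft.symm, hright.symm, ?_, hJ, hJ'⟩
  exact
    { left_ABid := hl.comp LinearMap.id LinearMap.id (of h).toLinearMap
      left_AAA := h8
      left_AAB := h9
      left_BAA := h10
      left_BAB := h11
      left_BBA := h12
      left_BBB := h13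
      right_AAB := hAAB
      right_BAB := hBAB
      right_AAA := h14
      right_ABA := h15
      right_ABB := h16
      right_BAA := h17
      right_BBA := h18
      right_BBB := h19 }

/-- The witnesses are the projections of R; their normalization comes from that of R, because πA and
πB preserve counits and units. -/
theorem exists_eq_alpha (hA : IsCounitalAlgebra k A) (hA' : IsUnitalCoalgebra k A)
    (hB : IsCounitalAlgebra k B) (hB' : IsUnitalCoalgebra k B)
    (hσ : IsRightConormal σ) (hQ : IsQuasitriangular k R) :
    ∃ (W : B ⊗[k] B) (X : A ⊗[k] B) (Y : B ⊗[k] A) (Z : A ⊗[k] A),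
      IsFactorDatum σ τ W X Y Z ∧ R = alpha h W X Y Z := by
  obtain ⟨s, hR⟩ := TensorProduct.exists_finset R
  have hP := hQ
  rw [hR, (isSplitting hA hB hB' hσ).isQuasitriangular_iff] at hP
  obtain ⟨-, -, hH, hJ, hJ'⟩ := hP
  have hF := isFactorization_of_projectedHexagons hA hB hB' hσ hR hH hJ
  have hI := (factorIdentities_iff hR hA hA' hB hB' hσ hF).2
    ⟨⟨hH.left_AAA, hH.left_AAB, hH.left_BAA, hH.left_BAB, hH.left_BBA, hH.left_BBB, hH.right_AAA,
      hH.right_ABA, hH.right_ABB, hH.right_BAA, hH.right_BBA, hH.right_BBB⟩, hJ, hJ'⟩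
  have oneA : projA h 1 = 1 := by simp [projA_apply, one_def, hB.counit_one]
  have oneB : projB h 1 = 1 := by simp [projB_apply, one_def, hA.counit_one]
  refine ⟨_, _, _, _, ⟨⟨?_, ?_⟩, ⟨?_, ?_⟩, ⟨?_, ?_⟩, ⟨?_, ?_⟩, hI⟩, ?_⟩
  · exact (lid_rTensor_counit_map counit_projB (projB h) R).trans (by rw [hQ.counit_left, oneB])
  · exact (rid_lTensor_counit_map counit_projB (projB h) R).trans (by rw [hQ.counit_right, oneB])
  · exact (lid_rTensor_counit_map counit_projA (projB h) R).trans (by rw [hQ.counit_left, oneB])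
  · exact (rid_lTensor_counit_map counit_projB (projA h) R).trans (by rw [hQ.counit_right, oneA])
  · exact (lid_rTensor_counit_map counit_projB (projA h) R).trans (by rw [hQ.counit_left, oneA])
  · exact (rid_lTensor_counit_map counit_projA (projB h) R).trans (by rw [hQ.counit_right, oneB])
  · exact (lid_rTensor_counit_map counit_projA (projA h) R).trans (by rw [hQ.counit_left, oneA])
  · exact (rid_lTensor_counit_map counit_projA (projA h) R).trans (by rw [hQ.counit_right, oneA])
  · rw [alpha, ← hF.HH, map_of_map_of_symm]

end SmashBiproduct

theorem theorem3p7 {k A B : Type*} [Field k]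
    [Ring A] [Algebra k A] [Coalgebra k A] [Ring B] [Algebra k B] [Coalgebra k B]
    (hA : IsCounitalAlgebra k A) (hA' : IsUnitalCoalgebra k A)
    (hB : IsCounitalAlgebra k B) (hB' : IsUnitalCoalgebra k B)
    (σ : B ⊗[k] A →ₗ[k] A ⊗[k] B) (τ : A ⊗[k] B →ₗ[k] B ⊗[k] A)
    (h : IsSmashBiproduct σ τ) (hσ : IsRightConormal σ) :
    ((∃ R : SmashBiproduct h ⊗[k] SmashBiproduct h, IsQuasitriangular k R) ↔
      ∃ (W : B ⊗[k] B) (X : A ⊗[k] B) (Y : B ⊗[k] A) (Z : A ⊗[k] A),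
        IsFactorDatum σ τ W X Y Z) ∧
    (∀ (W : B ⊗[k] B) (X : A ⊗[k] B) (Y : B ⊗[k] A) (Z : A ⊗[k] A),
      IsFactorDatum σ τ W X Y Z → IsQuasitriangular k (SmashBiproduct.alpha h W X Y Z)) ∧
    (∀ R : SmashBiproduct h ⊗[k] SmashBiproduct h, IsQuasitriangular k R →
      ∃ (W : B ⊗[k] B) (X : A ⊗[k] B) (Y : B ⊗[k] A) (Z : A ⊗[k] A),
        IsFactorDatum σ τ W X Y Z ∧ R = SmashBiproduct.alpha h W X Y Z) := by
  have hα (W : B ⊗[k] B) (X : A ⊗[k] B) (Y : B ⊗[k] A) (Z : A ⊗[k] A)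
      (hD : IsFactorDatum σ τ W X Y Z) : IsQuasitriangular k (SmashBiproduct.alpha h W X Y Z) :=
    SmashBiproduct.isQuasitriangular_alpha hA hA' hB hB' hσ hD
  have hex (R : SmashBiproduct h ⊗[k] SmashBiproduct h) (hQ : IsQuasitriangular k R) :=
    SmashBiproduct.exists_eq_alpha hA hA' hB hB' hσ hQ
  refine ⟨⟨?_, ?_⟩, hα, hex⟩
  · rintro ⟨R, hQ⟩
    obtain ⟨W, X, Y, Z, hD, -⟩ := hex R hQ
    exact ⟨W, X, Y, Z, hD⟩
  · rintro ⟨W, X, Y, Z, hD⟩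
    exact ⟨_, hα W X Y Z hD⟩
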